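/- Let $F_2$ be the free group on $x_1,x_2$, and let $\mathcal T_2$ be the kernel of the natural map $\mathrm{Out}(F_2)\to GL_2(\mathbb Z)$ given by abelianizing. Then $\mathcal T_2$ is trivial. Moreover, the spine of Outer space is described as follows. Let $X_2$ be the simplicial complex whose vertices are the equivalence classes of marked graphs $(\Gamma,g)$ of rank $2$. Here $\Gamma$ is a finite connected graph with all edges of length $1$, with no separating edges and no vertices of valence less than $3$, and $g$ is a homotopy equivalence from the standard rose $R_2$ to $\Gamma$; $(\Gamma,g)$ and $(\Gamma',g')$ are equivalent if $f\circ g\simeq g'$ for some isometry $f:\Gamma\to\Gamma'$. Simplices are spanned by chains of forest collapses. The group $\mathrm{Out}(F_2)$ acts on the right by precomposition; put $Y_2=X_2/\mathcal T_2$. A rose is a vertex given by a graph with one vertex. The star of a rose in $X_2$ is the union of the closed simplices containing it, and the star of a rose in $Y_2$ is the image of the star of a rose of $X_2$ lying over it. The label of an oriented edge $e$ of $(\Gamma,g)$ is the vector in $\mathbb Z^2$ whose $i$-th entry is the signed number of times $g(x_i)$ passes over $e$. A marking matrix of a rose has as rows the labels of its two edges (in either order, with any orientations). The norm of $v=(a,b)$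 is $|v|=(|a|,|b|)$, ordered lexicographically, and the norm of a rose with labels $v_1,v_2$, $|v_2|<|v_1|$, is $(|v_2|,|v_1|)$, ordered lexicographically. The descending link of a rose of $Y_2$ is the intersection of its star with the union of the stars of the roses of strictly smaller norm. A nonempty set of roses closed under taking roses of smaller norm defines an initial segment of $Y_2$, namely the union of their stars. Then: 1. The projection $X_2\to Y_2$ is a bijection on vertices, and $X_2$ and $Y_2$ are trees. 2. The star of each rose $\rho$ in $Y_2$ is an arc consisting of $\rho$, two further vertices $\theta_1\neq\theta_2$, and the two edges joining $\rho$ to them; it meets the union of the stars of the other roses exactly in $\{\theta_1,\theta_2\}$. 3. The descending link of the rose with the identity marking is empty, and the descending link of every other rose is a single point. 4. Every initial segment is a tree, and $Y_2$ is the union of the stars of its roses. 5. $Y_2$ is dual to the Farey graph, the graph on $\mathbb Q\cup\{\infty\}$ in which $b/a$ and $d/c$ are adjacent when $ad-bc=\pm1$ (with $1/0=\infty$). Sending $(\Gamma,g)$ to the set of slopes $b/a$ of the labels $(a,b)$ of its edges defines a bijection from the vertices of $Y_2$ to the edges and triangles of the Farey graph. The roses correspond to the Farey edges, a rose with marking matrix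 $\left(\begin{smallmatrix}a&b\\c&d\end{smallmatrix}\right)$ going to $\{b/a,d/c\}$, and two vertices lie in a common simplex of $Y_2$ if and only if one of the corresponding Farey cells contains the other. -/

import Mathlib

noncomputable section

namespace OutFn

/-! ### The group of outer automorphisms and the Torelli group -/

/-- The subgroup of inner automorphisms of `G`. -/
def Inn (G : Type*) [Group G] : Subgroup (MulAut G) := (MulAut.conj : G →* MulAut G).range

instance Inn_normal (G : Type*) [Group G] : (Inn G).Normal := by
  constructor
  rintro _ ⟨g, rfl⟩ φ
  refine ⟨φ g, ?_⟩
  ext x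
  simp [MulAut.conj_apply]

/-- `Out(F_n)`. -/
abbrev Out (n : ℕ) : Type := MulAut (FreeGroup (Fin n)) ⧸ Inn (FreeGroup (Fin n))

/-- The abelianization `F_n → ℤ^n`, sending `x_j` to the `j`-th standard basis vector. -/
def abelianize (n : ℕ) : FreeGroup (Fin n) →* Multiplicative (Fin n → ℤ) :=
  FreeGroup.lift fun j => Multiplicative.ofAdd (Pi.single j 1)

/-- The matrix of the endomorphism of `ℤ^n` induced by an endomorphism of `F_n`: its `j`-th
column is the class of the image of `x_j`. -/
def abMatrix {n : ℕ} (φ : FreeGroup (Fin n) →* FreeGroup (Fin n)) : Matrix (Fin n) (Fin n) ℤ :=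
  fun i j => (abelianize n (φ (FreeGroup.of j))).toAdd i

lemma ab_apply {n : ℕ} (φ : FreeGroup (Fin n) →* FreeGroup (Fin n)) (w : FreeGroup (Fin n)) :
    (abelianize n (φ w)).toAdd = (abMatrix φ).mulVec (abelianize n w).toAdd := by
  induction w using FreeGroup.induction_on with
  | C1 => simp
  | of j => ext i; simp [abelianize, abMatrix]
  | inv_of j h => simp only [map_inv, toAdd_inv, Matrix.mulVec_neg, h]
  | mul x y hx hy => simp only [map_mul, toAdd_mul, Matrix.mulVec_add, hx, hy]

/-- The homomorphism `Aut(F_n) → GL_n(ℤ)` given by abelianizing. -/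
def autToGL (n : ℕ) : MulAut (FreeGroup (Fin n)) →* GL (Fin n) ℤ :=
  MonoidHom.toHomUnits
    { toFun := fun φ => abMatrix φ.toMonoidHom
      map_one' := by
        ext i j
        simp [abMatrix, abelianize, Matrix.one_apply, Pi.single_apply]
      map_mul' := fun φ ψ => by
        ext i j
        have h := congrFun (ab_apply φ.toMonoidHom (ψ (FreeGroup.of j))) i
        simpa [abMatrix, Matrix.mul_apply, Matrix.mulVec, dotProduct] using h }

lemma Inn_le_ker (n : ℕ) : Inn (FreeGroup (Fin n)) ≤ (autToGL n).ker := by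
  rintro _ ⟨g, rfl⟩
  rw [MonoidHom.mem_ker]
  ext i j
  simp [autToGL, abMatrix, abelianize, Matrix.one_apply, Pi.single_apply]

/-- The natural homomorphism `Out(F_n) → GL_n(ℤ)`. -/
def outToGL (n : ℕ) : Out n →* GL (Fin n) ℤ :=
  QuotientGroup.lift (Inn (FreeGroup (Fin n))) (autToGL n) (Inn_le_ker n)

/-- The Torelli group `T_n`, the kernel of `Out(F_n) → GL_n(ℤ)`. -/
def Torelli (n : ℕ) : Subgroup (Out n) := (outToGL n).ker

/-! ### Finite graphs -/

/-- A finite graph (finite 1-dimensional cell complex): vertices, oriented edges ("darts"), the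
initial vertex of each dart, and orientation reversal. Loops and multiple edges are allowed. -/
structure FinGraph where
  V : Type
  D : Type
  finV : Finite V
  finD : Finite D
  src : D → V
  rev : D → D
  rev_rev : ∀ d, rev (rev d) = d
  rev_ne : ∀ d, rev d ≠ d

namespace FinGraph

/-- The terminal vertex of a dart. -/
def tgt (Γ : FinGraph) (d : Γ.D) : Γ.V := Γ.src (Γ.rev d)

/-- `Γ.IsWalk u l w`: the list of darts `l` is an edge path from `u` to `w`. -/
def IsWalk (Γ : FinGraph) : Γ.V → List Γ.D → Γ.V → Prop
  | u, [], w => u = w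
  | u, d :: l, w => Γ.src d = u ∧ Γ.IsWalk (Γ.tgt d) l w

/-- `u` and `w` are joined by an edge path all of whose darts satisfy `p`. -/
def Joined (Γ : FinGraph) (p : Γ.D → Prop) (u w : Γ.V) : Prop :=
  ∃ l, Γ.IsWalk u l w ∧ ∀ d ∈ l, p d

def Connected (Γ : FinGraph) : Prop := Nonempty Γ.V ∧ ∀ u w, Γ.Joined (fun _ => True) u w

/-- Removing the (open) edge underlying any dart `e` leaves a connected graph. -/
def NoSeparatingEdge (Γ : FinGraph) : Prop :=
  ∀ e u w, Γ.Joined (fun d => d ≠ e ∧ d ≠ Γ.rev e) u w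

def valence (Γ : FinGraph) (v : Γ.V) : ℕ := Nat.card {d : Γ.D // Γ.src d = v}

/-- A set of darts whose underlying edges contain no circuit. -/
def IsForest (Γ : FinGraph) (F : Γ.D → Prop) : Prop :=
  ∀ v l, Γ.IsWalk v l v → (∀ d ∈ l, F d) → l.IsChain (fun a b => b ≠ Γ.rev a) → l = []

/-- The group generated by the darts, with the reverse of a dart as its inverse (the free group
on the edges). Edge paths that are homotopic relative to their endpoints are exactly those edge
paths from `u` to `w` with the same class in this group. -/
abbrev EdgeGroup (Γ : FinGraph) : Type :=
  PresentedGroup (Set.range fun d : Γ.D => FreeGroup.of d * FreeGroup.of (Γ.rev d))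

def dartClass (Γ : FinGraph) (d : Γ.D) : Γ.EdgeGroup := PresentedGroup.of d

lemma dartClass_rev (Γ : FinGraph) (d : Γ.D) : Γ.dartClass (Γ.rev d) = (Γ.dartClass d)⁻¹ := by
  have h : (PresentedGroup.mk (Set.range fun d : Γ.D => FreeGroup.of d * FreeGroup.of (Γ.rev d)))
      (FreeGroup.of d * FreeGroup.of (Γ.rev d)) = 1 :=
    (QuotientGroup.eq_one_iff _).2 (Subgroup.subset_normalClosure ⟨d, rfl⟩)
  rw [map_mul] at h
  exact eq_inv_of_mul_eq_one_right h

/-- The homotopy class of an edge path. -/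
def pathClass (Γ : FinGraph) (l : List Γ.D) : Γ.EdgeGroup := (l.map Γ.dartClass).prod

/-- A homomorphism out of the edge group is given by the images of the darts. -/
def edgeLift (Γ : FinGraph) {H : Type*} [Group H] (f : Γ.D → H) (hf : ∀ d, f (Γ.rev d) = (f d)⁻¹) :
    Γ.EdgeGroup →* H :=
  PresentedGroup.toGroup (f := f) (by rintro _ ⟨d, rfl⟩; simp [hf])

lemma edgeLift_dartClass (Γ : FinGraph) {H : Type*} [Group H] (f : Γ.D → H)
    (hf : ∀ d, f (Γ.rev d) = (f d)⁻¹) (d : Γ.D) : Γ.edgeLift f hf (Γ.dartClass d) = f d :=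
  PresentedGroup.toGroup.of _

/-- Homotopy classes of edge paths from `u` to `w`. -/
def paths (Γ : FinGraph) (u w : Γ.V) : Set Γ.EdgeGroup :=
  {x | ∃ l, Γ.IsWalk u l w ∧ Γ.pathClass l = x}

lemma IsWalk.append {Γ : FinGraph} {l l' : List Γ.D} {u v w : Γ.V} (h : Γ.IsWalk u l v)
    (h' : Γ.IsWalk v l' w) : Γ.IsWalk u (l ++ l') w := by
  induction l generalizing u with
  | nil => cases h; exact h'
  | cons d l ih => exact ⟨h.1, ih h.2⟩

lemma IsWalk.reverse {Γ : FinGraph} {l : List Γ.D} {u w : Γ.V} (h : Γ.IsWalk u l w) :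
    Γ.IsWalk w (l.reverse.map Γ.rev) u := by
  induction l generalizing u with
  | nil => exact h.symm
  | cons d l ih =>
    simp only [List.reverse_cons, List.map_append, List.map_cons, List.map_nil]
    refine (ih h.2).append ⟨rfl, ?_⟩
    simpa [tgt, Γ.rev_rev, IsWalk] using h.1

lemma one_mem_paths (Γ : FinGraph) (u : Γ.V) : 1 ∈ Γ.paths u u := ⟨[], rfl, rfl⟩

lemma mul_mem_paths {Γ : FinGraph} {u v w : Γ.V} {x y : Γ.EdgeGroup} (hx : x ∈ Γ.paths u v)
    (hy : y ∈ Γ.paths v w) : x * y ∈ Γ.paths u w := by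
  obtain ⟨l, hl, rfl⟩ := hx
  obtain ⟨l', hl', rfl⟩ := hy
  exact ⟨l ++ l', hl.append hl', by simp [pathClass]⟩

lemma inv_mem_paths {Γ : FinGraph} {u w : Γ.V} {x : Γ.EdgeGroup} (hx : x ∈ Γ.paths u w) :
    x⁻¹ ∈ Γ.paths w u := by
  obtain ⟨l, hl, rfl⟩ := hx
  refine ⟨_, hl.reverse, ?_⟩
  simp only [pathClass, List.prod_inv_reverse, List.map_map, List.map_reverse]
  congr 2
  refine List.map_congr_left fun d _ => ?_
  exact Γ.dartClass_rev d

/-- The fundamental group `π_1(Γ, v)`: homotopy classes of closed edge paths at `v`. -/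
def fundGroup (Γ : FinGraph) (v : Γ.V) : Subgroup Γ.EdgeGroup where
  carrier := Γ.paths v v
  one_mem' := Γ.one_mem_paths v
  mul_mem' := mul_mem_paths
  inv_mem' := inv_mem_paths

open Classical in
/-- The homomorphism `Γ.EdgeGroup → ℤ` counting, with sign, the passages over the dart `d`. -/
def count (Γ : FinGraph) (d : Γ.D) : Γ.EdgeGroup →* Multiplicative ℤ :=
  Γ.edgeLift (fun e => Multiplicative.ofAdd
    ((if e = d then 1 else 0) - (if e = Γ.rev d then 1 else 0) : ℤ)) (by
      intro e
      have h1 : (Γ.rev e = d) ↔ (e = Γ.rev d) :=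
        ⟨fun h => by rw [← h, Γ.rev_rev], fun h => by rw [h, Γ.rev_rev]⟩
      have h2 : (Γ.rev e = Γ.rev d) ↔ (e = d) :=
        ⟨fun h => by rw [← Γ.rev_rev e, h, Γ.rev_rev], fun h => by rw [h]⟩
      rw [← ofAdd_neg, neg_sub]
      congr 2 <;> exact if_congr (by assumption) rfl rfl)

end FinGraph

/-- A graph isomorphism (equivalently, up to isotopy, an isometry between connected graphs with
all edges of length `1` and all valences at least `3`). -/
structure GraphIso (Γ Γ' : FinGraph) where
  onV : Γ.V ≃ Γ'.V
  onD : Γ.D ≃ Γ'.D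
  src_eq : ∀ d, Γ'.src (onD d) = onV (Γ.src d)
  rev_eq : ∀ d, onD (Γ.rev d) = Γ'.rev (onD d)

namespace GraphIso

def refl (Γ : FinGraph) : GraphIso Γ Γ := ⟨.refl _, .refl _, fun _ => rfl, fun _ => rfl⟩

def symm {Γ Γ' : FinGraph} (f : GraphIso Γ Γ') : GraphIso Γ' Γ where
  onV := f.onV.symm
  onD := f.onD.symm
  src_eq d := by rw [Equiv.eq_symm_apply, ← f.src_eq, Equiv.apply_symm_apply]
  rev_eq d := by rw [Equiv.symm_apply_eq, f.rev_eq, Equiv.apply_symm_apply]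

def trans {Γ Γ' Γ'' : FinGraph} (f : GraphIso Γ Γ') (g : GraphIso Γ' Γ'') : GraphIso Γ Γ'' where
  onV := f.onV.trans g.onV
  onD := f.onD.trans g.onD
  src_eq d := by simp [g.src_eq, f.src_eq]
  rev_eq d := by simp [g.rev_eq, f.rev_eq]

/-- The induced map on homotopy classes of edge paths. -/
def map {Γ Γ' : FinGraph} (f : GraphIso Γ Γ') : Γ.EdgeGroup →* Γ'.EdgeGroup :=
  Γ.edgeLift (fun d => Γ'.dartClass (f.onD d)) fun d => by rw [f.rev_eq, Γ'.dartClass_rev]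

lemma map_dartClass {Γ Γ' : FinGraph} (f : GraphIso Γ Γ') (d : Γ.D) :
    f.map (Γ.dartClass d) = Γ'.dartClass (f.onD d) := Γ.edgeLift_dartClass _ _ d

lemma map_refl (Γ : FinGraph) : (refl Γ).map = MonoidHom.id _ :=
  PresentedGroup.ext fun d => (refl Γ).map_dartClass d

lemma map_trans {Γ Γ' Γ'' : FinGraph} (f : GraphIso Γ Γ') (g : GraphIso Γ' Γ'') :
    (f.trans g).map = g.map.comp f.map :=
  PresentedGroup.ext fun d => by
    change (f.trans g).map (Γ.dartClass d) = g.map (f.map (Γ.dartClass d))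
    simp only [map_dartClass]; rfl

lemma symm_map_map {Γ Γ' : FinGraph} (f : GraphIso Γ Γ') (x : Γ.EdgeGroup) :
    f.symm.map (f.map x) = x := by
  have h : f.symm.map.comp f.map = MonoidHom.id _ := PresentedGroup.ext fun d => by
    change f.symm.map (f.map (Γ.dartClass d)) = Γ.dartClass d
    simp only [map_dartClass]
    congr 1
    exact f.onD.symm_apply_apply d
  exact DFunLike.congr_fun h x

lemma map_mem_paths {Γ Γ' : FinGraph} (f : GraphIso Γ Γ') {u w : Γ.V} {x : Γ.EdgeGroup}
    (hx : x ∈ Γ.paths u w) : f.map x ∈ Γ'.paths (f.onV u) (f.onV w) := by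
  obtain ⟨l, hl, rfl⟩ := hx
  refine ⟨l.map f.onD, ?_, ?_⟩
  · induction l generalizing u with
    | nil => exact congrArg f.onV hl
    | cons d l ih =>
      refine ⟨by rw [f.src_eq, hl.1], ?_⟩
      have := ih hl.2
      rwa [FinGraph.tgt, ← f.src_eq, f.rev_eq] at this
  · simp only [FinGraph.pathClass, map_list_prod, List.map_map]
    refine congrArg List.prod (List.map_congr_left fun d _ => (f.map_dartClass d).symm)

end GraphIso

/-- A map collapsing a forest: the darts sent to `none` form a forest, each component of which
is sent to a vertex, and everything else is mapped bijectively. -/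
structure ForestCollapse (Γ Γ' : FinGraph) where
  onV : Γ.V → Γ'.V
  onD : Γ.D → Option Γ'.D
  forest : Γ.IsForest fun d => onD d = none
  rev_eq : ∀ d, onD (Γ.rev d) = (onD d).map Γ'.rev
  src_eq : ∀ d d', onD d = some d' → Γ'.src d' = onV (Γ.src d)
  onD_bij : ∀ d', ∃! d, onD d = some d'
  onV_surj : Function.Surjective onV
  onV_eq_iff : ∀ u w, onV u = onV w ↔ Γ.Joined (fun d => onD d = none) u w

/-- The induced map on homotopy classes of edge paths: collapsed darts are deleted. -/
def ForestCollapse.map {Γ Γ' : FinGraph} (c : ForestCollapse Γ Γ') : Γ.EdgeGroup →* Γ'.EdgeGroup :=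
  Γ.edgeLift (fun d => (c.onD d).elim 1 Γ'.dartClass) fun d => by
    rw [c.rev_eq]
    cases c.onD d with
    | none => simp
    | some d' => exact Γ'.dartClass_rev d'

/-! ### Marked graphs and the spine of Outer space -/

/-- A marked graph of rank `n` with all edges of length `1`. The homotopy class of a homotopy
equivalence from the standard rose `R_n` to `Γ` is given by an isomorphism
`F_n ≃ π_1(Γ, base)`, up to the changes of base point in `MarkedGraph.Equiv`. -/
structure MarkedGraph (n : ℕ) extends FinGraph where
  connected : toFinGraph.Connected
  noSeparatingEdge : toFinGraph.NoSeparatingEdge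
  three_le_valence : ∀ v, 3 ≤ toFinGraph.valence v
  base : V
  marking : FreeGroup (Fin n) ≃* toFinGraph.fundGroup base

namespace MarkedGraph

variable {n : ℕ}

/-- The marking as a map into the group of homotopy classes of edge paths. -/
def mark (X : MarkedGraph n) : FreeGroup (Fin n) →* X.toFinGraph.EdgeGroup :=
  (X.toFinGraph.fundGroup X.base).subtype.comp X.marking.toMonoidHom

/-- `(Γ, g)` and `(Γ', g')` are equivalent: there is an isometry `f : Γ → Γ'` such that `f ∘ g` is
homotopic to `g'`; during the homotopy the base point runs along the path `p`. -/
def Equiv (X X' : MarkedGraph n) : Prop :=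
  ∃ f : GraphIso X.toFinGraph X'.toFinGraph, ∃ p ∈ X'.toFinGraph.paths (f.onV X.base) X'.base,
    ∀ x, f.map (X.mark x) = p * X'.mark x * p⁻¹

/-- `(Γ', g')` is obtained from `(Γ, g)` by collapsing a forest `c : Γ → Γ'`, i.e. `c ∘ g` is
homotopic to `g'`. -/
def CollapsesTo (X X' : MarkedGraph n) : Prop :=
  ∃ c : ForestCollapse X.toFinGraph X'.toFinGraph, ∃ p ∈ X'.toFinGraph.paths (c.onV X.base) X'.base,
    ∀ x, c.map (X.mark x) = p * X'.mark x * p⁻¹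

lemma Equiv.refl (X : MarkedGraph n) : X.Equiv X :=
  ⟨GraphIso.refl _, 1, X.toFinGraph.one_mem_paths _, fun x => by simp [GraphIso.map_refl]⟩

lemma Equiv.symm {X X' : MarkedGraph n} (h : X.Equiv X') : X'.Equiv X := by
  obtain ⟨f, p, hp, hx⟩ := h
  refine ⟨f.symm, f.symm.map p⁻¹, ?_, fun x => ?_⟩
  · have := f.symm.map_mem_paths (FinGraph.inv_mem_paths hp)
    rwa [show f.symm.onV (f.onV X.base) = X.base from f.onV.symm_apply_apply _] at this
  · have : X'.mark x = p⁻¹ * f.map (X.mark x) * p := by rw [hx]; group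
    rw [this, map_mul, map_mul, f.symm_map_map, map_inv, inv_inv]

lemma Equiv.trans {X X' X'' : MarkedGraph n} (h : X.Equiv X') (h' : X'.Equiv X'') :
    X.Equiv X'' := by
  obtain ⟨f, p, hp, hx⟩ := h
  obtain ⟨g, q, hq, hy⟩ := h'
  refine ⟨f.trans g, g.map p * q, FinGraph.mul_mem_paths (g.map_mem_paths hp) hq, fun x => ?_⟩
  rw [GraphIso.map_trans, MonoidHom.comp_apply, hx, map_mul, map_mul, hy, map_inv]
  group

instance setoid (n : ℕ) : Setoid (MarkedGraph n) := ⟨Equiv, Equiv.refl, Equiv.symm, Equiv.trans⟩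

/-- The marked graph `(Γ, g ∘ φ)`. -/
def precomp (X : MarkedGraph n) (φ : MulAut (FreeGroup (Fin n))) : MarkedGraph n :=
  { X with marking := φ.trans X.marking }

lemma precomp_equiv {X X' : MarkedGraph n} (h : X.Equiv X') (φ : MulAut (FreeGroup (Fin n))) :
    (X.precomp φ).Equiv (X'.precomp φ) := by
  obtain ⟨f, p, hp, hx⟩ := h
  exact ⟨f, p, hp, fun x => hx (φ x)⟩

lemma precomp_inn (X : MarkedGraph n) (φ : MulAut (FreeGroup (Fin n)))
    (w : FreeGroup (Fin n)) : (X.precomp (φ * MulAut.conj w)).Equiv (X.precomp φ) := by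
  refine ⟨GraphIso.refl _, X.mark (φ w), (X.marking (φ w)).2, fun x => ?_⟩
  refine (DFunLike.congr_fun (GraphIso.map_refl X.toFinGraph) _).trans ?_
  change X.mark (φ (w * x * w⁻¹)) = X.mark (φ w) * X.mark (φ x) * (X.mark (φ w))⁻¹
  simp only [map_mul, map_inv]

end MarkedGraph

/-- The vertices of `X_n`: equivalence classes of marked graphs with edges of length `1`. -/
def SpineVertex (n : ℕ) : Type 1 := Quotient (MarkedGraph.setoid n)

/-- The right action of `Out(F_n)`: `(Γ, g) · φ = (Γ, g ∘ φ)`. -/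
def SpineVertex.act {n : ℕ} (φ : Out n) : SpineVertex n → SpineVertex n :=
  Quotient.map' (s₂ := MarkedGraph.setoid n) (fun X => X.precomp φ.out)
    fun _ _ h => MarkedGraph.precomp_equiv h _

lemma SpineVertex.act_mk {n : ℕ} (φ : MulAut (FreeGroup (Fin n))) (X : MarkedGraph n) :
    SpineVertex.act (QuotientGroup.mk φ) (Quotient.mk _ X) = Quotient.mk _ (X.precomp φ) := by
  obtain ⟨⟨_, w, rfl⟩, hw⟩ := QuotientGroup.mk_out_eq_mul (Inn (FreeGroup (Fin n))) φ
  refine Quotient.sound (s := MarkedGraph.setoid n) ?_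
  change (X.precomp (Quotient.out _)).Equiv _
  rw [hw]
  exact X.precomp_inn φ w

instance (n : ℕ) : MulAction (Out n)ᵐᵒᵖ (SpineVertex n) where
  smul φ x := SpineVertex.act φ.unop x
  one_smul x := by
    induction x using Quotient.inductionOn with
    | h X => exact SpineVertex.act_mk 1 X
  mul_smul φ ψ x := by
    obtain ⟨a, ha⟩ := QuotientGroup.mk_surjective φ.unop
    obtain ⟨b, hb⟩ := QuotientGroup.mk_surjective ψ.unop
    induction x using Quotient.inductionOn with
    | h X =>
      change SpineVertex.act (ψ.unop * φ.unop) _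
        = SpineVertex.act φ.unop (SpineVertex.act ψ.unop _)
      rw [← ha, ← hb, ← QuotientGroup.mk_mul, SpineVertex.act_mk, SpineVertex.act_mk,
        SpineVertex.act_mk]
      rfl

/-- `y` is obtained from `x` by collapsing a forest. -/
def SpineVertex.CollapsesTo {n : ℕ} (x y : SpineVertex n) : Prop :=
  ∃ X Y : MarkedGraph n, x = Quotient.mk _ X ∧ y = Quotient.mk _ Y ∧ X.CollapsesTo Y

/-- The spine `X_n` of Outer space: the vertices are the classes of marked graphs, and a finite
set of vertices spans a simplex if any two of its elements are related by a forest collapse. -/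
def Spine (n : ℕ) : PreAbstractSimplicialComplex (SpineVertex n) where
  faces := {s | s.Nonempty ∧ IsChain SpineVertex.CollapsesTo (s : Set (SpineVertex n))}
  isRelLowerSet_faces := fun _ hs => ⟨hs.1, fun _ hts ht => ⟨ht, hs.2.mono (by exact_mod_cast hts)⟩⟩

/-- The vertices of `Y_n`: the orbits of `T_n` on the vertices of `X_n`. -/
abbrev QuotVertex (n : ℕ) : Type 1 := MulAction.orbitRel.Quotient (Torelli n).op (SpineVertex n)

/-- The projection `X_n → Y_n` on vertices. -/
def quotProj {n : ℕ} (x : SpineVertex n) : QuotVertex n := Quotient.mk _ x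

/-- The vertex of `Y_n` given by a marked graph. -/
def MarkedGraph.toQuot {n : ℕ} (X : MarkedGraph n) : QuotVertex n :=
  quotProj (Quotient.mk _ X)

open Classical in
/-- The image of a subcomplex of `X_n` in the quotient by `T_n`. -/
def imageInQuot {n : ℕ} (K : PreAbstractSimplicialComplex (SpineVertex n)) :
    PreAbstractSimplicialComplex (QuotVertex n) := K.map quotProj

/-- The quotient `Y_n = X_n / T_n`; its simplices are the images of the simplices of `X_n`. -/
def QuotSpine (n : ℕ) : PreAbstractSimplicialComplex (QuotVertex n) := imageInQuot (Spine n)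

/-- The union of the closed simplices of `K` that contain the vertex `v`. -/
def closedStar {ι : Type*} (K : PreAbstractSimplicialComplex ι) (v : ι) :
    PreAbstractSimplicialComplex ι where
  faces := {s | s.Nonempty ∧ ∃ t ∈ K.faces, v ∈ t ∧ s ⊆ t}
  isRelLowerSet_faces := fun _ hs =>
    ⟨hs.1, fun _ hts ht => ⟨ht, hs.2.imp fun _ h => ⟨h.1, h.2.1, hts.trans h.2.2⟩⟩⟩

/-- The star of a vertex of `Y_n`: the image of the star of any vertex of `X_n` above it. -/
def quotStar {n : ℕ} (y : QuotVertex n) : PreAbstractSimplicialComplex (QuotVertex n) :=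
  ⨆ x ∈ {x : SpineVertex n | quotProj x = y}, imageInQuot (closedStar (Spine n) x)

/-- The graph formed by the vertices and edges of a simplicial complex. -/
def oneSkeleton {ι : Type*} (K : PreAbstractSimplicialComplex ι) :
    SimpleGraph {v : ι // {v} ∈ K.faces} where
  Adj u w := u ≠ w ∧ ∃ s ∈ K.faces, (u : ι) ∈ s ∧ (w : ι) ∈ s
  symm := ⟨fun _ _ h => ⟨h.1.symm, h.2.imp fun _ hs => ⟨hs.1, hs.2.2, hs.2.1⟩⟩⟩
  loopless := ⟨fun _ h => h.1 rfl⟩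

/-- A simplicial complex that is a tree: it has no simplices of dimension at least `2`, and the
graph of its vertices and edges is a (nonempty) tree. -/
def IsTreeComplex {ι : Type*} (K : PreAbstractSimplicialComplex ι) : Prop :=
  (∀ s ∈ K.faces, s.card ≤ 2) ∧ (oneSkeleton K).IsTree

/-! ### Labels, roses, and the ordering of the roses of `Y_n` -/

/-- The label of the dart `d`: its `i`-th entry is the number of times, counted with sign, that
`g(x_i)` runs over `d`. -/
def MarkedGraph.label {n : ℕ} (X : MarkedGraph n) (d : X.D) : Fin n → ℤ :=
  fun i => (X.toFinGraph.count d (X.mark (FreeGroup.of i))).toAdd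

/-- A rose is a graph with exactly one vertex. -/
def MarkedGraph.IsRose {n : ℕ} (X : MarkedGraph n) : Prop := Nat.card X.V = 1

def IsRose {n : ℕ} (y : QuotVertex n) : Prop := ∃ X : MarkedGraph n, X.toQuot = y ∧ X.IsRose

/-- `M` is a marking matrix of `y`: `y` is given by a rose, and the rows of `M` are the labels of
its edges, with some ordering of the edges and some choice of orientations. -/
def HasMarkingMatrix {n : ℕ} (y : QuotVertex n) (M : Matrix (Fin n) (Fin n) ℤ) : Prop :=
  ∃ X : MarkedGraph n, X.toQuot = y ∧ X.IsRose ∧ ∃ e : Fin n → X.D,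
    (∀ d, ∃! i, d = e i ∨ d = X.rev (e i)) ∧ ∀ i, M i = X.label (e i)

/-- The norm `(|a_1|, …, |a_n|)` of a vector, in the lexicographically ordered set `ℕ^n`. -/
def vecNorm {n : ℕ} (v : Fin n → ℤ) : Lex (Fin n → ℕ) := toLex fun i => (v i).natAbs

/-- The norm `(|v_n|, …, |v_1|)` of the matrix with rows `v_1, …, v_n`, in the lexicographic
order. -/
def matNorm {n : ℕ} (M : Matrix (Fin n) (Fin n) ℤ) : Lex (Fin n → Lex (Fin n → ℕ)) :=
  toLex fun i => vecNorm (M i.rev)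

/-- The norms of the rows satisfy `|v_n| < ⋯ < |v_1|`. -/
def IsStandard {n : ℕ} (M : Matrix (Fin n) (Fin n) ℤ) : Prop := StrictAnti fun i => vecNorm (M i)

/-- The norm of the rose `y` is smaller than the norm of the rose `y'`, the norm of a rose being
that of its standard marking matrix. -/
def RoseLT {n : ℕ} (y y' : QuotVertex n) : Prop :=
  ∃ M M', HasMarkingMatrix y M ∧ IsStandard M ∧ HasMarkingMatrix y' M' ∧ IsStandard M' ∧
    matNorm M < matNorm M'

/-- The descending link: the intersection of the star of `y` with the union of the stars of all
roses of smaller norm. -/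
def descendingLink {n : ℕ} (y : QuotVertex n) : PreAbstractSimplicialComplex (QuotVertex n) :=
  quotStar y ⊓ ⨆ z ∈ {z | RoseLT z y}, quotStar z

/-! ### The Farey graph -/

/-- The slope `b/a ∈ ℚ ∪ {∞}` of the vector `(a, b)`. -/
def fareySlope (v : Fin 2 → ℤ) : OnePoint ℚ :=
  if v 0 = 0 then OnePoint.infty else (((v 1 : ℚ) / (v 0 : ℚ) : ℚ) : OnePoint ℚ)

/-- The Farey graph: `b/a` and `d/c` are adjacent if `ad - bc = ±1`. -/
def fareyGraph : SimpleGraph (OnePoint ℚ) :=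
  SimpleGraph.fromRel fun p q => ∃ v w : Fin 2 → ℤ,
    (v 0 * w 1 - v 1 * w 0 = 1 ∨ v 0 * w 1 - v 1 * w 0 = -1) ∧ p = fareySlope v ∧ q = fareySlope w

/-- The edges and the triangles of the Farey graph. -/
def FareyCell : Type :=
  {s : Finset (OnePoint ℚ) // fareyGraph.IsNClique 2 s ∨ fareyGraph.IsNClique 3 s}

end OutFn

end

open OutFn

namespace OutFn

/-! ### Reduced words without cancellation -/

section Words

open FreeGroup

variable {α : Type*}

/-! Everything rests on the injectivity of Out(F_2) → GL_2(ℤ). Nielsen's theorem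
(`nielsenSubgroup_eq_top`) provides three generators of Out(F_2): a swap s, an inversion t and a
transvection u. Its proof views an automorphism as a map from a theta graph to the rose with edge
images A, B, C, chosen of least total length. Minimality rules out cancellation, and if no edge
image were trivial, every nontrivial element would have an image of length at least two
(`two_le_norm_of_theta`), against surjectivity. So the map comes from a rose, and absence of
cancellation makes it a signed permutation of the generators (`exists_letter_of_rose`). The
relations among s, t, u bring every outer class into the form w p w', with w, w' in ⟨s, t⟩ and p a
positive product of transvections (`exists_normal_form`). Column sums of matrices separate
nontrivial p from signed permutations, so the kernel is trivial (`torelli_two_eq_bot`).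

Consequently a marked graph is determined by its graph together with its labels
(`MarkedGraph.equiv_of_label_eq`). Counting edges leaves two shapes, rose and theta. The labels of a
rose form a basis of ℤ²; those of a theta, with all edges oriented from one vertex to the other, sum
to zero and are pairwise bases. Primitive vectors up to sign are the same as slopes, so the set of
slopes is a complete invariant (`MarkedGraph.equiv_of_slopes_eq`). Roses become Farey edges, thetas
become Farey triangles, and collapsing becomes inclusion. All cells occur because every integral
matrix of determinant ±1 lifts to Aut(F_2) (`exists_rose_theta`).

What remains is the combinatorics of the Farey graph. An edge v, w lies in exactly two triangles,
with third vertices v + w and v - w. Each triangle has an edge spanned by v, w in a common closed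
quadrant; then v + w has larger norm than both, so this edge has the least norm
(`Unimod.pairNorm_lt`). An edge other than the standard one can be written as v, w in a common
quadrant with v - w, w in a common quadrant too (`Unimod.exists_descent`): it is least in the
triangle of v, w, but not in the triangle of v - w, w. So exactly one of its two triangles leads to
a smaller edge. `roseOrder` records these facts. Sending a theta to its least rose, and a rose to
its descending theta, is a parent function along which a well-founded height drops, so initial
segments are trees (`RoseOrder.isTreeComplex_iSup_star`). -/

lemma isReduced_invRev_iff {w : List (α × Bool)} : IsReduced (invRev w) ↔ IsReduced w := by
  classical
  rw [isReduced_iff_reduce_eq, isReduced_iff_reduce_eq, reduce_invRev, invRev_injective.eq_iff]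

lemma isReduced_invRev_append_invRev {v w : List (α × Bool)} :
    IsReduced (invRev v ++ invRev w) ↔ IsReduced (w ++ v) := by
  rw [← invRev_append, isReduced_invRev_iff]

lemma invRev_ne_nil {w : List (α × Bool)} (h : w ≠ []) : invRev w ≠ [] := by
  intro h'
  exact h (invRev_injective h')

lemma exists_cons_of_not_isReduced {v w : List (α × Bool)} (hv : IsReduced v) (hw : IsReduced w)
    (h : ¬ IsReduced (invRev v ++ w)) : ∃ a v' w', v = a :: v' ∧ w = a :: w' := by
  cases v with
  | nil => exact absurd (by simpa using hw) h
  | cons a v =>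
    cases w with
    | nil => exact absurd (by simpa using isReduced_invRev_iff.2 hv) h
    | cons b w =>
      refine ⟨a, v, w, rfl, ?_⟩
      by_contra hab
      refine h (List.isChain_append.2 ⟨isReduced_invRev_iff.2 hv, hw, ?_⟩)
      intro x hx y hy hxy
      rw [invRev_cons, show invRev [a] = [(a.1, !a.2)] from rfl, List.getLast?_concat] at hx
      simp only [Option.mem_def, Option.some.injEq, List.head?_cons] at hx hy
      subst hx hy
      by_contra hne
      exact hab (by rw [show b = a from Prod.ext hxy.symm (by revert hne; cases a.2 <;> cases b.2 <;> simp)])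

/-- If the words `A i` and `C` begin with pairwise different letters and end with pairwise
different letters, the subgroup generated by the elements `A i * C⁻¹` contains no element of
length one. -/
lemma exists_word_of_theta (f : FreeGroup α →* FreeGroup α) (A : α → List (α × Bool))
    (C : List (α × Bool)) (hf : ∀ i, f (of i) = mk (A i) * (mk C)⁻¹) (hC : C ≠ [])
    (hA : ∀ i, A i ≠ [])
    (hAA : ∀ i j, i ≠ j → IsReduced (invRev (A i) ++ A j) ∧ IsReduced (A i ++ invRev (A j)))
    (hAC : ∀ i, IsReduced (invRev (A i) ++ C) ∧ IsReduced (A i ++ invRev C)) :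
    ∀ (l : α × Bool) (L : List (α × Bool)), IsReduced (l :: L) → ∃ t,
      t ≠ [] ∧ IsReduced ((if l.2 then A l.1 else C ++ invRev (A l.1)) ++ t) ∧
      f (mk (l :: L)) = mk ((if l.2 then A l.1 else C ++ invRev (A l.1)) ++ t) ∨
      (l.2 = false ∧ f (mk (l :: L)) = mk (C ++ invRev (A l.1))) := by
  have hCA : ∀ i, IsReduced (invRev C ++ A i) ∧ IsReduced (C ++ invRev (A i)) := fun i => by
    have h1 := (isReduced_invRev_iff (w := invRev (A i) ++ C)).2 (hAC i).1
    have h2 := (isReduced_invRev_iff (w := A i ++ invRev C)).2 (hAC i).2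
    rw [invRev_append, invRev_invRev] at h1 h2
    exact ⟨h1, h2⟩
  have hC' := invRev_ne_nil hC
  have hA' : ∀ i, invRev (A i) ≠ [] := fun i => invRev_ne_nil (hA i)
  intro l L
  induction L generalizing l with
  | nil =>
    intro _
    obtain ⟨i, b⟩ := l
    cases b
    · refine ⟨[], Or.inr ⟨rfl, ?_⟩⟩
      have : (mk [(i, false)] : FreeGroup α) = (of i)⁻¹ := rfl
      rw [this, _root_.map_inv, hf, mul_inv_rev, inv_inv, inv_mk, mul_mk]
    · refine ⟨invRev C, Or.inl ⟨hC', by simpa using (hAC i).2, ?_⟩⟩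
      have : (mk [(i, true)] : FreeGroup α) = of i := rfl
      simp [this, hf, inv_mk, mul_mk]
  | cons m L ih =>
    intro hred
    obtain ⟨i, b⟩ := l
    obtain ⟨j, c⟩ := m
    obtain ⟨hlm, hmL⟩ := isReduced_cons_cons.1 hred
    have hcons : (mk ((i, b) :: (j, c) :: L) : FreeGroup α) = mk [(i, b)] * mk ((j, c) :: L) := by
      rw [mul_mk]; rfl
    rw [hcons, _root_.map_mul]
    -- The recursion uses only that the image of the tail starts with its expected first piece and
    -- is reduced; both outcomes of the induction hypothesis provide this.
    have key : ∃ t', IsReduced ((if c then A j else C ++ invRev (A j)) ++ t') ∧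
        f (mk ((j, c) :: L)) = mk ((if c then A j else C ++ invRev (A j)) ++ t') := by
      obtain ⟨t', ⟨-, h1, h2⟩ | ⟨h1, h2⟩⟩ := ih (j, c) hmL
      · exact ⟨t', h1, h2⟩
      · refine ⟨[], ?_, ?_⟩
        · simp only at h1
          simpa [h1] using (hCA j).2
        · simp only at h1 h2
          simpa [h1] using h2
    obtain ⟨t', h1, h2⟩ := key
    rw [h2]
    cases b
    · have hfi : f (mk [(i, false)]) = mk (C ++ invRev (A i)) := by
        have : (mk [(i, false)] : FreeGroup α) = (of i)⁻¹ := rfl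
        rw [this, _root_.map_inv, hf, mul_inv_rev, inv_inv, inv_mk, mul_mk]
      rw [hfi, mul_mk]
      refine ⟨(if c then A j else C ++ invRev (A j)) ++ t', Or.inl ⟨?_, ?_, rfl⟩⟩
      · cases c <;> simp [hA j, hC]
      · cases c
        · simp only [Bool.false_eq_true, if_false] at h1 ⊢
          have h3 := IsReduced.append_overlap (hCA i).2 (hAC i).1 (hA' i)
          have := IsReduced.append_overlap (L₁ := C ++ invRev (A i)) (L₂ := C)
            (L₃ := invRev (A j) ++ t') h3 (by simpa using h1) hC
          simpa using this
        · simp only [if_true, Bool.false_eq_true, if_false] at h1 ⊢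
          have hij : i ≠ j := by
            rintro rfl
            simpa using hlm rfl
          have h3 := IsReduced.append_overlap (hCA i).2 (hAA i j hij).1 (hA' i)
          have := IsReduced.append_overlap (L₁ := C ++ invRev (A i)) (L₂ := A j)
            (L₃ := t') h3 (by simpa using h1) (hA j)
          simpa using this
    · have hfi : f (mk [(i, true)]) = mk (A i ++ invRev C) := by
        have : (mk [(i, true)] : FreeGroup α) = of i := rfl
        rw [this, hf, inv_mk, mul_mk]
      rw [hfi, mul_mk]
      cases c
      -- The only cancellation: `A i * C⁻¹` meets `C * (A j)⁻¹`, the middle disappears, and `A i`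
      -- against `(A j)⁻¹` is reduced because `i ≠ j`.
      · have hij : i ≠ j := by
          rintro rfl
          simpa using hlm rfl
        simp only [if_true, Bool.false_eq_true, if_false] at h1 ⊢
        refine ⟨invRev (A j) ++ t', Or.inl ⟨by simp [hA' j], ?_, ?_⟩⟩
        · have h3 : IsReduced (invRev (A j) ++ t') := h1.infix ⟨C, [], by simp⟩
          simpa using IsReduced.append_overlap (hAA i j hij).2 h3 (hA' j)
        · simp only [← mul_mk, ← inv_mk]
          group
      · simp only [if_true] at h1 ⊢
        refine ⟨invRev C ++ A j ++ t', Or.inl ⟨by simp [hA j], ?_, by simp⟩⟩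
        have h3 := IsReduced.append_overlap (hAC i).2 (hCA j).1 hC'
        simpa using IsReduced.append_overlap (L₁ := A i ++ invRev C) h3 h1 (hA j)

/-- In both outcomes of `exists_word_of_theta` the reduced word of the image is a concatenation of
at least two nonempty pieces. -/
lemma two_le_norm_of_theta [DecidableEq α] (f : FreeGroup α →* FreeGroup α)
    (A : α → FreeGroup α)
    (C : FreeGroup α) (hf : ∀ i, f (of i) = A i * C⁻¹) (hC : C ≠ 1)
    (hA : ∀ i, A i ≠ 1)
    (hAA : ∀ i j, i ≠ j → IsReduced ((A i)⁻¹.toWord ++ (A j).toWord) ∧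
      IsReduced ((A i).toWord ++ (A j)⁻¹.toWord))
    (hAC : ∀ i, IsReduced ((A i)⁻¹.toWord ++ C.toWord) ∧ IsReduced ((A i).toWord ++ C⁻¹.toWord))
    (w : FreeGroup α) (hw : w ≠ 1) : 2 ≤ (f w).norm := by
  simp only [toWord_inv] at hAA hAC
  have hC' : C.toWord ≠ [] := by simpa using hC
  have hA' : ∀ i, (A i).toWord ≠ [] := by simpa using hA
  have key := exists_word_of_theta f (fun i => (A i).toWord) C.toWord (by simpa [mk_toWord] using hf)
    hC' hA' hAA hAC
  obtain ⟨l, L, hL⟩ : ∃ l L, w.toWord = l :: L :=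
    List.exists_cons_of_ne_nil (by simpa using hw)
  have hred : IsReduced (l :: L) := hL ▸ isReduced_toWord
  have hlen : ∀ u : List (α × Bool), u ≠ [] → 1 ≤ u.length := fun u hu =>
    List.length_pos_iff.2 hu
  have h1 := hlen _ hC'
  have h2 := hlen _ (hA' l.1)
  obtain ⟨t, ⟨ht, h3, h4⟩ | ⟨h3, h4⟩⟩ := key l L hred
  · have h5 := hlen _ ht
    rw [← hL, mk_toWord] at h4
    rw [h4, FreeGroup.norm, toWord_mk, h3.reduce_eq]
    split_ifs <;> simp <;> omega
  · rw [← hL, mk_toWord] at h4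
    have h5 : IsReduced (C.toWord ++ invRev (A l.1).toWord) := by
      have := (isReduced_invRev_iff).2 (hAC l.1).2
      rwa [invRev_append, invRev_invRev] at this
    rw [h4, FreeGroup.norm, toWord_mk, h5.reduce_eq]
    simp; omega

/-- If no cancellation occurs between (inverses of) the images of different generators, elements of
length one in the image of `f` are images of generators or their inverses. -/
lemma exists_letter_of_rose [DecidableEq α] (f : FreeGroup α →* FreeGroup α)
    (hne : ∀ i, f (of i) ≠ 1)
    (hf : ∀ l m : α × Bool, l.1 ≠ m.1 → IsReduced ((f (mk [l])).toWord ++ (f (mk [m])).toWord))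
    (w : FreeGroup α) (hw : (f w).norm = 1) : ∃ l, w = mk [l] := by
  let c : α → List (α × Bool) := fun i => reduceCyclically.conjugator (f (of i)).toWord
  let k : α × Bool → List (α × Bool) := fun l =>
    if l.2 then reduceCyclically (f (of l.1)).toWord
    else invRev (reduceCyclically (f (of l.1)).toWord)
  have hword : ∀ l, (f (mk [l])).toWord = c l.1 ++ k l ++ invRev (c l.1) := by
    rintro ⟨i, b⟩
    have h := reduceCyclically.conj_conjugator_reduceCyclically (f (of i)).toWord
    cases b
    · have : (mk [(i, false)] : FreeGroup α) = (of i)⁻¹ := rfl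
      rw [this, _root_.map_inv, toWord_inv]
      nth_rewrite 1 [← h]
      simp [c, k, invRev_append]
    · have : (mk [(i, true)] : FreeGroup α) = of i := rfl
      rw [this]
      nth_rewrite 1 [← h]
      simp [c, k]
  have hk : ∀ l, k l ≠ [] := by
    intro l hl
    refine hne l.1 (toWord_eq_nil_iff.1 ?_)
    have h := reduceCyclically.conj_conjugator_reduceCyclically (f (of l.1)).toWord
    have h0 : reduceCyclically (f (of l.1)).toWord = [] := by
      by_cases hb : l.2
      · simpa [k, hb] using hl
      · have : invRev (reduceCyclically (f (of l.1)).toWord) = [] := by simpa [k, hb] using hl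
        exact invRev_injective this
    have h2 : (mk (f (of l.1)).toWord : FreeGroup α) = 1 := by
      rw [← h, h0, List.append_nil, ← mul_mk, ← inv_mk, mul_inv_cancel]
    rw [mk_toWord] at h2
    rw [h2, toWord_one]
  have hkk : ∀ l, IsReduced (k l ++ k l) := by
    intro l
    have h := ((reduceCyclically.isCyclicallyReduced
      (isReduced_toWord (x := f (of l.1)))).flatten_replicate 2).isReduced
    have h' : IsReduced (reduceCyclically (f (of l.1)).toWord ++
      reduceCyclically (f (of l.1)).toWord) := by simpa [List.replicate] using h
    by_cases hb : l.2
    · simpa [k, hb] using h'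
    · simpa [k, hb, isReduced_invRev_append_invRev] using h'
  -- Cancellation occurs only between equal neighbouring letters, where the conjugators `(c l)⁻¹`
  -- and `c l` meet, and it stops there because `k l` is cyclically reduced. Each letter thus keeps
  -- its nonempty core `k l`, and two letters give length at least two.
  have main : ∀ (L : List (α × Bool)) (l : α × Bool), IsReduced (l :: L) → ∃ t,
      (f (mk (l :: L))).toWord = c l.1 ++ k l ++ t ∧ (L ≠ [] → t ≠ []) := by
    intro L
    induction L with
    | nil => exact fun l _ => ⟨_, hword l, by simp⟩
    | cons m L ih =>
      intro l hred
      obtain ⟨hlm, hmL⟩ := isReduced_cons_cons.1 hred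
      obtain ⟨t, ht, -⟩ := ih m hmL
      have hcons : (mk (l :: m :: L) : FreeGroup α) = mk [l] * mk (m :: L) := by
        rw [mul_mk]; rfl
      have hrt : IsReduced (c m.1 ++ k m ++ t) := ht ▸ isReduced_toWord
      have hmul : f (mk (l :: m :: L)) = mk (c l.1 ++ k l ++ invRev (c l.1) ++ (c m.1 ++ k m ++ t)) := by
        rw [hcons, _root_.map_mul, ← ht, ← hword, ← mul_mk, mk_toWord, mk_toWord]
      by_cases h : l.1 = m.1
      · have hl : l = m := Prod.ext h (hlm h)
        subst hl
        refine ⟨k l ++ t, ?_, fun _ => by simp [hk l]⟩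
        have h1 : f (mk (l :: l :: L)) = mk (c l.1 ++ k l ++ (k l ++ t)) := by
          rw [hmul]
          simp only [← mul_mk, ← inv_mk]
          group
        rw [h1, toWord_mk]
        refine IsReduced.reduce_eq ?_
        have h2 : IsReduced (c l.1 ++ k l ++ k l) :=
          IsReduced.append_overlap (hrt.infix ⟨[], t, by simp⟩) (hkk l) (hk l)
        have := IsReduced.append_overlap (L₃ := t) h2 (hrt.infix ⟨c l.1, [], by simp⟩) (hk l)
        simpa using this
      · refine ⟨invRev (c l.1) ++ (c m.1 ++ k m ++ t), ?_, fun _ => by simp [hk m]⟩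
        rw [hmul, toWord_mk]
        have h1 := hf l m h
        rw [hword, hword] at h1
        have h2 : IsReduced ((c l.1 ++ k l ++ invRev (c l.1)) ++ (c m.1 ++ k m)) :=
          h1.infix ⟨[], invRev (c m.1), by simp⟩
        have := IsReduced.append_overlap (L₁ := c l.1 ++ k l ++ invRev (c l.1))
          (L₂ := c m.1 ++ k m) (L₃ := t) h2 hrt (by simp [hk m])
        rw [← List.append_assoc, this.reduce_eq]
        simp
  have hw1 : w ≠ 1 := by rintro rfl; simp at hw
  obtain ⟨l, L, hL⟩ : ∃ l L, w.toWord = l :: L :=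
    List.exists_cons_of_ne_nil (by simpa using hw1)
  obtain ⟨t, ht, htL⟩ := main L l (hL ▸ isReduced_toWord)
  rw [← hL, mk_toWord] at ht
  have hlen : 1 ≤ (k l).length := List.length_pos_iff.2 (hk l)
  rw [FreeGroup.norm, ht] at hw
  simp only [List.length_append] at hw
  have hLnil : L = [] := by
    by_contra hne'
    have : 1 ≤ t.length := List.length_pos_iff.2 (htL hne')
    omega
  exact ⟨l, by rw [← hLnil, ← hL, mk_toWord]⟩

/-- If two reduced words begin with the same letter, cancelling it shortens both. -/
lemma exists_norm_inv_mul [DecidableEq α] {v w : FreeGroup α}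
    (h : ¬ IsReduced (v⁻¹.toWord ++ w.toWord)) :
    ∃ g : FreeGroup α, g.norm = 1 ∧ (g⁻¹ * v).norm + 1 = v.norm ∧
      (g⁻¹ * w).norm + 1 = w.norm := by
  rw [toWord_inv] at h
  obtain ⟨a, v', w', hv, hw⟩ := exists_cons_of_not_isReduced isReduced_toWord isReduced_toWord h
  have key : ∀ (u : FreeGroup α) (u' : List (α × Bool)), u.toWord = a :: u' →
      ((mk [a])⁻¹ * u).norm + 1 = u.norm := by
    intro u u' hu
    have h1 : (mk [a])⁻¹ * u = mk u' := by
      rw [inv_mul_eq_iff_eq_mul, mul_mk, ← mk_toWord (x := u), hu]; rfl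
    have h2 : IsReduced u' := (hu ▸ isReduced_toWord (x := u)).infix ⟨[a], [], by simp⟩
    rw [h1, FreeGroup.norm, toWord_mk, h2.reduce_eq, FreeGroup.norm, hu, List.length_cons]
  exact ⟨mk [a], by simp [FreeGroup.norm, toWord_mk], key v v' hv, key w w' hw⟩

end Words

end OutFn

namespace OutFn

/-! ### Nielsen generators of `Aut(F_2)` -/

noncomputable section Nielsen

open FreeGroup

/-- `F_2`. -/
abbrev F2 : Type := FreeGroup (Fin 2)

/-- The endomorphism of `F_2` with `x_1 ↦ u`, `x_2 ↦ v`. -/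
def pairHom (u v : F2) : F2 →* F2 := FreeGroup.lift ![u, v]

@[simp] lemma pairHom_zero (u v : F2) : pairHom u v (of 0) = u := by simp [pairHom]

@[simp] lemma pairHom_one (u v : F2) : pairHom u v (of 1) = v := by simp [pairHom]

lemma hom_ext_F2 {G : Type*} [Group G] {f g : F2 →* G} (h0 : f (of 0) = g (of 0))
    (h1 : f (of 1) = g (of 1)) : f = g := by
  refine FreeGroup.ext_hom _ _ fun i => ?_
  fin_cases i
  · exact h0
  · exact h1

lemma aut_ext_F2 {f g : MulAut F2} (h0 : f (of 0) = g (of 0)) (h1 : f (of 1) = g (of 1)) :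
    f = g :=
  MulEquiv.toMonoidHom_injective (hom_ext_F2 (f := f.toMonoidHom) (g := g.toMonoidHom) h0 h1)

/-- The automorphism given by a pair of inverse endomorphisms. -/
def pairAut (u v u' v' : F2) (h0 : pairHom u' v' u = of 0) (h1 : pairHom u' v' v = of 1)
    (h0' : pairHom u v u' = of 0) (h1' : pairHom u v v' = of 1) : MulAut F2 :=
  MonoidHom.toMulEquiv (pairHom u v) (pairHom u' v') (hom_ext_F2 (by simpa) (by simpa))
    (hom_ext_F2 (by simpa) (by simpa))

lemma pairAut_apply {u v u' v' : F2} {h0 h1 h0' h1'} (w : F2) :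
    pairAut u v u' v' h0 h1 h0' h1' w = pairHom u v w := rfl

/-- `x_1 ↔ x_2`. -/
def swapAut : MulAut F2 := pairAut (of 1) (of 0) (of 1) (of 0) (by simp) (by simp) (by simp) (by simp)

/-- `x_1 ↦ x_1⁻¹`. -/
def invAut : MulAut F2 :=
  pairAut (of 0)⁻¹ (of 1) (of 0)⁻¹ (of 1) (by simp) (by simp) (by simp) (by simp)

/-- `x_1 ↦ x_1 x_2`. -/
def mulAut : MulAut F2 :=
  pairAut (of 0 * of 1) (of 1) (of 0 * (of 1)⁻¹) (of 1) (by simp) (by simp) (by simp) (by simp)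

@[simp] lemma swapAut_zero : swapAut (of 0) = of 1 := by simp [swapAut, pairAut_apply]
@[simp] lemma swapAut_one : swapAut (of 1) = of 0 := by simp [swapAut, pairAut_apply]
@[simp] lemma invAut_zero : invAut (of 0) = (of 0)⁻¹ := by simp [invAut, pairAut_apply]
@[simp] lemma invAut_one : invAut (of 1) = of 1 := by simp [invAut, pairAut_apply]
@[simp] lemma mulAut_zero : mulAut (of 0) = of 0 * of 1 := by simp [mulAut, pairAut_apply]
@[simp] lemma mulAut_one : mulAut (of 1) = of 1 := by simp [mulAut, pairAut_apply]

@[simp] lemma swapAut_mul_self : swapAut * swapAut = 1 := aut_ext_F2 (by simp) (by simp)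
@[simp] lemma invAut_mul_self : invAut * invAut = 1 := aut_ext_F2 (by simp) (by simp)

@[simp] lemma swapAut_inv : swapAut⁻¹ = swapAut := inv_eq_of_mul_eq_one_left swapAut_mul_self
@[simp] lemma invAut_inv : invAut⁻¹ = invAut := inv_eq_of_mul_eq_one_left invAut_mul_self

/-- The subgroup of `Aut(F_2)` generated by the elementary Nielsen automorphisms and the inner
automorphisms. -/
def nielsenSubgroup : Subgroup (MulAut F2) :=
  Inn F2 ⊔ Subgroup.closure {swapAut, invAut, mulAut}

lemma swapAut_mem : swapAut ∈ nielsenSubgroup :=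
  Subgroup.mem_sup_right (Subgroup.subset_closure (by simp))

lemma invAut_mem : invAut ∈ nielsenSubgroup :=
  Subgroup.mem_sup_right (Subgroup.subset_closure (by simp))

lemma mulAut_mem : mulAut ∈ nielsenSubgroup :=
  Subgroup.mem_sup_right (Subgroup.subset_closure (by simp))

lemma conj_mem (g : F2) : MulAut.conj g ∈ nielsenSubgroup :=
  Subgroup.mem_sup_left ⟨g, rfl⟩

/-- `(A, B, C)` are the images of the edges of a theta graph, under a map to the rose inducing an
automorphism in the left coset of `φ` modulo Nielsen automorphisms. -/
def ThetaTriple (φ : MulAut F2) (A B C : F2) : Prop :=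
  ∃ ν ∈ nielsenSubgroup, φ (ν (of 0)) = A * C⁻¹ ∧ φ (ν (of 1)) = B * C⁻¹

namespace ThetaTriple

variable {φ : MulAut F2} {A B C : F2}

lemma mul_right (h : ThetaTriple φ A B C) (g : F2) : ThetaTriple φ (A * g) (B * g) (C * g) := by
  obtain ⟨ν, hν, h0, h1⟩ := h
  exact ⟨ν, hν, by rw [h0]; group, by rw [h1]; group⟩

/-- Conjugation by `g` after `φ` is conjugation by `φ⁻¹ g` before it, an inner factor that
`nielsenSubgroup` absorbs. -/
lemma mul_left (h : ThetaTriple φ A B C) (g : F2) : ThetaTriple φ (g * A) (g * B) (g * C) := by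
  obtain ⟨ν, hν, h0, h1⟩ := h
  refine ⟨MulAut.conj (φ⁻¹ g) * ν, mul_mem (conj_mem _) hν, ?_, ?_⟩
  · simp only [MulAut.mul_apply, MulAut.conj_apply, _root_.map_mul, _root_.map_inv,
      MulAut.apply_inv_self, h0]
    group
  · simp only [MulAut.mul_apply, MulAut.conj_apply, _root_.map_mul, _root_.map_inv,
      MulAut.apply_inv_self, h1]
    group

lemma swap (h : ThetaTriple φ A B C) : ThetaTriple φ B A C := by
  obtain ⟨ν, hν, h0, h1⟩ := h
  exact ⟨ν * swapAut, mul_mem hν swapAut_mem, by simpa using h1, by simpa using h0⟩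

/-- The change of generators is x₁ ↦ x₁⁻¹, x₂ ↦ x₂ x₁⁻¹, because B A⁻¹ = (B C⁻¹)(A C⁻¹)⁻¹. -/
lemma swap_left_right (h : ThetaTriple φ A B C) : ThetaTriple φ C B A := by
  obtain ⟨ν, hν, h0, h1⟩ := h
  refine ⟨ν * (invAut * (swapAut * mulAut * swapAut)), mul_mem hν (mul_mem invAut_mem (mul_mem
    (mul_mem swapAut_mem mulAut_mem) swapAut_mem)), ?_, ?_⟩
  · simp only [MulAut.mul_apply, invAut_zero, _root_.map_inv, swapAut_zero, mulAut_one, swapAut_one,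
      h0]
    group
  · simp only [MulAut.mul_apply, invAut_one, swapAut_one, mulAut_zero, _root_.map_mul, swapAut_zero,
      invAut_zero, _root_.map_inv, h0, h1]
    group

/-- With the third edge trivial, A and B are the petals of a rose and can be reversed independently.
-/
lemma inv_right (h : ThetaTriple φ A B 1) : ThetaTriple φ A B⁻¹ 1 := by
  obtain ⟨ν, hν, h0, h1⟩ := h
  refine ⟨ν * (swapAut * invAut * swapAut), mul_mem hν (mul_mem (mul_mem
    swapAut_mem invAut_mem) swapAut_mem), ?_, ?_⟩
  · simpa using h0
  · simpa using h1

/-- The total length of the edges is minimal. -/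
def IsMinimal (φ : MulAut F2) (A B C : F2) : Prop :=
  ThetaTriple φ A B C ∧
    ∀ A' B' C', ThetaTriple φ A' B' C' → A.norm + B.norm + C.norm ≤ A'.norm + B'.norm + C'.norm

lemma exists_isMinimal (φ : MulAut F2) : ∃ A B C, IsMinimal φ A B C := by
  let S : Set (F2 × F2 × F2) := {p | ThetaTriple φ p.1 p.2.1 p.2.2}
  have hS : S.Nonempty := ⟨(φ (of 0), φ (of 1), 1), 1, one_mem _, by simp, by simp⟩
  let m : F2 × F2 × F2 → ℕ := fun p => p.1.norm + p.2.1.norm + p.2.2.norm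
  refine ⟨_, _, _, Function.argminOn_mem m S hS, fun A' B' C' h => ?_⟩
  exact Function.argminOn_le m S (a := (A', B', C')) h

namespace IsMinimal

lemma swap (h : IsMinimal φ A B C) : IsMinimal φ B A C :=
  ⟨h.1.swap, fun A' B' C' h' => by have := h.2 A' B' C' h'; omega⟩

lemma swap_left_right (h : IsMinimal φ A B C) : IsMinimal φ C B A :=
  ⟨h.1.swap_left_right, fun A' B' C' h' => by have := h.2 A' B' C' h'; omega⟩

lemma inv_right (h : IsMinimal φ A B 1) : IsMinimal φ A B⁻¹ 1 :=
  ⟨h.1.inv_right, fun A' B' C' h' => by have := h.2 A' B' C' h'; simpa using this⟩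

/-- If A and B began with the same letter g, multiplying all three edges by g⁻¹ would shorten A and
B by one each and lengthen C by at most one, against minimality. -/
lemma isReduced_left (h : IsMinimal φ A B C) : IsReduced (A⁻¹.toWord ++ B.toWord) := by
  by_contra hr
  obtain ⟨g, hg, h1, h2⟩ := exists_norm_inv_mul hr
  have h3 := h.2 _ _ _ (h.1.mul_left g⁻¹)
  have h4 := norm_mul_le g⁻¹ C
  rw [norm_inv_eq] at h4
  omega

lemma isReduced_right (h : IsMinimal φ A B C) : IsReduced (A.toWord ++ B⁻¹.toWord) := by
  by_contra hr
  obtain ⟨g, hg, h1, h2⟩ := exists_norm_inv_mul (v := A⁻¹) (w := B⁻¹) (by rwa [inv_inv])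
  have h3 := h.2 _ _ _ (h.1.mul_right g)
  have h4 := norm_mul_le C g
  have h5 : (A * g).norm = (g⁻¹ * A⁻¹).norm := by rw [← norm_inv_eq, mul_inv_rev]
  have h6 : (B * g).norm = (g⁻¹ * B⁻¹).norm := by rw [← norm_inv_eq, mul_inv_rev]
  rw [norm_inv_eq] at h1 h2
  omega

/-- Otherwise minimality gives the hypotheses of `two_le_norm_of_theta`, so no generator is in the
image of the automorphism φν. -/
lemma exists_eq_one (h : IsMinimal φ A B C) : A = 1 ∨ B = 1 ∨ C = 1 := by
  by_contra! hne
  obtain ⟨ν, -, h0, h1⟩ := h.1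
  let ψ := φ * ν
  have hb := h.swap_left_right
  have hc := h.swap.swap_left_right
  have := two_le_norm_of_theta ψ.toMonoidHom ![A, B] C (by
      intro i; fin_cases i
      · exact h0
      · exact h1) hne.2.2 (by
      intro i; fin_cases i
      · exact hne.1
      · exact hne.2.1) (by
      intro i j hij
      fin_cases i <;> fin_cases j
      · exact absurd rfl hij
      · exact ⟨h.isReduced_left, h.isReduced_right⟩
      · exact ⟨h.swap.isReduced_left, h.swap.isReduced_right⟩
      · exact absurd rfl hij) (by
      intro i
      fin_cases i
      · exact ⟨hc.swap.isReduced_left,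
          hc.swap.isReduced_right⟩
      · exact ⟨hb.swap.isReduced_left, hb.swap.isReduced_right⟩) (ψ⁻¹ (of 0)) (by
      simp)
  have h2 : ψ.toMonoidHom (ψ⁻¹ (of 0)) = of 0 := ψ.apply_symm_apply _
  rw [h2, norm_of] at this
  omega

end IsMinimal

end ThetaTriple

lemma closure_signed_le : Subgroup.closure {swapAut, invAut} ≤ nielsenSubgroup := by
  rw [Subgroup.closure_le]
  rintro _ (rfl | rfl)
  · exact swapAut_mem
  · exact invAut_mem

/-- An automorphism that permutes the generators up to inversion. -/
lemma mem_closure_signed {ψ : MulAut F2} (h : ∀ i, ∃ l, ψ (of i) = mk [l]) :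
    ψ ∈ Subgroup.closure {swapAut, invAut} := by
  set W := Subgroup.closure {swapAut, invAut} with hW
  have hs : swapAut ∈ W := Subgroup.subset_closure (by simp)
  have ht : invAut ∈ W := Subgroup.subset_closure (by simp)
  obtain ⟨⟨i, a⟩, h0⟩ := h 0
  obtain ⟨⟨j, b⟩, h1⟩ := h 1
  have hf : ∀ k : Fin 2, (mk [(k, false)] : F2) = (of k)⁻¹ := fun _ => rfl
  have ht' : ∀ k : Fin 2, (mk [(k, true)] : F2) = of k := fun _ => rfl
  have hij : i ≠ j := by
    rintro rfl
    have h01 : ψ (of 0) = ψ (of 1) ∨ ψ (of 0) = ψ (of 1)⁻¹ := by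
      rw [_root_.map_inv, h0, h1]
      cases a <;> cases b <;> simp [hf, ht']
    rcases h01 with h01 | h01
    · simpa using congrArg toWord (ψ.injective h01)
    · simpa [invRev] using congrArg toWord (ψ.injective h01)
  have hcases : ψ = 1 ∨ ψ = invAut ∨ ψ = swapAut * invAut * swapAut ∨
      ψ = invAut * (swapAut * invAut * swapAut) ∨ ψ = swapAut ∨ ψ = swapAut * invAut ∨
      ψ = invAut * swapAut ∨ ψ = invAut * swapAut * invAut := by
    fin_cases i <;> fin_cases j <;> first | exact absurd rfl hij | skip
    · cases a <;> cases b <;> simp only [hf, ht', Fin.zero_eta, Fin.mk_one] at h0 h1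
      · exact Or.inr <| Or.inr <| Or.inr <| Or.inl <| aut_ext_F2 (by simp [h0]) (by simp [h1])
      · exact Or.inr <| Or.inl <| aut_ext_F2 (by simp [h0]) (by simp [h1])
      · exact Or.inr <| Or.inr <| Or.inl <| aut_ext_F2 (by simp [h0]) (by simp [h1])
      · exact Or.inl <| aut_ext_F2 (by simp [h0]) (by simp [h1])
    · cases a <;> cases b <;> simp only [hf, ht', Fin.zero_eta, Fin.mk_one] at h0 h1 <;>
        refine Or.inr <| Or.inr <| Or.inr <| Or.inr ?_
      · exact Or.inr <| Or.inr <| Or.inr <| aut_ext_F2 (by simp [h0]) (by simp [h1])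
      · exact Or.inr <| Or.inl <| aut_ext_F2 (by simp [h0]) (by simp [h1])
      · exact Or.inr <| Or.inr <| Or.inl <| aut_ext_F2 (by simp [h0]) (by simp [h1])
      · exact Or.inl <| aut_ext_F2 (by simp [h0]) (by simp [h1])
  have hsts := W.mul_mem (W.mul_mem hs ht) hs
  rcases hcases with h | h | h | h | h | h | h | h <;> rw [h]
  exacts [W.one_mem, ht, hsts, W.mul_mem ht hsts, hs, W.mul_mem hs ht, W.mul_mem ht hs,
    W.mul_mem (W.mul_mem ht hs) ht]

/-- **Nielsen's theorem** in rank two. -/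
theorem nielsenSubgroup_eq_top : nielsenSubgroup = ⊤ := by
  rw [Subgroup.eq_top_iff']
  intro φ
  obtain ⟨A, B, C, h⟩ := ThetaTriple.exists_isMinimal φ
  obtain ⟨A, B, h⟩ : ∃ A B, ThetaTriple.IsMinimal φ A B 1 := by
    rcases h.exists_eq_one with rfl | rfl | rfl
    · exact ⟨_, _, h.swap_left_right⟩
    · exact ⟨_, _, h.swap.swap_left_right⟩
    · exact ⟨_, _, h⟩
  obtain ⟨ν, hν, h0, h1⟩ := h.1
  let ψ := φ * ν
  have h0' : ψ (of 0) = A := h0.trans (by simp)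
  have h1' : ψ (of 1) = B := h1.trans (by simp)
  have hf : ∀ k : Fin 2, (mk [(k, false)] : F2) = (of k)⁻¹ := fun _ => rfl
  have ht' : ∀ k : Fin 2, (mk [(k, true)] : F2) = of k := fun _ => rfl
  -- Since C = 1, minimality persists when B is replaced by B⁻¹; together with the swap this covers
  -- all sign patterns.
  have hAB : IsReduced (A.toWord ++ B.toWord) ∧ IsReduced (A.toWord ++ B⁻¹.toWord) ∧
      IsReduced (A⁻¹.toWord ++ B.toWord) ∧ IsReduced (A⁻¹.toWord ++ B⁻¹.toWord) :=
    ⟨by simpa using h.inv_right.isReduced_right, h.isReduced_right, h.isReduced_left,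
      h.inv_right.isReduced_left⟩
  have hBA : IsReduced (B.toWord ++ A.toWord) ∧ IsReduced (B.toWord ++ A⁻¹.toWord) ∧
      IsReduced (B⁻¹.toWord ++ A.toWord) ∧ IsReduced (B⁻¹.toWord ++ A⁻¹.toWord) :=
    ⟨by simpa using h.inv_right.swap.isReduced_left, h.swap.isReduced_right,
      h.swap.isReduced_left, h.inv_right.swap.isReduced_right⟩
  have key := exists_letter_of_rose ψ.toMonoidHom (fun i => by simp) (by
    rintro ⟨i, a⟩ ⟨j, b⟩ hij
    change IsReduced ((ψ _).toWord ++ (ψ _).toWord)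
    fin_cases i <;> fin_cases j <;> first | exact absurd rfl hij | skip
    · cases a <;> cases b <;>
        simp only [hf, ht', Fin.zero_eta, Fin.mk_one, _root_.map_inv, h0', h1', hAB]
    · cases a <;> cases b <;>
        simp only [hf, ht', Fin.zero_eta, Fin.mk_one, _root_.map_inv, h0', h1', hBA])
  -- The preimage of a generator under `ψ` has an image of length one, hence is itself a letter; so
  -- `ψ⁻¹` is a signed permutation.
  have hψ : ψ⁻¹ ∈ nielsenSubgroup := closure_signed_le <| mem_closure_signed fun i => by
    refine key _ ?_
    change (ψ (ψ⁻¹ (of i))).norm = 1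
    rw [MulAut.apply_inv_self, norm_of]
  have h2 : φ = ψ * ν⁻¹ := by simp [ψ]
  rw [h2]
  exact mul_mem (by simpa using inv_mem hψ) (inv_mem hν)

end Nielsen

end OutFn

namespace OutFn

/-! ### `Out(F_2) → GL_2(ℤ)` is an isomorphism -/

section NormalForm

variable {G : Type*} [Group G] {s t u : G}

/-- A normal form in a group generated by `s`, `t`, `u` that satisfy the relations between the
outer classes of the elementary Nielsen automorphisms of `F_2`. -/
lemma exists_normal_form (hs : s * s = 1) (ht : t * t = 1) (h1 : t * u * t = u⁻¹)
    (h2 : s * t * s * u * (s * t * s) = u⁻¹) (h3 : s * u * s * u⁻¹ = u * (s * t))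
    (htop : Subgroup.closure {s, t, u} = ⊤) (g : G) :
    ∃ w ∈ Subgroup.closure {s, t}, ∃ p ∈ Submonoid.closure {u, s * u * s},
      ∃ w' ∈ Subgroup.closure {s, t}, g = w * p * w' := by
  set W := Subgroup.closure {s, t} with hW
  set P := Submonoid.closure {u, s * u * s} with hP
  have hsW : s ∈ W := Subgroup.subset_closure (by simp)
  have htW : t ∈ W := Subgroup.subset_closure (by simp)
  have huP : u ∈ P := Submonoid.subset_closure (by simp)
  have hvP : s * u * s ∈ P := Submonoid.subset_closure (by simp)
  have hs' : s⁻¹ = s := inv_eq_of_mul_eq_one_left hs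
  have ht' : t⁻¹ = t := inv_eq_of_mul_eq_one_left ht
  set v := s * u * s with hv
  have hsu : s * u * s⁻¹ = v := by rw [hs']
  have hsv : s * v * s⁻¹ = u := by
    rw [hs', hv, show s * (s * u * s) * s = (s * s) * u * (s * s) by group, hs]; simp
  have htu : t * u * t⁻¹ = u⁻¹ := by rw [ht', h1]
  have htv : t * v * t⁻¹ = v⁻¹ := by
    rw [ht', hv, mul_inv_rev, mul_inv_rev, hs', ← h2,
      show s * (s * t * s * u * (s * t * s) * s) = (s * s) * t * s * u * s * t * (s * s) by group,
      hs]
    group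
  -- `E` consists of the two transvections and their inverses; conjugation by `W` permutes it, so
  -- `W` can be moved past transvections.
  let E : Set G := {u, v, u⁻¹, v⁻¹}
  have hE : ∀ w ∈ W, ∀ e ∈ E, w * e * w⁻¹ ∈ E := by
    have hcs : ∀ e ∈ E, s * e * s⁻¹ ∈ E := by
      rintro _ (rfl | rfl | rfl | rfl)
      · rw [hsu]; simp [E]
      · rw [hsv]; simp [E]
      · rw [← conj_inv, hsu]; simp [E]
      · rw [← conj_inv, hsv]; simp [E]
    have hct : ∀ e ∈ E, t * e * t⁻¹ ∈ E := by
      rintro _ (rfl | rfl | rfl | rfl)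
      · rw [htu]; simp [E]
      · rw [htv]; simp [E]
      · rw [← conj_inv, htu]; simp [E]
      · rw [← conj_inv, htv]; simp [E]
    intro w hw
    induction hw using Subgroup.closure_induction_left with
    | one => simp
    | mul_left x hx y _ ih =>
      intro e he
      rw [show x * y * e * (x * y)⁻¹ = x * (y * e * y⁻¹) * x⁻¹ by group]
      rcases hx with rfl | rfl
      exacts [hcs _ (ih e he), hct _ (ih e he)]
    | inv_mul_cancel x hx y _ ih =>
      intro e he
      rw [show x⁻¹ * y * e * (x⁻¹ * y)⁻¹ = x⁻¹ * (y * e * y⁻¹) * x⁻¹⁻¹ by group]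
      rcases hx with rfl | rfl
      · rw [hs']; exact hcs _ (ih e he)
      · rw [ht']; exact hct _ (ih e he)
  have hlast : ∀ p ∈ P, p = 1 ∨ ∃ p' ∈ P, p = p' * u ∨ p = p' * v := by
    intro p hp
    induction hp using Submonoid.closure_induction_right with
    | one => exact Or.inl rfl
    | mul_right x hx y hy ih =>
      rcases hy with rfl | rfl
      exacts [Or.inr ⟨x, hx, Or.inl rfl⟩, Or.inr ⟨x, hx, Or.inr rfl⟩]
  -- An inverse transvection either cancels the last factor of `p`, or becomes positive after
  -- conjugation by `t` when `p = 1`, or is absorbed by v u⁻¹ = u s t or its mirror image u v⁻¹ = v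
  -- t s.
  have hPE : ∀ p ∈ P, ∀ e ∈ E, ∃ w ∈ W, ∃ p' ∈ P, ∃ w' ∈ W, p * e = w * p' * w' := by
    rintro p hp _ (rfl | rfl | rfl | rfl)
    · exact ⟨1, W.one_mem, _, mul_mem hp huP, 1, W.one_mem, by simp⟩
    · exact ⟨1, W.one_mem, _, mul_mem hp hvP, 1, W.one_mem, by simp⟩
    · rcases hlast p hp with rfl | ⟨p', hp', rfl | rfl⟩
      · exact ⟨t, htW, u, huP, t, htW, by rw [one_mul, h1]⟩
      · exact ⟨1, W.one_mem, p', hp', 1, W.one_mem, by group⟩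
      · exact ⟨1, W.one_mem, p' * u, mul_mem hp' huP, s * t, mul_mem hsW htW, by
          rw [mul_assoc, h3]; group⟩
    · rcases hlast p hp with rfl | ⟨p', hp', rfl | rfl⟩
      · exact ⟨t, htW, v, hvP, t, htW, by rw [one_mul, ← htv, ht']⟩
      · refine ⟨1, W.one_mem, p' * v, mul_mem hp' hvP, t * s, mul_mem htW hsW, ?_⟩
        have : u * v⁻¹ = v * (t * s) := by
          have h4 : s * (v * u⁻¹) * s⁻¹ = s * (u * (s * t)) * s⁻¹ := by rw [h3]
          rw [show s * (v * u⁻¹) * s⁻¹ = (s * v * s⁻¹) * (s * u * s⁻¹)⁻¹ by group, hsv, hsu] at h4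
          rw [h4, hv, hs']
          group
        rw [mul_assoc, this]; group
      · exact ⟨1, W.one_mem, p', hp', 1, W.one_mem, by group⟩
  let N : Set G := {g | ∃ w ∈ W, ∃ p ∈ P, ∃ w' ∈ W, g = w * p * w'}
  have hNW : ∀ g ∈ N, ∀ x ∈ W, g * x ∈ N := by
    rintro _ ⟨w, hw, p, hp, w', hw', rfl⟩ x hx
    exact ⟨w, hw, p, hp, w' * x, mul_mem hw' hx, by group⟩
  have hNE : ∀ g ∈ N, ∀ e ∈ E, g * e ∈ N := by
    rintro _ ⟨w, hw, p, hp, w', hw', rfl⟩ e he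
    obtain ⟨a, ha, p', hp', b, hb, hab⟩ := hPE p hp _ (hE w' hw' e he)
    refine ⟨w * a, mul_mem hw ha, p', hp', b * w', mul_mem hb hw', ?_⟩
    rw [show w * p * w' * e = w * (p * (w' * e * w'⁻¹)) * w' by group, hab]
    group
  have hg : g ∈ Subgroup.closure {s, t, u} := htop ▸ Subgroup.mem_top g
  change g ∈ N
  induction hg using Subgroup.closure_induction_right with
  | one => exact ⟨1, W.one_mem, 1, P.one_mem, 1, W.one_mem, by simp⟩
  | mul_right x _ y hy ih =>
    rcases hy with rfl | rfl | rfl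
    exacts [hNW _ ih _ hsW, hNW _ ih _ htW, hNE _ ih _ (by simp [E])]
  | mul_inv_cancel x _ y hy ih =>
    rcases hy with rfl | rfl | rfl
    exacts [hNW _ ih _ (inv_mem hsW), hNW _ ih _ (inv_mem htW), hNE _ ih _ (by simp [E])]

end NormalForm

/-! ### Triviality of the kernel and surjectivity onto GL_2(ℤ). -/

section Torelli

open FreeGroup

lemma coe_autToGL {n : ℕ} (φ : MulAut (FreeGroup (Fin n))) :
    (autToGL n φ : Matrix (Fin n) (Fin n) ℤ) = abMatrix φ.toMonoidHom := rfl

lemma abMatrix_apply {n : ℕ} (φ : FreeGroup (Fin n) →* FreeGroup (Fin n)) (i j : Fin n) :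
    abMatrix φ i j = (abelianize n (φ (of j))).toAdd i := rfl

lemma abelianize_of {n : ℕ} (j : Fin n) :
    abelianize n (of j) = Multiplicative.ofAdd (Pi.single j 1) := by
  simp [abelianize]

lemma abMatrix_swapAut : abMatrix swapAut.toMonoidHom = !![0, 1; 1, 0] := by
  ext i j
  fin_cases i <;> fin_cases j <;> simp [abMatrix_apply, abelianize_of]

lemma abMatrix_invAut : abMatrix invAut.toMonoidHom = !![-1, 0; 0, 1] := by
  ext i j
  fin_cases i <;> fin_cases j <;> simp [abMatrix_apply, abelianize_of]

lemma abMatrix_mulAut : abMatrix mulAut.toMonoidHom = !![1, 0; 1, 1] := by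
  ext i j
  fin_cases i <;> fin_cases j <;> simp [abMatrix_apply, abelianize_of]

/-- The sum of the entries in the `j`-th column of the matrix of an outer automorphism. -/
def colSum (g : Out 2) (j : Fin 2) : ℤ := ∑ i, (outToGL 2 g : Matrix (Fin 2) (Fin 2) ℤ) i j

lemma colSum_mul_mk (g : Out 2) (φ : MulAut F2) (j : Fin 2) :
    colSum (g * QuotientGroup.mk φ) j =
      colSum g 0 * abMatrix φ.toMonoidHom 0 j + colSum g 1 * abMatrix φ.toMonoidHom 1 j := by
  have h : (outToGL 2 (QuotientGroup.mk φ) : Matrix (Fin 2) (Fin 2) ℤ)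
    = abMatrix φ.toMonoidHom := rfl
  simp only [colSum, _root_.map_mul, Units.val_mul, h, Matrix.mul_apply, Fin.sum_univ_two]
  ring

lemma colSum_one (j : Fin 2) : colSum 1 j = 1 := by
  fin_cases j <;> simp [colSum]

lemma mk_eq_mk_of_conj {φ ψ : MulAut F2} (g : F2) (h : φ = MulAut.conj g * ψ) :
    (QuotientGroup.mk φ : Out 2) = QuotientGroup.mk ψ := by
  have : (QuotientGroup.mk (MulAut.conj g) : Out 2) = 1 := (QuotientGroup.eq_one_iff _).2 ⟨g, rfl⟩
  rw [h, QuotientGroup.mk_mul, this, one_mul]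

/-- This is Nielsen's theorem read in Out(F_2), where the inner factor of `nielsenSubgroup`
vanishes. -/
lemma closure_out_eq_top : Subgroup.closure {(QuotientGroup.mk swapAut : Out 2),
    QuotientGroup.mk invAut, QuotientGroup.mk mulAut} = ⊤ := by
  have h := congrArg (Subgroup.map (QuotientGroup.mk' (Inn F2))) nielsenSubgroup_eq_top
  rw [nielsenSubgroup, Subgroup.map_sup, Subgroup.map_top_of_surjective _
    (QuotientGroup.mk'_surjective _), MonoidHom.map_closure,
    (Subgroup.map_eq_bot_iff _).2 (by rw [QuotientGroup.ker_mk']), bot_sup_eq] at h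
  rw [← h]
  congr 1
  simp [Set.image_insert_eq]

/-- A product of `swapAut` and `invAut` permutes the generators up to inversion. -/
lemma exists_letter_of_mem_closure {ψ : MulAut F2}
    (h : ψ ∈ Subgroup.closure {swapAut, invAut}) (i : Fin 2) : ∃ l, ψ (of i) = mk [l] := by
  have hs : ∀ ψ : MulAut F2, (∀ i, ∃ l, ψ (of i) = mk [l]) →
      ∀ i, ∃ l, (ψ * swapAut) (of i) = mk [l] := by
    intro ψ h i
    fin_cases i
    · simpa using h 1
    · simpa using h 0
  have ht : ∀ ψ : MulAut F2, (∀ i, ∃ l, ψ (of i) = mk [l]) →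
      ∀ i, ∃ l, (ψ * invAut) (of i) = mk [l] := by
    intro ψ h i
    fin_cases i
    · obtain ⟨l, hl⟩ := h 0
      exact ⟨(l.1, !l.2), by simp [hl, invRev]⟩
    · simpa using h 1
  induction h using Subgroup.closure_induction_right generalizing i with
  | one => exact ⟨(i, true), rfl⟩
  | mul_right x _ y hy ih =>
    rcases hy with rfl | rfl
    exacts [hs x ih i, ht x ih i]
  | mul_inv_cancel x _ y hy ih =>
    rcases hy with rfl | rfl
    · rw [swapAut_inv]; exact hs x ih i
    · rw [invAut_inv]; exact ht x ih i

/-- Each generator goes to a letter, and a diagonal entry 1 forces that letter to be the generator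
itself, with positive sign. -/
lemma eq_one_of_mem_closure_signed {ψ : MulAut F2} (h : ψ ∈ Subgroup.closure {swapAut, invAut})
    (h1 : abMatrix ψ.toMonoidHom = 1) : ψ = 1 := by
  have key : ∀ i, ψ (of i) = of i := by
    intro i
    obtain ⟨⟨j, b⟩, hl⟩ := exists_letter_of_mem_closure h i
    have h2 : abMatrix ψ.toMonoidHom i i = 1 := by rw [h1]; simp
    rw [abMatrix_apply] at h2
    change (abelianize 2 (ψ (of i))).toAdd i = 1 at h2
    rw [hl] at h2 ⊢
    cases b
    · have : (mk [(j, false)] : F2) = (of j)⁻¹ := rfl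
      rw [this, _root_.map_inv, abelianize_of] at h2
      by_cases hij : i = j <;> simp [hij] at h2
    · have : (mk [(j, true)] : F2) = of j := rfl
      rw [this, abelianize_of] at h2
      by_cases hij : i = j
      · rw [hij]; rfl
      · simp [hij] at h2
  exact aut_ext_F2 (key 0) (key 1)

/-- The Torelli group of rank two is trivial. -/
theorem torelli_two_eq_bot : Torelli 2 = ⊥ := by
  rw [eq_bot_iff]
  intro g hg
  set s : Out 2 := QuotientGroup.mk swapAut with hsdef
  set t : Out 2 := QuotientGroup.mk invAut with htdef
  set u : Out 2 := QuotientGroup.mk mulAut with hudef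
  have hs : s * s = 1 := by rw [hsdef, ← QuotientGroup.mk_mul, swapAut_mul_self]; rfl
  have ht : t * t = 1 := by rw [htdef, ← QuotientGroup.mk_mul, invAut_mul_self]; rfl
  have hs' : s⁻¹ = s := inv_eq_of_mul_eq_one_left hs
  have ht' : t⁻¹ = t := inv_eq_of_mul_eq_one_left ht
  -- The first and third relations fail in Aut(F_2): they hold up to conjugation by x₂⁻¹ and x₂
  -- respectively.
  have h1 : t * u * t = u⁻¹ := by
    rw [eq_inv_iff_mul_eq_one]
    refine mk_eq_mk_of_conj (φ := invAut * mulAut * invAut * mulAut) (ψ := 1) (of 1)⁻¹ ?_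
    refine aut_ext_F2 ?_ ?_ <;> simp [mul_assoc]
  have h2 : s * t * s * u * (s * t * s) = u⁻¹ := by
    rw [eq_inv_iff_mul_eq_one]
    refine mk_eq_mk_of_conj (φ := swapAut * invAut * swapAut * mulAut *
      (swapAut * invAut * swapAut) * mulAut) (ψ := 1) 1 ?_
    refine aut_ext_F2 ?_ ?_ <;> simp
  have h3 : s * u * s * u⁻¹ = u * (s * t) := by
    rw [mul_inv_eq_iff_eq_mul]
    refine mk_eq_mk_of_conj (φ := swapAut * mulAut * swapAut)
      (ψ := mulAut * (swapAut * invAut) * mulAut) (of 1) ?_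
    refine aut_ext_F2 ?_ ?_ <;> simp [mul_assoc]
  obtain ⟨w, hw, p, hp, w', hw', rfl⟩ := exists_normal_form hs ht h1 h2 h3 closure_out_eq_top g
  -- Right multiplication by `u` or `s * u * s` adds one column sum to the other. Starting from (1,
  -- 1), both stay positive and the total grows from 2 with every factor.
  have hP : 1 ≤ colSum p 0 ∧ 1 ≤ colSum p 1 ∧ (p = 1 ∨ 3 ≤ colSum p 0 + colSum p 1) := by
    clear hg
    induction hp using Submonoid.closure_induction_right with
    | one => simp [colSum_one]
    | mul_right x _ y hy ih =>
      obtain ⟨ha, hb, -⟩ := ih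
      rcases hy with rfl | rfl
      · have e0 : colSum (x * u) 0 = colSum x 0 + colSum x 1 := by
          rw [colSum_mul_mk, abMatrix_mulAut]; simp
        have e1 : colSum (x * u) 1 = colSum x 1 := by
          rw [colSum_mul_mk, abMatrix_mulAut]; simp
        rw [e0, e1]
        exact ⟨by omega, by omega, Or.inr (by omega)⟩
      · have e0 : colSum (x * (s * u * s)) 0 = colSum x 0 := by
          rw [← mul_assoc, ← mul_assoc]
          simp only [hsdef, hudef, colSum_mul_mk, abMatrix_mulAut, abMatrix_swapAut]
          simp
        have e1 : colSum (x * (s * u * s)) 1 = colSum x 1 + colSum x 0 := by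
          rw [← mul_assoc, ← mul_assoc]
          simp only [hsdef, hudef, colSum_mul_mk, abMatrix_mulAut, abMatrix_swapAut]
          simp
        rw [e0, e1]
        exact ⟨by omega, by omega, Or.inr (by omega)⟩
  have hW : ∀ w ∈ Subgroup.closure {s, t}, colSum w 0 ≤ 1 ∧ -1 ≤ colSum w 0 ∧
      colSum w 1 ≤ 1 ∧ -1 ≤ colSum w 1 := by
    intro w hw
    have hst : ∀ x, (colSum x 0 ≤ 1 ∧ -1 ≤ colSum x 0 ∧ colSum x 1 ≤ 1 ∧ -1 ≤ colSum x 1) →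
        ∀ y ∈ ({s, t} : Set (Out 2)), colSum (x * y) 0 ≤ 1 ∧ -1 ≤ colSum (x * y) 0 ∧
          colSum (x * y) 1 ≤ 1 ∧ -1 ≤ colSum (x * y) 1 := by
      rintro x hx _ (rfl | rfl)
      · simp only [hsdef, colSum_mul_mk, abMatrix_swapAut]
        simp
        omega
      · simp only [htdef, colSum_mul_mk, abMatrix_invAut]
        simp
        omega
    induction hw using Subgroup.closure_induction_right with
    | one => simp [colSum_one]
    | mul_right x _ y hy ih => exact hst x ih y hy
    | mul_inv_cancel x _ y hy ih =>
      have : y⁻¹ = y := by rcases hy with rfl | rfl <;> assumption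
      rw [this]
      exact hst x ih y hy
  have hker : outToGL 2 p = outToGL 2 (w⁻¹ * w'⁻¹) := by
    have h : outToGL 2 (w * p * w') = 1 := hg
    rw [_root_.map_mul, _root_.map_mul] at h
    rw [_root_.map_mul, _root_.map_inv, _root_.map_inv]
    generalize outToGL 2 w = a at *
    generalize outToGL 2 w' = c at *
    generalize outToGL 2 p = b at *
    rw [show b = a⁻¹ * (a * b * c) * c⁻¹ by group, h, mul_one]
  -- The matrix of `p` equals that of an element of ⟨s, t⟩, whose column sums are at most 1; a total
  -- of 3 is impossible.
  have hp1 : p = 1 := by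
    refine hP.2.2.resolve_right fun h => ?_
    have := hW _ (mul_mem (inv_mem hw) (inv_mem hw'))
    simp only [colSum, ← hker] at this
    simp only [colSum] at h hP
    have h4 := hP.1
    have h5 := hP.2.1
    omega
  subst hp1
  rw [mul_one] at hg ⊢
  have hww : w * w' ∈ (Subgroup.closure {swapAut, invAut}).map (QuotientGroup.mk' (Inn F2)) := by
    rw [MonoidHom.map_closure]
    convert mul_mem hw hw'
    simp [Set.image_insert_eq, hsdef, htdef]
  obtain ⟨ψ, hψ, hψw⟩ := hww
  rw [← hψw] at hg ⊢
  have h6 : ψ = 1 := eq_one_of_mem_closure_signed hψ 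
    (congrArg Units.val (show autToGL 2 ψ = 1 from hg))
  rw [h6, _root_.map_one]
  exact Subgroup.mem_bot.2 rfl

/-- Every integral matrix with determinant `±1` is induced by an automorphism of `F_2`. -/
theorem exists_abMatrix_eq (M : Matrix (Fin 2) (Fin 2) ℤ) (hM : M.det = 1 ∨ M.det = -1) :
    ∃ φ : MulAut F2, abMatrix φ.toMonoidHom = M := by
  have hSL : ∀ A : Matrix.SpecialLinearGroup (Fin 2) ℤ,
      ∃ φ : MulAut F2, abMatrix φ.toMonoidHom = A.1 := by
    intro A
    have hA : A ∈ (autToGL 2).range.comap Matrix.SpecialLinearGroup.toGL := by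
      have htop : (⊤ : Subgroup (Matrix.SpecialLinearGroup (Fin 2) ℤ)) ≤
          (autToGL 2).range.comap Matrix.SpecialLinearGroup.toGL := by
        -- It suffices to lift the two standard generators S and T of SL_2(ℤ); determinant -1 is
        -- reduced to this case by a factor diag(-1, 1), the matrix of `invAut`.
        rw [← SpecialLinearGroup.SL2Z_generators, Subgroup.closure_le]
        rintro _ (rfl | rfl)
        · refine ⟨invAut * swapAut, Units.ext ?_⟩
          rw [_root_.map_mul, Units.val_mul, coe_autToGL, coe_autToGL, abMatrix_swapAut,
            abMatrix_invAut]
          simp [ModularGroup.S]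
          rfl
        · refine ⟨swapAut * mulAut * swapAut, Units.ext ?_⟩
          rw [_root_.map_mul, _root_.map_mul, Units.val_mul, Units.val_mul, coe_autToGL,
            coe_autToGL, abMatrix_swapAut, abMatrix_mulAut]
          simp [ModularGroup.T]
          rfl
      exact htop (Subgroup.mem_top A)
    obtain ⟨φ, hφ⟩ := hA
    exact ⟨φ, congrArg Units.val hφ⟩
  rcases hM with hM | hM
  · exact hSL ⟨M, hM⟩
  · obtain ⟨φ, hφ⟩ := hSL ⟨M * !![-1, 0; 0, 1], by simp [Matrix.det_mul, hM]⟩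
    refine ⟨φ * invAut, ?_⟩
    rw [← coe_autToGL, _root_.map_mul, Units.val_mul, coe_autToGL, coe_autToGL, hφ,
      abMatrix_invAut]
    simp only [mul_assoc]
    simp [← Matrix.one_fin_two]

end Torelli

end OutFn

namespace OutFn

/-! ### Cochains and labels of marked graphs -/

namespace FinGraph

variable {Γ : FinGraph}

/-- The darts `e i` are the edges of `Γ`, each with one orientation. -/
def IsOrientation (Γ : FinGraph) {ι : Type*} (e : ι → Γ.D) : Prop :=
  ∀ d, ∃! i, d = e i ∨ d = Γ.rev (e i)

lemma tgt_rev (Γ : FinGraph) (d : Γ.D) : Γ.tgt (Γ.rev d) = Γ.src d := by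
  rw [tgt, Γ.rev_rev]

lemma dartClass_mem_paths (Γ : FinGraph) (d : Γ.D) :
    Γ.dartClass d ∈ Γ.paths (Γ.src d) (Γ.tgt d) :=
  ⟨[d], ⟨rfl, rfl⟩, by simp [pathClass]⟩

lemma Connected.paths_nonempty (h : Γ.Connected) (u w : Γ.V) : (Γ.paths u w).Nonempty := by
  obtain ⟨l, hl, -⟩ := h.2 u w
  exact ⟨_, l, hl, rfl⟩

lemma edgeGroup_ext {H : Type*} [Group H] {f g : Γ.EdgeGroup →* H}
    (h : ∀ d, f (Γ.dartClass d) = g (Γ.dartClass d)) : f = g :=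
  PresentedGroup.ext h

/-- Homomorphisms from the fundamental group to abelian groups extend to the edge group. -/
lemma Connected.exists_extension (h : Γ.Connected) {v : Γ.V} {A : Type*} [CommGroup A]
    (θ : Γ.fundGroup v →* A) :
    ∃ r : Γ.EdgeGroup →* A, ∀ x : Γ.fundGroup v, r x = θ x := by
  choose p hp using fun u => h.paths_nonempty v u
  have hmem : ∀ {u w x}, x ∈ Γ.paths u w → p u * x * (p w)⁻¹ ∈ Γ.fundGroup v := fun hx =>
    mul_mem_paths (mul_mem_paths (hp _) hx) (inv_mem_paths (hp _))
  -- Each dart is closed up to a loop at `v` by the chosen paths `p`.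
  let r : Γ.EdgeGroup →* A := Γ.edgeLift (fun d => θ ⟨_, hmem (Γ.dartClass_mem_paths d)⟩) (by
    intro d
    rw [← map_inv]
    congr 1
    refine Subtype.ext ?_
    simp only [InvMemClass.coe_inv, dartClass_rev, tgt_rev]
    change p (Γ.tgt d) * _ * _ = _
    group)
  have key : ∀ (l : List Γ.D) (u w : Γ.V), Γ.IsWalk u l w →
      ∀ m : p u * Γ.pathClass l * (p w)⁻¹ ∈ Γ.fundGroup v, r (Γ.pathClass l) = θ ⟨_, m⟩ := by
    intro l
    induction l with
    | nil =>
      intro u w hl m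
      obtain rfl : u = w := hl
      have : (⟨_, m⟩ : Γ.fundGroup v) = 1 := Subtype.ext (by simp [pathClass])
      rw [this]
      simp [pathClass]
    | cons d l ih =>
      intro u w hl m
      obtain ⟨rfl, hl'⟩ := hl
      have h1 : Γ.pathClass (d :: l) = Γ.dartClass d * Γ.pathClass l := by simp [pathClass]
      have h2 : (⟨_, m⟩ : Γ.fundGroup v) = ⟨_, hmem (Γ.dartClass_mem_paths d)⟩ *
          ⟨_, hmem ⟨l, hl', rfl⟩⟩ := Subtype.ext (by
        simp only [MulMemClass.mk_mul_mk, h1]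
        group)
      rw [h2, map_mul, ← ih _ _ hl', h1, map_mul, edgeLift_dartClass]
  refine ⟨r, ?_⟩
  rintro ⟨x, l, hl, rfl⟩
  refine (key l v v hl (hmem ⟨l, hl, rfl⟩)).trans ?_
  -- On a loop at `v` this changes the class by conjugation with `p v`, which is invisible in the
  -- commutative target.
  have h2 : (⟨_, hmem ⟨l, hl, rfl⟩⟩ : Γ.fundGroup v) =
      ⟨p v, hp v⟩ * ⟨Γ.pathClass l, l, hl, rfl⟩ * ⟨p v, hp v⟩⁻¹ := Subtype.ext (by simp)
  rw [h2, map_mul, map_mul, map_inv, mul_comm, inv_mul_cancel_left]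

open Classical in
lemma count_dartClass (Γ : FinGraph) (d e : Γ.D) : (Γ.count d (Γ.dartClass e)).toAdd =
    (if e = d then 1 else 0) - (if e = Γ.rev d then 1 else 0) := by
  rw [count, edgeLift_dartClass]; rfl

lemma count_rev (Γ : FinGraph) (d : Γ.D) (x : Γ.EdgeGroup) :
    (Γ.count (Γ.rev d) x).toAdd = -(Γ.count d x).toAdd := by
  have h : Γ.count (Γ.rev d) = (Γ.count d)⁻¹ := edgeGroup_ext fun e => by
    refine Multiplicative.toAdd.injective ?_
    rw [MonoidHom.inv_apply, toAdd_inv, count_dartClass, count_dartClass, Γ.rev_rev, neg_sub]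
  rw [h]; rfl

namespace IsOrientation

variable {ι : Type*} {e : ι → Γ.D}

lemma injective (he : Γ.IsOrientation e) : Function.Injective e := fun i _ hij =>
  (he (e i)).unique (Or.inl rfl) (Or.inl hij)

lemma ne_rev (he : Γ.IsOrientation e) (i j : ι) : e i ≠ Γ.rev (e j) := by
  intro hij
  obtain rfl : i = j := (he (e i)).unique (Or.inl rfl) (Or.inr hij)
  exact Γ.rev_ne _ hij.symm

lemma count_eq (he : Γ.IsOrientation e) [DecidableEq ι] (i j : ι) :
    (Γ.count (e i) (Γ.dartClass (e j))).toAdd = if j = i then 1 else 0 := by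
  classical
  rw [count_dartClass, if_neg (he.ne_rev j i), sub_zero]
  exact if_congr he.injective.eq_iff rfl rfl

/-- A homomorphism to an abelian group is determined by its values on the oriented edges. -/
lemma toAdd_apply_eq_sum (he : Γ.IsOrientation e) [Fintype ι] {M : Type*} [AddCommGroup M]
    (r : Γ.EdgeGroup →* Multiplicative M) (x : Γ.EdgeGroup) :
    (r x).toAdd = ∑ i, (Γ.count (e i) x).toAdd • (r (Γ.dartClass (e i))).toAdd := by
  classical
  let r' : Γ.EdgeGroup →* Multiplicative M :=
    { toFun := fun x => Multiplicative.ofAdd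
        (∑ i, (Γ.count (e i) x).toAdd • (r (Γ.dartClass (e i))).toAdd)
      map_one' := by simp
      map_mul' := fun x y => by
        rw [← ofAdd_add, ← Finset.sum_add_distrib]
        simp [add_smul] }
  have hfwd : ∀ j, r (Γ.dartClass (e j)) = r' (Γ.dartClass (e j)) := fun j => by
    refine Multiplicative.toAdd.injective ?_
    change _ = ∑ i, (Γ.count (e i) (Γ.dartClass (e j))).toAdd • (r (Γ.dartClass (e i))).toAdd
    simp [he.count_eq]
  have : r = r' := edgeGroup_ext fun d => by
    obtain ⟨j, rfl | rfl, -⟩ := he d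
    · exact hfwd j
    · rw [dartClass_rev, map_inv, map_inv, hfwd]
  exact congrArg Multiplicative.toAdd (DFunLike.congr_fun this x)

/-- The darts of a graph in terms of its oriented edges. -/
lemma bijective (he : Γ.IsOrientation e) :
    Function.Bijective fun p : ι × Bool => if p.2 then Γ.rev (e p.1) else e p.1 := by
  constructor
  · rintro ⟨i, a⟩ ⟨j, b⟩ h
    cases a <;> cases b <;> simp only [if_true, Bool.false_eq_true, if_false] at h
    · rw [he.injective h]
    · exact absurd h (he.ne_rev i j)
    · exact absurd h.symm (he.ne_rev j i)
    · have := congrArg Γ.rev h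
      rw [Γ.rev_rev, Γ.rev_rev] at this
      rw [he.injective this]
  · intro d
    obtain ⟨i, rfl | rfl, -⟩ := he d
    exacts [⟨(i, false), rfl⟩, ⟨(i, true), rfl⟩]

lemma card_eq (he : Γ.IsOrientation e) : Nat.card Γ.D = 2 * Nat.card ι := by
  rw [← Nat.card_congr (Equiv.ofBijective _ he.bijective), Nat.card_prod]
  simp [mul_comm]

end IsOrientation

lemma exists_isOrientation (Γ : FinGraph) :
    ∃ (k : ℕ) (e : Fin k → Γ.D), Γ.IsOrientation e := by
  have := Γ.finD
  obtain ⟨m, ⟨f⟩⟩ := Finite.exists_equiv_fin Γ.D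
  let O : Type := {d : Γ.D // f d < f (Γ.rev d)}
  obtain ⟨k, ⟨g⟩⟩ := Finite.exists_equiv_fin O
  refine ⟨k, fun i => (g.symm i).1, fun d => ?_⟩
  have hne : f d ≠ f (Γ.rev d) := fun h => Γ.rev_ne d (f.injective h).symm
  rcases lt_or_gt_of_ne hne with h | h
  · refine ⟨g ⟨d, h⟩, Or.inl (by simp), ?_⟩
    rintro i (hi | hi)
    · rw [← g.apply_symm_apply i]
      exact congrArg g (Subtype.ext hi.symm)
    · have h1 := (g.symm i).2
      rw [← hi] at h1
      have h2 : (g.symm i).1 = Γ.rev d := by rw [hi, Γ.rev_rev]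
      rw [h2] at h1
      exact absurd h (lt_asymm h1)
  · have h' : f (Γ.rev d) < f (Γ.rev (Γ.rev d)) := by rwa [Γ.rev_rev]
    refine ⟨g ⟨Γ.rev d, h'⟩, Or.inr (by simp [Γ.rev_rev]), ?_⟩
    rintro i (hi | hi)
    · have h1 := (g.symm i).2
      rw [← show d = (g.symm i).1 from hi] at h1
      exact absurd h (lt_asymm h1)
    · rw [← g.apply_symm_apply i]
      refine congrArg g (Subtype.ext ?_)
      change (g.symm i).1 = Γ.rev d
      rw [hi, Γ.rev_rev]

lemma sum_valence (Γ : FinGraph) [Fintype Γ.V] : ∑ v, Γ.valence v = Nat.card Γ.D := by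
  have := Γ.finD
  have : ∀ v, Finite {d : Γ.D // Γ.src d = v} := fun v => inferInstance
  rw [← Nat.card_congr (Equiv.sigmaFiberEquiv Γ.src), Nat.card_sigma]
  rfl

end FinGraph

lemma GraphIso.count_map {Γ Γ' : FinGraph} (f : GraphIso Γ Γ') (d : Γ.D) (x : Γ.EdgeGroup) :
    Γ'.count (f.onD d) (f.map x) = Γ.count d x := by
  classical
  have h : (Γ'.count (f.onD d)).comp f.map = Γ.count d := FinGraph.edgeGroup_ext fun e => by
    refine Multiplicative.toAdd.injective ?_
    rw [MonoidHom.comp_apply, f.map_dartClass, FinGraph.count_dartClass, FinGraph.count_dartClass,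
      ← f.rev_eq]
    simp only [f.onD.injective.eq_iff]
  exact DFunLike.congr_fun h x

lemma ForestCollapse.map_dartClass {Γ Γ' : FinGraph} (c : ForestCollapse Γ Γ') (d : Γ.D) :
    c.map (Γ.dartClass d) = (c.onD d).elim 1 Γ'.dartClass :=
  Γ.edgeLift_dartClass _ _ d

lemma ForestCollapse.count_map {Γ Γ' : FinGraph} (c : ForestCollapse Γ Γ') {d : Γ.D} {d' : Γ'.D}
    (hd : c.onD d = some d') (x : Γ.EdgeGroup) :
    Γ'.count d' (c.map x) = Γ.count d x := by
  classical
  have hrev : c.onD (Γ.rev d) = some (Γ'.rev d') := by rw [c.rev_eq, hd]; rfl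
  have h : (Γ'.count d').comp c.map = Γ.count d := FinGraph.edgeGroup_ext fun e => by
    refine Multiplicative.toAdd.injective ?_
    rw [MonoidHom.comp_apply, c.map_dartClass, FinGraph.count_dartClass]
    have h1 : e = d ↔ c.onD e = some d' :=
      ⟨fun h => h ▸ hd, fun h => (c.onD_bij d').unique h hd⟩
    have h2 : e = Γ.rev d ↔ c.onD e = some (Γ'.rev d') :=
      ⟨fun h => h ▸ hrev, fun h => (c.onD_bij _).unique h hrev⟩
    simp only [h1, h2]
    cases c.onD e with
    | none => simp
    | some e' => simp [FinGraph.count_dartClass]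
  exact DFunLike.congr_fun h x

namespace MarkedGraph

variable {n : ℕ} (X : MarkedGraph n)

lemma mark_mem (w : FreeGroup (Fin n)) : X.mark w ∈ X.toFinGraph.fundGroup X.base :=
  (X.marking w).2

lemma mark_injective : Function.Injective X.mark := fun _ _ h =>
  X.marking.injective (Subtype.ext h)

lemma exists_mark_eq {x : X.toFinGraph.EdgeGroup} (hx : x ∈ X.toFinGraph.fundGroup X.base) :
    ∃ w, X.mark w = x := by
  obtain ⟨w, hw⟩ := X.marking.surjective ⟨x, hx⟩
  exact ⟨w, congrArg Subtype.val hw⟩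

lemma label_rev (d : X.D) : X.label (X.rev d) = -X.label d := by
  ext i
  exact X.toFinGraph.count_rev d _

/-- The class in `H_1` determines how often a loop passes over each edge. -/
lemma count_mark (d : X.D) (w : FreeGroup (Fin n)) :
    (X.toFinGraph.count d (X.mark w)).toAdd = ∑ i, X.label d i * (abelianize n w).toAdd i := by
  induction w using FreeGroup.induction_on with
  | C1 => simp
  | of j => simp [abelianize_of, Pi.single_apply, label]
  | inv_of j h => simp only [map_inv, toAdd_inv, h, Pi.neg_apply, mul_neg, Finset.sum_neg_distrib]
  | mul x y hx hy =>
    simp only [map_mul, toAdd_mul, hx, hy, Pi.add_apply, mul_add, Finset.sum_add_distrib]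

/-- A retraction of the 1-chains of the graph onto H_1, identified with ℤ^n by the marking. -/
lemma exists_abelianize_extension : ∃ r : X.toFinGraph.EdgeGroup →* Multiplicative (Fin n → ℤ),
    ∀ w, r (X.mark w) = abelianize n w := by
  obtain ⟨r, hr⟩ := X.connected.exists_extension
    ((abelianize n).comp X.marking.symm.toMonoidHom)
  refine ⟨r, fun w => ?_⟩
  rw [show X.mark w = ((X.marking w : X.toFinGraph.fundGroup X.base) :
    X.toFinGraph.EdgeGroup) from rfl, hr]
  change abelianize n (X.marking.symm (X.marking w)) = _
  rw [MulEquiv.symm_apply_apply]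

/-- The labels of the edges form a matrix with a left inverse. -/
lemma exists_label_inverse {ι : Type*} [Fintype ι] {e : ι → X.D}
    (he : X.toFinGraph.IsOrientation e) : ∃ r : ι → Fin n → ℤ,
      ∀ j k, ∑ i, X.label (e i) j * r i k = if j = k then 1 else 0 := by
  obtain ⟨r, hr⟩ := X.exists_abelianize_extension
  refine ⟨fun i => (r (X.toFinGraph.dartClass (e i))).toAdd, fun j k => ?_⟩
  have h := congrFun (he.toAdd_apply_eq_sum r (X.mark (FreeGroup.of j))) k
  rw [hr, abelianize_of] at h
  simp only [toAdd_ofAdd, Finset.sum_apply, Pi.smul_apply, smul_eq_mul] at h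
  rw [Pi.single_apply] at h
  rw [← if_congr (eq_comm (a := k) (b := j)) rfl rfl, h]
  rfl

/-- The class of a loop in H_1 is recovered from its edge counts by the extension of the
abelianization to the edge group. -/
lemma abelianize_eq_of_count_eq {w w' : FreeGroup (Fin n)}
    (h : ∀ d, X.toFinGraph.count d (X.mark w) = X.toFinGraph.count d (X.mark w')) :
    abelianize n w = abelianize n w' := by
  obtain ⟨k, e, he⟩ := X.toFinGraph.exists_isOrientation
  obtain ⟨r, hr⟩ := X.exists_abelianize_extension
  rw [← hr, ← hr]
  refine Multiplicative.toAdd.injective ?_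
  rw [he.toAdd_apply_eq_sum, he.toAdd_apply_eq_sum]
  simp only [h]

end MarkedGraph

lemma exists_conj_of_abMatrix_eq_one {n : ℕ} (hT : Torelli n = ⊥)
    {φ : MulAut (FreeGroup (Fin n))} (h : abMatrix φ.toMonoidHom = 1) :
    ∃ g, φ = MulAut.conj g := by
  have h1 : (QuotientGroup.mk φ : Out n) ∈ Torelli n :=
    show autToGL n φ = 1 from Units.ext h
  rw [hT, Subgroup.mem_bot, QuotientGroup.eq_one_iff] at h1
  obtain ⟨g, hg⟩ := h1
  exact ⟨g, hg.symm⟩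

namespace MarkedGraph

variable {n : ℕ} {X X' : MarkedGraph n}

/-- If the Torelli group is trivial, a marked graph is determined by its labels. -/
lemma equiv_of_label_eq (hT : Torelli n = ⊥) (f : GraphIso X.toFinGraph X'.toFinGraph)
    (h : ∀ d, X'.label (f.onD d) = X.label d) : X.Equiv X' := by
  obtain ⟨p, hp⟩ := X'.connected.paths_nonempty (f.onV X.base) X'.base
  -- Transporting the marking of `X` along `f` and `p` and reading it through the marking of `X'`
  -- gives an automorphism `ψ`. Equal labels make it act trivially on H_1, so it is conjugation by
  -- some `g`, and `p * X'.mark g` is the track of the base point.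
  have hmem : ∀ w, p⁻¹ * f.map (X.mark w) * p ∈ X'.toFinGraph.fundGroup X'.base := fun w =>
    FinGraph.mul_mem_paths (FinGraph.mul_mem_paths (FinGraph.inv_mem_paths hp)
      (f.map_mem_paths (X.mark_mem w))) hp
  choose ψ hψ using fun w => X'.exists_mark_eq (hmem w)
  have hmul : ∀ w w', ψ (w * w') = ψ w * ψ w' := fun w w' => X'.mark_injective (by
    rw [map_mul, hψ, hψ, hψ, map_mul, map_mul]; group)
  have hfinj : Function.Injective f.map := fun x y hxy => by
    rw [← f.symm_map_map x, hxy, f.symm_map_map]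
  have hinj : Function.Injective ψ := fun w w' hw => by
    have h1 := congrArg X'.mark hw
    rw [hψ, hψ] at h1
    exact X.mark_injective (hfinj (mul_left_cancel (mul_right_cancel h1)))
  have hsurj : Function.Surjective ψ := fun w => by
    have h1 : p * X'.mark w * p⁻¹ ∈ X'.toFinGraph.paths (f.onV X.base) (f.onV X.base) :=
      FinGraph.mul_mem_paths (FinGraph.mul_mem_paths hp (X'.mark_mem w))
        (FinGraph.inv_mem_paths hp)
    have h2 := f.symm.map_mem_paths h1
    rw [show f.symm.onV (f.onV X.base) = X.base from f.onV.symm_apply_apply _] at h2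
    obtain ⟨w', hw'⟩ := X.exists_mark_eq h2
    refine ⟨w', X'.mark_injective ?_⟩
    have h3 : f.map (f.symm.map (p * X'.mark w * p⁻¹)) = p * X'.mark w * p⁻¹ :=
      f.symm.symm_map_map _
    rw [hψ, hw', h3]
    group
  let Ψ : MulAut (FreeGroup (Fin n)) :=
    MulEquiv.ofBijective (MonoidHom.mk' ψ hmul) ⟨hinj, hsurj⟩
  have hcount : ∀ d w, X'.toFinGraph.count (f.onD d) (X'.mark w) =
      X.toFinGraph.count d (X.mark w) := fun d w => by
    refine Multiplicative.toAdd.injective ?_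
    rw [count_mark, count_mark, h]
  have hab : ∀ w, abelianize n (ψ w) = abelianize n w := fun w => by
    refine X'.abelianize_eq_of_count_eq fun d => ?_
    obtain ⟨d, rfl⟩ := f.onD.surjective d
    rw [hψ, hcount, map_mul, map_mul, map_inv, f.count_map, mul_comm, mul_inv_cancel_left]
  have h1 : abMatrix Ψ.toMonoidHom = 1 := by
    ext i j
    change (abelianize n (ψ (FreeGroup.of j))).toAdd i = _
    rw [hab, abelianize_of, toAdd_ofAdd, Pi.single_apply, Matrix.one_apply]
  obtain ⟨g, hg⟩ := exists_conj_of_abMatrix_eq_one hT h1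
  refine ⟨f, p * X'.mark g, FinGraph.mul_mem_paths hp (X'.mark_mem g), fun w => ?_⟩
  have h2 : ψ w = g * w * g⁻¹ := DFunLike.congr_fun hg w
  have h3 := hψ w
  rw [h2, map_mul, map_mul, map_inv] at h3
  rw [show f.map (X.mark w) = p * (p⁻¹ * f.map (X.mark w) * p) * p⁻¹ by group, ← h3]
  group

end MarkedGraph

/-! ### Graphs of rank two -/

namespace MarkedGraph

variable {n : ℕ} (X : MarkedGraph n)

/-- The number of edges is at most the rank plus the number of vertices minus one. -/
lemma card_edges_add_one_le {k : ℕ} {e : Fin k → X.D} (he : X.toFinGraph.IsOrientation e) :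
    k + 1 ≤ n + Nat.card X.V := by
  classical
  have := X.finV
  have := Fintype.ofFinite X.V
  choose p hp using fun u => X.connected.paths_nonempty X.base u
  let N : X.toFinGraph.EdgeGroup → (Fin k → ℚ) := fun x i => ((X.toFinGraph.count (e i) x).toAdd : ℚ)
  have hN1 : N 1 = 0 := by ext i; simp [N]
  have hNmul : ∀ x y, N (x * y) = N x + N y := fun x y => by ext i; simp [N]
  have hNinv : ∀ x, N x⁻¹ = -N x := fun x => by ext i; simp [N]
  -- Edge counts of the loops of the n generators and of one path to each vertex other than the
  -- base: n + |V| - 1 vectors, shown to span ℚ^k.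
  let b : Fin n ⊕ {v : X.V // v ≠ X.base} → (Fin k → ℚ) :=
    Sum.elim (fun j => N (X.mark (FreeGroup.of j))) (fun v => N (p v))
  let S : Submodule ℚ (Fin k → ℚ) := Submodule.span ℚ (Set.range b)
  have hmark : ∀ w, N (X.mark w) ∈ S := fun w => by
    induction w using FreeGroup.induction_on with
    | C1 => rw [map_one, hN1]; exact S.zero_mem
    | of j => exact Submodule.subset_span ⟨Sum.inl j, rfl⟩
    | inv_of j h => rw [map_inv, hNinv]; exact S.neg_mem h
    | mul x y hx hy => rw [map_mul, hNmul]; exact S.add_mem hx hy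
  have hloop : ∀ x ∈ X.toFinGraph.fundGroup X.base, N x ∈ S := fun x hx => by
    obtain ⟨w, rfl⟩ := X.exists_mark_eq hx
    exact hmark w
  have hpath : ∀ v, N (p v) ∈ S := fun v => by
    by_cases hv : v = X.base
    · subst hv; exact hloop _ (hp _)
    · exact Submodule.subset_span ⟨Sum.inr ⟨v, hv⟩, rfl⟩
  -- A dart, closed up by the chosen paths, is a loop, so its count vector is that of the loop
  -- corrected by those of the two paths.
  have hdart : ∀ d, N (X.toFinGraph.dartClass d) ∈ S := fun d => by
    have h1 : p (X.src d) * X.toFinGraph.dartClass d * (p (X.toFinGraph.tgt d))⁻¹ ∈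
        X.toFinGraph.fundGroup X.base :=
      FinGraph.mul_mem_paths (FinGraph.mul_mem_paths (hp _) (X.toFinGraph.dartClass_mem_paths d))
        (FinGraph.inv_mem_paths (hp _))
    have h2 := hloop _ h1
    rw [hNmul, hNmul, hNinv] at h2
    have h3 := S.add_mem (S.sub_mem h2 (hpath (X.src d))) (hpath (X.toFinGraph.tgt d))
    convert h3 using 1
    abel
  have htop : S = ⊤ := by
    rw [eq_top_iff, ← Pi.basisFun ℚ (Fin k) |>.span_eq, Submodule.span_le]
    rintro _ ⟨i, rfl⟩
    have : N (X.toFinGraph.dartClass (e i)) = Pi.basisFun ℚ (Fin k) i := by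
      ext j
      simp only [N, he.count_eq, Pi.basisFun_apply, Pi.single_apply]
      by_cases h : i = j <;> simp [h, eq_comm]
    rw [← this]
    exact hdart _
  have h1 : k ≤ Fintype.card (Fin n ⊕ {v : X.V // v ≠ X.base}) := by
    have h2 := finrank_range_le_card (R := ℚ) b
    rw [Set.finrank, show Submodule.span ℚ (Set.range b) = ⊤ from htop, finrank_top] at h2
    simpa using h2
  rw [Fintype.card_sum, Fintype.card_fin, Fintype.card_subtype_compl,
    Fintype.card_subtype_eq] at h1
  have h3 : 0 < Fintype.card X.V := Fintype.card_pos_iff.2 ⟨X.base⟩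
  rw [Nat.card_eq_fintype_card]
  omega

variable (X : MarkedGraph 2)

/-- A marked graph of rank two has one vertex and two edges, or two vertices and three edges. -/
lemma card_cases {k : ℕ} {e : Fin k → X.D} (he : X.toFinGraph.IsOrientation e) :
    (Nat.card X.V = 1 ∧ k = 2) ∨ (Nat.card X.V = 2 ∧ k = 3) := by
  have := X.finV
  have := Fintype.ofFinite X.V
  have h1 := X.card_edges_add_one_le he
  have h2 := he.card_eq
  rw [← X.toFinGraph.sum_valence, Nat.card_fin] at h2
  have h3 : 3 * Nat.card X.V ≤ ∑ v, X.toFinGraph.valence v := by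
    rw [Nat.card_eq_fintype_card, mul_comm, ← smul_eq_mul]
    exact Finset.card_nsmul_le_sum _ _ _ fun v _ => X.three_le_valence v
  have h4 : 0 < Nat.card X.V := Nat.card_pos_iff.2 ⟨⟨X.base⟩, X.finV⟩
  -- From 3|V| ≤ 2k and k ≤ |V| + 1 follows |V| ≤ 2, and each value of |V| leaves one value of k.
  omega

/-- The edges `e i` of a marked graph with two vertices all run from `u` to `w`. -/
structure IsTheta (u w : X.V) (e : Fin 3 → X.D) : Prop where
  ne : u ≠ w
  eq_or : ∀ v, v = u ∨ v = w
  orient : X.toFinGraph.IsOrientation e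
  src_eq : ∀ i, X.src (e i) = u
  tgt_eq : ∀ i, X.toFinGraph.tgt (e i) = w

end MarkedGraph

end OutFn

namespace OutFn

/-! ### Unimodular pairs of vectors and their slopes -/

/-- The vectors `v`, `w` form a basis of `ℤ^2`. -/
def Unimod (v w : Fin 2 → ℤ) : Prop := v 0 * w 1 - v 1 * w 0 = 1 ∨ v 0 * w 1 - v 1 * w 0 = -1

namespace Unimod

variable {v w x : Fin 2 → ℤ}

lemma symm (h : Unimod v w) : Unimod w v := by
  unfold Unimod at *
  rcases h with h | h
  · right; linarith
  · left; linarith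

lemma neg_left (h : Unimod v w) : Unimod (-v) w := by
  unfold Unimod at *
  simp only [Pi.neg_apply]
  rcases h with h | h
  · right; linarith
  · left; linarith

lemma neg_right (h : Unimod v w) : Unimod v (-w) := h.symm.neg_left.symm

lemma add_right (h : Unimod v w) : Unimod v (v + w) := by
  unfold Unimod at *
  simp only [Pi.add_apply]
  rcases h with h | h
  · left; linarith
  · right; linarith

lemma isCoprime (h : Unimod v w) : IsCoprime (v 0) (v 1) := by
  rcases h with h | h
  · exact ⟨w 1, -w 0, by linarith⟩
  · exact ⟨-w 1, w 0, by linarith⟩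

end Unimod

lemma unimod_iff_det {M : Matrix (Fin 2) (Fin 2) ℤ} :
    Unimod (M 0) (M 1) ↔ M.det = 1 ∨ M.det = -1 := by
  rw [Matrix.det_fin_two, Unimod]

lemma fareySlope_neg (v : Fin 2 → ℤ) : fareySlope (-v) = fareySlope v := by
  unfold fareySlope
  simp [neg_div_neg_eq]

/-- Equal slopes mean vanishing determinant, and primitive parallel vectors differ by a unit of ℤ.
-/
lemma fareySlope_eq_iff {v w : Fin 2 → ℤ} (hv : IsCoprime (v 0) (v 1))
    (hw : IsCoprime (w 0) (w 1)) : fareySlope v = fareySlope w ↔ w = v ∨ w = -v := by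
  constructor
  · intro h
    have hdet : v 0 * w 1 = v 1 * w 0 := by
      unfold fareySlope at h
      by_cases h0 : v 0 = 0 <;> by_cases h1 : w 0 = 0
      · simp [h0, h1]
      · simp [h0, h1] at h
      · simp [h0, h1] at h
      · simp only [h0, h1, if_false, OnePoint.coe_eq_coe] at h
        have h0' : (v 0 : ℚ) ≠ 0 := by exact_mod_cast h0
        have h1' : (w 0 : ℚ) ≠ 0 := by exact_mod_cast h1
        rw [div_eq_div_iff h0' h1'] at h
        have : v 1 * w 0 = w 1 * v 0 := by exact_mod_cast h
        linarith
    obtain ⟨x, y, hxy⟩ := hv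
    obtain ⟨x', y', hxy'⟩ := hw
    -- By the Bézout relation of `v`, this is the factor with `w = c • v`; the relation of `w` makes
    -- it a unit.
    set c := x * w 0 + y * w 1 with hc
    have e0 : w 0 = c * v 0 := by
      rw [hc]; linear_combination (-w 0) * hxy - y * hdet
    have e1 : w 1 = c * v 1 := by
      rw [hc]; linear_combination (-w 1) * hxy + x * hdet
    have hunit : c * (x' * v 0 + y' * v 1) = 1 := by
      rw [← hxy', e0, e1]; ring
    rcases Int.isUnit_iff.1 (IsUnit.of_mul_eq_one _ hunit) with h1 | h1
    · left
      ext i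
      fin_cases i
      · simpa [h1] using e0
      · simpa [h1] using e1
    · right
      ext i
      fin_cases i
      · simpa [h1] using e0
      · simpa [h1] using e1
  · rintro (rfl | rfl)
    · rfl
    · rw [fareySlope_neg]

lemma Unimod.fareySlope_ne {v w : Fin 2 → ℤ} (h : Unimod v w) : fareySlope v ≠ fareySlope w := by
  intro h'
  rcases (fareySlope_eq_iff h.isCoprime h.symm.isCoprime).1 h' with rfl | rfl
  · rcases h with h | h
    · have : (0 : ℤ) = 1 := by linear_combination h
      omega
    · have : (0 : ℤ) = -1 := by linear_combination h
      omega
  · rcases h with h | h <;> simp only [Pi.neg_apply] at h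
    · have : (0 : ℤ) = 1 := by linear_combination h
      omega
    · have : (0 : ℤ) = -1 := by linear_combination h
      omega

lemma exists_isCoprime_fareySlope_eq (p : OnePoint ℚ) :
    ∃ v : Fin 2 → ℤ, IsCoprime (v 0) (v 1) ∧ fareySlope v = p := by
  induction p using OnePoint.rec with
  | infty => exact ⟨![0, 1], ⟨0, 1, by simp⟩, by simp [fareySlope]⟩
  | coe q =>
    refine ⟨![q.den, q.num], ?_, ?_⟩
    · simpa using (Rat.isCoprime_num_den q).symm
    · have : (q.den : ℤ) ≠ 0 := by exact_mod_cast q.den_ne_zero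
      simp [fareySlope, Rat.num_div_den]

lemma Unimod.fareyGraph_adj {v w : Fin 2 → ℤ} (h : Unimod v w) :
    fareyGraph.Adj (fareySlope v) (fareySlope w) := by
  rw [fareyGraph, SimpleGraph.fromRel_adj]
  exact ⟨h.fareySlope_ne, Or.inl ⟨v, w, h, rfl, rfl⟩⟩

/-- Adjacency quantifies over arbitrary representatives, but those with determinant ±1 are
primitive, hence unique up to sign, and signs preserve the condition. -/
lemma fareyGraph_adj_iff {v w : Fin 2 → ℤ} (hv : IsCoprime (v 0) (v 1))
    (hw : IsCoprime (w 0) (w 1)) :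
    fareyGraph.Adj (fareySlope v) (fareySlope w) ↔ Unimod v w := by
  refine ⟨fun h => ?_, fun h => h.fareyGraph_adj⟩
  rw [fareyGraph, SimpleGraph.fromRel_adj] at h
  have key : ∀ {v w v' w' : Fin 2 → ℤ}, IsCoprime (v 0) (v 1) → IsCoprime (w 0) (w 1) →
      Unimod v' w' → fareySlope v = fareySlope v' → fareySlope w = fareySlope w' →
      Unimod v w := by
    intro v w v' w' hv hw h hvv hww
    rcases (fareySlope_eq_iff hv h.isCoprime).1 hvv with rfl | rfl <;>
      rcases (fareySlope_eq_iff hw h.symm.isCoprime).1 hww with rfl | rfl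
    · exact h
    · simpa using h.neg_right
    · simpa using h.neg_left
    · simpa using h.neg_left.neg_right
  obtain ⟨-, ⟨v', w', h, h1, h2⟩ | ⟨v', w', h, h1, h2⟩⟩ := h
  · exact key hv hw h h1 h2
  · exact (key hw hv h h1 h2).symm

lemma range_fin_three {α : Type*} (f : Fin 3 → α) : Set.range f = {f 0, f 1, f 2} := by
  ext x
  simp [Fin.exists_fin_succ, eq_comm]

/-- If three vectors sum to zero and two of them form a basis, so do any two. -/
lemma Unimod.of_sum_eq_zero {m : Fin 3 → Fin 2 → ℤ} (h : Unimod (m 0) (m 1)) (hm : ∑ i, m i = 0)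
    {i j : Fin 3} (hij : i ≠ j) : Unimod (m i) (m j) := by
  have h2 : m 2 = -(m 0 + m 1) := by
    rw [Fin.sum_univ_three] at hm
    exact eq_neg_of_add_eq_zero_right hm
  have h02 : Unimod (m 0) (m 2) := h2 ▸ h.add_right.neg_right
  have h12 : Unimod (m 1) (m 2) := by
    rw [h2, add_comm]; exact h.symm.add_right.neg_right
  fin_cases i <;> fin_cases j <;> first | exact absurd rfl hij | skip
  exacts [h, h02, h.symm, h12, h02.symm, h12.symm]

/-- Two bases with a zero-sum completion, equal up to signs, are equal up to a common sign. -/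
lemma eq_or_eq_neg_of_sum_eq_zero {m l : Fin 3 → Fin 2 → ℤ} (h : Unimod (m 0) (m 1))
    (hm : ∑ i, m i = 0) (hl : ∑ i, l i = 0) (hlm : ∀ i, l i = m i ∨ l i = -m i) :
    (∀ i, l i = m i) ∨ (∀ i, l i = -m i) := by
  rw [Fin.sum_univ_three] at hm hl
  have hm0 := congrFun hm 0
  have hm1 := congrFun hm 1
  have hl0 := congrFun hl 0
  have hl1 := congrFun hl 1
  simp only [Pi.add_apply, Pi.zero_apply] at hm0 hm1 hl0 hl1
  have hfin : ∀ P : Fin 3 → Prop, P 0 → P 1 → P 2 → ∀ i, P i := by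
    intro P h0 h1 h2 i
    fin_cases i <;> assumption
  rcases hlm 0 with h0 | h0 <;> rcases hlm 1 with h1 | h1 <;> rcases hlm 2 with h2 | h2 <;>
    first
    | exact Or.inl (hfin _ h0 h1 h2)
    | exact Or.inr (hfin _ h0 h1 h2)
    | (exfalso
       rw [h0, h1, h2] at hl0 hl1
       simp only [Pi.neg_apply] at hl0 hl1
       have a0 : m 0 0 = 0 ∨ m 1 0 = 0 ∨ m 2 0 = 0 := by omega
       -- With mixed signs, adding or subtracting the two zero-sum relations makes twice one of the
       -- three vectors vanish, so the pair is degenerate.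
       have hz : (m 0 0 = 0 ∧ m 0 1 = 0) ∨ (m 1 0 = 0 ∧ m 1 1 = 0) ∨
          (m 0 0 + m 1 0 = 0 ∧ m 0 1 + m 1 1 = 0) := by omega
       have : m 0 0 * m 1 1 - m 0 1 * m 1 0 = 0 := by
         rcases hz with ⟨e0, e1⟩ | ⟨e0, e1⟩ | ⟨e0, e1⟩
         · rw [e0, e1]; ring
         · rw [e0, e1]; ring
         · linear_combination m 1 1 * e0 - m 1 0 * e1
       rcases h with h | h <;> omega)

end OutFn

namespace OutFn

/-! ### Classification of marked graphs of rank two -/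

namespace FinGraph

variable {Γ : FinGraph}

namespace IsOrientation

variable {ι : Type*} {e e' : ι → Γ.D}

lemma comp_equiv (he : Γ.IsOrientation e) {κ : Type*} (σ : κ ≃ ι) : Γ.IsOrientation (e ∘ σ) := by
  intro d
  obtain ⟨i, hi, hu⟩ := he d
  refine ⟨σ.symm i, by simpa using hi, fun j hj => ?_⟩
  rw [← hu (σ j) hj, σ.symm_apply_apply]

lemma flip (he : Γ.IsOrientation e) (h : ∀ i, e' i = e i ∨ e' i = Γ.rev (e i)) :
    Γ.IsOrientation e' := by
  have key : ∀ d i, (d = e' i ∨ d = Γ.rev (e' i)) ↔ (d = e i ∨ d = Γ.rev (e i)) := by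
    intro d i
    rcases h i with h | h
    · rw [h]
    · rw [h, Γ.rev_rev, or_comm]
  intro d
  simpa only [key] using he d

end IsOrientation

/-- `r` is the coboundary of `h`. Its vanishing on loops expresses that a loop enters and leaves
each vertex equally often. -/
lemma pathClass_coboundary {M : Type*} [AddCommGroup M] (h : Γ.V → M) :
    ∃ r : Γ.EdgeGroup →* Multiplicative M,
      (∀ d, (r (Γ.dartClass d)).toAdd = h (Γ.tgt d) - h (Γ.src d)) ∧
      ∀ {u w x}, x ∈ Γ.paths u w → (r x).toAdd = h w - h u := by
  let r : Γ.EdgeGroup →* Multiplicative M :=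
    Γ.edgeLift (fun d => Multiplicative.ofAdd (h (Γ.tgt d) - h (Γ.src d))) fun d => by
      rw [← ofAdd_neg, neg_sub, tgt_rev]; rfl
  have hr : ∀ d, (r (Γ.dartClass d)).toAdd = h (Γ.tgt d) - h (Γ.src d) := fun d => by
    simp only [r, edgeLift_dartClass, toAdd_ofAdd]
  refine ⟨r, hr, ?_⟩
  rintro u w _ ⟨l, hl, rfl⟩
  induction l generalizing u with
  | nil => obtain rfl : u = w := hl; simp [pathClass]
  | cons d l ih =>
    obtain ⟨rfl, hl'⟩ := hl
    have := ih hl'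
    simp only [pathClass, List.map_cons, List.prod_cons, map_mul, toAdd_mul, hr] at this ⊢
    rw [this]
    abel

end FinGraph

lemma exists_graphIso {Γ Γ' : FinGraph} {ι : Type*} {e : ι → Γ.D} {e' : ι → Γ'.D}
    (he : Γ.IsOrientation e) (he' : Γ'.IsOrientation e') (σ : Γ.V ≃ Γ'.V)
    (hsrc : ∀ i, Γ'.src (e' i) = σ (Γ.src (e i)))
    (htgt : ∀ i, Γ'.tgt (e' i) = σ (Γ.tgt (e i))) :
    ∃ f : GraphIso Γ Γ', ∀ i, f.onD (e i) = e' i := by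
  let E := Equiv.ofBijective _ he.bijective
  let E' := Equiv.ofBijective _ he'.bijective
  have h1 : ∀ i, (E.symm.trans E') (e i) = e' i := fun i => by
    have : E (i, false) = e i := rfl
    rw [← this, Equiv.trans_apply, E.symm_apply_apply]; rfl
  have h2 : ∀ i, (E.symm.trans E') (Γ.rev (e i)) = Γ'.rev (e' i) := fun i => by
    have : E (i, true) = Γ.rev (e i) := rfl
    rw [← this, Equiv.trans_apply, E.symm_apply_apply]; rfl
  refine ⟨⟨σ, E.symm.trans E', fun d => ?_, fun d => ?_⟩, h1⟩
  · obtain ⟨i, rfl | rfl, -⟩ := he d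
    · rw [h1, hsrc]
    · rw [h2]; exact htgt i
  · obtain ⟨i, rfl | rfl, -⟩ := he d
    · rw [h1, h2]
    · rw [h2, Γ.rev_rev, Γ'.rev_rev, h1]

/-! ### Slopes as a complete invariant. -/

namespace MarkedGraph

/-- The slopes of the labels of a marked graph of rank two. -/
def slopes (X : MarkedGraph 2) : Set (OnePoint ℚ) := Set.range fun d => fareySlope (X.label d)

variable {X X' : MarkedGraph 2}

lemma slopes_eq {ι : Type*} {e : ι → X.D} (he : X.toFinGraph.IsOrientation e) :
    X.slopes = Set.range fun i => fareySlope (X.label (e i)) := by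
  refine Set.Subset.antisymm ?_ ?_
  · rintro _ ⟨d, rfl⟩
    obtain ⟨i, rfl | rfl, -⟩ := he d
    · exact ⟨i, rfl⟩
    · refine ⟨i, ?_⟩
      change _ = fareySlope (X.label (X.rev (e i)))
      rw [label_rev, fareySlope_neg]
  · rintro _ ⟨i, rfl⟩
    exact ⟨e i, rfl⟩

/-- The label matrix is square here, so the left inverse from `exists_label_inverse` makes its
determinant a unit. -/
lemma unimod_of_rose {e : Fin 2 → X.D} (he : X.toFinGraph.IsOrientation e) :
    Unimod (X.label (e 0)) (X.label (e 1)) := by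
  obtain ⟨r, hr⟩ := X.exists_label_inverse he
  let A : Matrix (Fin 2) (Fin 2) ℤ := fun i => X.label (e i)
  let B : Matrix (Fin 2) (Fin 2) ℤ := r
  have h : A.transpose * B = 1 := by
    ext j k
    rw [Matrix.mul_apply, Matrix.one_apply]
    exact hr j k
  have h1 := congrArg Matrix.det h
  rw [Matrix.det_mul, Matrix.det_transpose, Matrix.det_one] at h1
  exact unimod_iff_det.2 (Int.isUnit_iff.1 (IsUnit.of_mul_eq_one _ h1))

namespace IsTheta

variable {u w : X.V} {e : Fin 3 → X.D}

/-- The coboundary of the indicator function of `w` is 1 on each edge `e i` and 0 on loops. -/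
lemma sum_label (h : X.IsTheta u w e) : ∑ i, X.label (e i) = 0 := by
  classical
  obtain ⟨r, hr, hr'⟩ := X.toFinGraph.pathClass_coboundary fun v => if v = w then (1 : ℤ) else 0
  ext j
  have h1 := hr' (X.mark_mem (FreeGroup.of j))
  rw [sub_self, h.orient.toAdd_apply_eq_sum] at h1
  simp only [hr, h.src_eq, h.tgt_eq, if_neg h.ne, if_true, sub_zero, smul_eq_mul, mul_one] at h1
  simpa [label] using h1

lemma unimod (h : X.IsTheta u w e) {i j : Fin 3} (hij : i ≠ j) :
    Unimod (X.label (e i)) (X.label (e j)) := by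
  refine Unimod.of_sum_eq_zero (m := fun i => X.label (e i)) ?_ h.sum_label hij
  obtain ⟨r, hr⟩ := X.exists_label_inverse h.orient
  let A : Matrix (Fin 2) (Fin 2) ℤ := !![X.label (e 0) 0, X.label (e 0) 1;
    X.label (e 1) 0, X.label (e 1) 1]
  -- Eliminating the third label, which is minus the sum of the other two, turns the left inverse
  -- `r` of the 3 × 2 label matrix into one for its first two rows.
  let B : Matrix (Fin 2) (Fin 2) ℤ := !![r 0 0 - r 2 0, r 0 1 - r 2 1; r 1 0 - r 2 0, r 1 1 - r 2 1]
  have hs := h.sum_label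
  have hAB : A.transpose * B = 1 := by
    ext j k
    have h1 := hr j k
    have h2 := congrFun hs j
    rw [Fin.sum_univ_three] at h1 h2
    simp only [Pi.add_apply, Pi.zero_apply] at h2
    rw [Matrix.one_apply, ← h1, Matrix.mul_apply, Fin.sum_univ_two]
    fin_cases j <;> fin_cases k <;> simp [A, B] at h2 ⊢
    · linear_combination -(r 2 0) * h2
    · linear_combination -(r 2 1) * h2
    · linear_combination -(r 2 0) * h2
    · linear_combination -(r 2 1) * h2
  have h1 := congrArg Matrix.det hAB
  rw [Matrix.det_mul, Matrix.det_transpose, Matrix.det_one] at h1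
  have h2 := Int.isUnit_iff.1 (IsUnit.of_mul_eq_one _ h1)
  simpa [A, Matrix.det_fin_two, Unimod] using h2

lemma injective_slope (h : X.IsTheta u w e) :
    Function.Injective fun i => fareySlope (X.label (e i)) := by
  intro i j hij
  by_contra hne
  exact (h.unimod hne).fareySlope_ne hij

lemma reverse (h : X.IsTheta u w e) : X.IsTheta w u fun i => X.rev (e i) where
  ne := h.ne.symm
  eq_or v := (h.eq_or v).symm
  orient := h.orient.flip fun _ => Or.inr rfl
  src_eq := h.tgt_eq
  tgt_eq i := (X.toFinGraph.tgt_rev _).trans (h.src_eq i)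

lemma comp_equiv (h : X.IsTheta u w e) (σ : Fin 3 ≃ Fin 3) : X.IsTheta u w (e ∘ σ) where
  ne := h.ne
  eq_or := h.eq_or
  orient := h.orient.comp_equiv σ
  src_eq _ := h.src_eq _
  tgt_eq _ := h.tgt_eq _

end IsTheta

/-- In a marked graph of rank two with two vertices there are no loops. -/
lemma src_ne_tgt {a b : X.V} (hab : a ≠ b) (hval : X.toFinGraph.valence a = 3) (d : X.D)
    (hd : X.src d = a) : X.toFinGraph.tgt d ≠ a := by
  classical
  intro hd'
  have := X.finD
  have := Fintype.ofFinite X.D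
  let S : Finset X.D := Finset.univ.filter fun x => X.src x = a
  have hS : S.card = 3 := by
    rw [← hval, FinGraph.valence, Nat.card_eq_fintype_card, Fintype.card_subtype]
  have h1 : d ∈ S := by simp [S, hd]
  have h2 : X.rev d ∈ S.erase d := Finset.mem_erase.2 ⟨X.rev_ne d, by simpa [S, FinGraph.tgt] using hd'⟩
  -- A loop uses two of the three darts at `a`. Without the remaining one, `e`, no path could leave
  -- `a`, so `e` would be separating.
  obtain ⟨e, he⟩ : ∃ e, (S.erase d).erase (X.rev d) = {e} := by
    rw [← Finset.card_eq_one, Finset.card_erase_of_mem h2, Finset.card_erase_of_mem h1, hS]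
  have hout : ∀ x, X.src x = a → x ≠ e → X.toFinGraph.tgt x = a := by
    intro x hx hxe
    have h3 : x ∉ (S.erase d).erase (X.rev d) := by rw [he]; simpa using hxe
    have h4 : x ∈ S := by simp [S, hx]
    simp only [Finset.mem_erase, not_and, h4, not_true_eq_false, imp_false, ne_eq] at h3
    by_cases h5 : x = X.rev d
    · rw [h5, FinGraph.tgt_rev, hd]
    · rw [not_not.1 (h3 h5), hd']
  obtain ⟨l, hl, hle⟩ := X.noSeparatingEdge e a b
  have key : ∀ (l : List X.D) (v : X.V), v = a → X.toFinGraph.IsWalk v l b →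
      (∀ x ∈ l, x ≠ e ∧ x ≠ X.rev e) → False := by
    intro l
    induction l with
    | nil => exact fun v hv hl _ => hab (hv.symm.trans hl)
    | cons x l ih =>
      intro v hv hl hle
      exact ih _ (hout x (hl.1.trans hv) (hle x (by simp)).1) hl.2 fun y hy => hle y (by simp [hy])
  exact key l a rfl hl hle

/-- A marked graph of rank two is a rose or a theta graph. -/
lemma rose_or_theta (X : MarkedGraph 2) :
    (X.IsRose ∧ ∃ e : Fin 2 → X.D, X.toFinGraph.IsOrientation e) ∨
      (¬ X.IsRose ∧ ∃ u w e, X.IsTheta u w e) := by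
  classical
  obtain ⟨k, e, he⟩ := X.toFinGraph.exists_isOrientation
  rcases X.card_cases he with ⟨h, rfl⟩ | ⟨h, rfl⟩
  · exact Or.inl ⟨h, e, he⟩
  · refine Or.inr ⟨fun h' => by rw [IsRose] at h'; omega, ?_⟩
    have := X.finV
    have := X.finD
    have := Fintype.ofFinite X.V
    have := Fintype.ofFinite X.D
    rw [Nat.card_eq_fintype_card, ← Finset.card_univ, Finset.card_eq_two] at h
    obtain ⟨u, w, huw, hV⟩ := h
    have hor : ∀ v, v = u ∨ v = w := fun v => by
      have := Finset.mem_univ v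
      rw [hV] at this
      simpa using this
    have hsum := X.toFinGraph.sum_valence
    rw [hV, Finset.sum_pair huw, he.card_eq, Nat.card_fin] at hsum
    have hu := X.three_le_valence u
    have hw := X.three_le_valence w
    -- The two valences sum to 6 and each is at least 3.
    have hu3 : X.toFinGraph.valence u = 3 := by omega
    have hw3 : X.toFinGraph.valence w = 3 := by omega
    have hu' : ∀ d, X.src d = u → X.toFinGraph.tgt d = w := fun d hd =>
      (hor _).resolve_left (src_ne_tgt huw hu3 d hd)
    have hw' : ∀ d, X.src d = w → X.toFinGraph.tgt d = u := fun d hd =>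
      (hor _).resolve_right (src_ne_tgt huw.symm hw3 d hd)
    let E : Fin 3 ≃ {d : X.D // X.src d = u} :=
      (finCongr hu3.symm).trans (Finite.equivFin {d : X.D // X.src d = u}).symm
    refine ⟨u, w, fun i => (E i).1, huw, hor, fun d => ?_, fun i => (E i).2,
      fun i => hu' _ (E i).2⟩
    rcases hor (X.src d) with hd | hd
    · refine ⟨E.symm ⟨d, hd⟩, Or.inl (by simp), ?_⟩
      rintro i (hi | hi)
      · rw [← E.symm_apply_apply i]
        exact congrArg E.symm (Subtype.ext hi.symm)
      · exfalso
        have h1 := hu' _ (E i).2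
        rw [FinGraph.tgt, ← hi, hd] at h1
        exact huw h1
    · have hd' : X.src (X.rev d) = u := hw' d hd
      refine ⟨E.symm ⟨X.rev d, hd'⟩, Or.inr (by simp [X.rev_rev]), ?_⟩
      rintro i (hi | hi)
      · have h1 := (E i).2
        rw [← hi, hd] at h1
        exact absurd h1.symm huw
      · rw [← E.symm_apply_apply i]
        refine congrArg E.symm (Subtype.ext ?_)
        change (E i).1 = X.rev d
        rw [hi, X.rev_rev]

/-- The oriented edges of a rose can be chosen with any labels of the correct slopes. -/
lemma exists_rose_labels {e : Fin 2 → X.D} (he : X.toFinGraph.IsOrientation e)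
    {m : Fin 2 → Fin 2 → ℤ} (hm : Unimod (m 0) (m 1))
    (hX : X.slopes = {fareySlope (m 0), fareySlope (m 1)}) :
    ∃ e' : Fin 2 → X.D, X.toFinGraph.IsOrientation e' ∧ ∀ i, X.label (e' i) = m i := by
  classical
  rw [slopes_eq he] at hX
  have h2 : (Set.range fun i => fareySlope (X.label (e i))) =
      {fareySlope (X.label (e 0)), fareySlope (X.label (e 1))} := by
    ext p; simp [Fin.exists_fin_two, eq_comm]
  rw [h2, Set.pair_eq_pair_iff] at hX
  obtain ⟨e₁, he₁, h0, h1⟩ : ∃ e₁ : Fin 2 → X.D, X.toFinGraph.IsOrientation e₁ ∧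
      fareySlope (X.label (e₁ 0)) = fareySlope (m 0) ∧
      fareySlope (X.label (e₁ 1)) = fareySlope (m 1) := by
    rcases hX with ⟨h0, h1⟩ | ⟨h0, h1⟩
    · exact ⟨e, he, h0, h1⟩
    · exact ⟨e ∘ Equiv.swap 0 1, he.comp_equiv _, by simpa using h1, by simpa using h0⟩
  have hu := unimod_of_rose he₁
  have key : ∀ i, ∃ d, (d = e₁ i ∨ d = X.rev (e₁ i)) ∧ X.label d = m i := by
    intro i
    have hi : m i = X.label (e₁ i) ∨ m i = -X.label (e₁ i) := by
      fin_cases i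
      · exact (fareySlope_eq_iff hu.isCoprime hm.isCoprime).1 h0
      · exact (fareySlope_eq_iff hu.symm.isCoprime hm.symm.isCoprime).1 h1
    rcases hi with hi | hi
    · exact ⟨_, Or.inl rfl, hi.symm⟩
    · exact ⟨_, Or.inr rfl, by rw [label_rev, hi]⟩
  choose e' he' hl using key
  exact ⟨e', he₁.flip he', hl⟩

/-- The edges of a theta graph can be chosen with any labels of the correct slopes. -/
lemma exists_theta_labels {u w : X.V} {e : Fin 3 → X.D} (he : X.IsTheta u w e)
    {m : Fin 3 → Fin 2 → ℤ} (hm : Unimod (m 0) (m 1)) (hm0 : ∑ i, m i = 0)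
    (hX : X.slopes = Set.range fun i => fareySlope (m i)) :
    ∃ u' w' e', X.IsTheta u' w' e' ∧ ∀ i, X.label (e' i) = m i := by
  rw [slopes_eq he.orient] at hX
  have hinj : Function.Injective fun i => fareySlope (m i) := by
    intro i j hij
    by_contra hne
    exact (hm.of_sum_eq_zero hm0 hne).fareySlope_ne hij
  let σ : Fin 3 ≃ Fin 3 := (Equiv.ofInjective _ hinj).trans
    ((Equiv.setCongr hX.symm).trans (Equiv.ofInjective _ he.injective_slope).symm)
  have hσ : ∀ i, fareySlope (X.label (e (σ i))) = fareySlope (m i) := fun i => by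
    have h := (Equiv.ofInjective _ he.injective_slope).apply_symm_apply
      ((Equiv.setCongr hX.symm) (Equiv.ofInjective _ hinj i))
    exact congrArg Subtype.val h
  have hcop : ∀ i, IsCoprime (m i 0) (m i 1) := fun i => by
    obtain ⟨j, hj⟩ := exists_ne i
    exact (hm.of_sum_eq_zero hm0 hj.symm).isCoprime
  have he₁ := he.comp_equiv σ
  have hcop' : ∀ i, IsCoprime (X.label (e (σ i)) 0) (X.label (e (σ i)) 1) := fun i => by
    obtain ⟨j, hj⟩ := exists_ne i
    exact (he₁.unimod hj.symm).isCoprime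
  have hpm : ∀ i, X.label (e (σ i)) = m i ∨ X.label (e (σ i)) = -m i := fun i =>
    (fareySlope_eq_iff (hcop i) (hcop' i)).1 (hσ i).symm
  -- Slopes fix each label up to sign, and the zero-sum condition makes the sign common; a common
  -- minus sign is removed by reversing all edges, which exchanges the two vertices.
  rcases eq_or_eq_neg_of_sum_eq_zero hm hm0 he₁.sum_label hpm with h | h
  · exact ⟨u, w, _, he₁, h⟩
  · refine ⟨w, u, _, he₁.reverse, fun i => ?_⟩
    rw [label_rev]
    exact (congrArg Neg.neg (h i)).trans (neg_neg _)

lemma IsRose.subsingleton (h : X.IsRose) : Subsingleton X.V :=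
  (Nat.card_eq_one_iff_unique.1 h).1

/-- Here the triviality of the Torelli group enters the classification. -/
lemma equiv_of_label_eq_of_orientation {ι : Type*} {e : ι → X.D} {e' : ι → X'.D}
    (he : X.toFinGraph.IsOrientation e) (he' : X'.toFinGraph.IsOrientation e') (σ : X.V ≃ X'.V)
    (hsrc : ∀ i, X'.src (e' i) = σ (X.src (e i)))
    (htgt : ∀ i, X'.toFinGraph.tgt (e' i) = σ (X.toFinGraph.tgt (e i)))
    (hl : ∀ i, X'.label (e' i) = X.label (e i)) : X.Equiv X' := by
  obtain ⟨f, hf⟩ := exists_graphIso he he' σ hsrc htgt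
  refine equiv_of_label_eq torelli_two_eq_bot f fun d => ?_
  obtain ⟨i, rfl | rfl, -⟩ := he d
  · rw [hf, hl]
  · rw [f.rev_eq, label_rev, label_rev, hf, hl]

lemma rose_slopes {e : Fin 2 → X.D} (he : X.toFinGraph.IsOrientation e) :
    X.slopes = {fareySlope (X.label (e 0)), fareySlope (X.label (e 1))} := by
  rw [slopes_eq he]
  ext p; simp [Fin.exists_fin_two, eq_comm]

lemma rose_ncard_slopes {e : Fin 2 → X.D} (he : X.toFinGraph.IsOrientation e) :
    X.slopes.ncard = 2 := by
  rw [rose_slopes he, Set.ncard_pair (unimod_of_rose he).fareySlope_ne]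

lemma IsTheta.ncard_slopes {u w : X.V} {e : Fin 3 → X.D} (he : X.IsTheta u w e) :
    X.slopes.ncard = 3 := by
  rw [slopes_eq he.orient, ← Set.image_univ, Set.ncard_image_of_injective _ he.injective_slope]
  simp [Set.ncard_univ]

/-- Marked graphs of rank two are classified by the slopes of their labels. -/
theorem equiv_of_slopes_eq (h : X.slopes = X'.slopes) : X.Equiv X' := by
  rcases X.rose_or_theta with ⟨hX, e, he⟩ | ⟨-, u, w, e, he⟩ <;>
    rcases X'.rose_or_theta with ⟨hX', e', he'⟩ | ⟨-, u', w', e', he'⟩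
  · obtain ⟨e'', he'', hl⟩ := exists_rose_labels he' (m := fun i => X.label (e i))
      (unimod_of_rose he) (h ▸ rose_slopes he)
    have := hX.subsingleton
    have := hX'.subsingleton
    let σ : X.V ≃ X'.V := ⟨fun _ => X'.base, fun _ => X.base, fun _ => Subsingleton.elim _ _,
      fun _ => Subsingleton.elim _ _⟩
    exact equiv_of_label_eq_of_orientation he he'' σ (fun _ => Subsingleton.elim _ _)
      (fun _ => Subsingleton.elim _ _) hl
  -- A rose has two slopes and a theta three, so the mixed cases cannot occur.
  · have h1 := rose_ncard_slopes he
    rw [h, he'.ncard_slopes] at h1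
    omega
  · have h1 := he.ncard_slopes
    rw [h, rose_ncard_slopes he'] at h1
    omega
  · classical
    obtain ⟨u'', w'', e'', he'', hl⟩ := exists_theta_labels he' (m := fun i => X.label (e i))
      (he.unimod (by decide)) he.sum_label (h ▸ slopes_eq he.orient)
    let σ : X.V ≃ X'.V :=
      { toFun := fun v => if v = u then u'' else w''
        invFun := fun v => if v = u'' then u else w
        left_inv := fun v => by
          rcases he.eq_or v with rfl | rfl
          · simp
          · simp [he.ne.symm, he''.ne.symm]
        right_inv := fun v => by
          rcases he''.eq_or v with rfl | rfl
          · simp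
          · simp [he.ne.symm, he''.ne.symm] }
    refine equiv_of_label_eq_of_orientation he.orient he''.orient σ (fun i => ?_) (fun i => ?_) hl
    · rw [he''.src_eq, he.src_eq]; simp [σ]
    · rw [he''.tgt_eq, he.tgt_eq]; simp [σ, he.ne.symm]

/-- Edge counts take values in ℤ, so conjugation by the base point track `p` does not affect them.
-/
lemma Equiv.slopes_eq (h : X.Equiv X') : X.slopes = X'.slopes := by
  obtain ⟨f, p, -, hf⟩ := h
  have hl : ∀ d, X'.label (f.onD d) = X.label d := fun d => by
    ext i
    refine congrArg Multiplicative.toAdd (a₁ := X'.toFinGraph.count _ _)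
      (a₂ := X.toFinGraph.count _ _) ?_
    rw [← f.count_map, hf, map_mul, map_mul, map_inv, mul_inv_cancel_comm]
  have h1 := f.onD.surjective.range_comp fun d => fareySlope (X'.label d)
  simpa only [Function.comp_def, hl, slopes] using h1

/-- Surviving edges keep their labels under a collapse. -/
lemma CollapsesTo.slopes_subset (h : X.CollapsesTo X') : X'.slopes ⊆ X.slopes := by
  obtain ⟨c, p, -, hc⟩ := h
  rintro _ ⟨d', rfl⟩
  obtain ⟨d, hd, -⟩ := c.onD_bij d'
  refine ⟨d, congrArg fareySlope ?_⟩
  ext i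
  refine congrArg Multiplicative.toAdd (a₁ := X.toFinGraph.count _ _)
    (a₂ := X'.toFinGraph.count _ _) ?_
  rw [← c.count_map hd, hc, map_mul, map_mul, map_inv, mul_inv_cancel_comm]

end MarkedGraph

end OutFn

namespace OutFn

/-! ### The standard rose and the standard theta graph -/

noncomputable section Standard

open FreeGroup

/-- The factors `q` at inner vertices telescope along a path, so checking darts suffices. On loops
at a vertex where `q` is trivial, `ι` inverts `r`. -/
lemma FinGraph.pathClass_of_gauge {Γ : FinGraph} {H : Type*} [Group H] (ι : H →* Γ.EdgeGroup)
    (r : Γ.EdgeGroup →* H) (q : Γ.V → Γ.EdgeGroup)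
    (h : ∀ d, ι (r (Γ.dartClass d)) = q (Γ.src d) * Γ.dartClass d * (q (Γ.tgt d))⁻¹)
    {u w : Γ.V} {x : Γ.EdgeGroup} (hx : x ∈ Γ.paths u w) : ι (r x) = q u * x * (q w)⁻¹ := by
  obtain ⟨l, hl, rfl⟩ := hx
  induction l generalizing u with
  | nil => obtain rfl : u = w := hl; simp [pathClass]
  | cons d l ih =>
    obtain ⟨rfl, hl'⟩ := hl
    have h1 : Γ.pathClass (d :: l) = Γ.dartClass d * Γ.pathClass l := by simp [pathClass]
    rw [h1, _root_.map_mul, _root_.map_mul, h, ih hl']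
    group

/-- The isomorphism of `F_2` with a fundamental group determined by the images of the generators,
a retraction `r`, and paths `q` from the base point to the other vertices. -/
def markingOf {Γ : FinGraph} (v : Γ.V) (ι : F2 →* Γ.EdgeGroup) (r : Γ.EdgeGroup →* F2)
    (q : Γ.V → Γ.EdgeGroup) (hq : q v = 1)
    (h : ∀ d, ι (r (Γ.dartClass d)) = q (Γ.src d) * Γ.dartClass d * (q (Γ.tgt d))⁻¹)
    (hr : ∀ w, r (ι w) = w) (hmem : ∀ w, ι w ∈ Γ.fundGroup v) : F2 ≃* Γ.fundGroup v where
  toFun w := ⟨ι w, hmem w⟩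
  invFun x := r x
  left_inv w := hr w
  right_inv x := Subtype.ext (by
    refine (FinGraph.pathClass_of_gauge ι r q h x.2).trans ?_
    rw [hq, one_mul, inv_one, mul_one])
  map_mul' w w' := Subtype.ext (by simp)

lemma apply_mem_of_generators {G : Type*} [Group G] {S : Subgroup G} {ι : F2 →* G}
    (h : ∀ i, ι (of i) ∈ S) (w : F2) : ι w ∈ S := by
  induction w using FreeGroup.induction_on with
  | C1 => rw [_root_.map_one]; exact S.one_mem
  | of i => exact h i
  | inv_of i hi => rw [_root_.map_inv]; exact S.inv_mem hi
  | mul x y hx hy => rw [_root_.map_mul]; exact S.mul_mem hx hy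

/-- The rose with two edges. -/
abbrev roseGraph : FinGraph where
  V := Unit
  D := Fin 2 × Bool
  finV := inferInstance
  finD := inferInstance
  src _ := ()
  rev d := (d.1, !d.2)
  rev_rev d := by simp
  rev_ne d := by simp [Prod.ext_iff]

/-- The theta graph: three edges joining two vertices. -/
abbrev thetaGraph : FinGraph where
  V := Bool
  D := Fin 3 × Bool
  finV := inferInstance
  finD := inferInstance
  src d := d.2
  rev d := (d.1, !d.2)
  rev_rev d := by simp
  rev_ne d := by simp [Prod.ext_iff]

def roseIncl : F2 →* roseGraph.EdgeGroup := FreeGroup.lift fun i => roseGraph.dartClass (i, false)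

def roseRetr : roseGraph.EdgeGroup →* F2 :=
  roseGraph.edgeLift (fun d => if d.2 then (of d.1)⁻¹ else of d.1) (by
    rintro ⟨i, b⟩; cases b <;> simp)

def thetaIncl : F2 →* thetaGraph.EdgeGroup :=
  FreeGroup.lift fun i => thetaGraph.dartClass (i.castSucc, false) *
    (thetaGraph.dartClass (2, false))⁻¹

/-- The third edge is used as maximal tree and is sent to 1. -/
def thetaRetr : thetaGraph.EdgeGroup →* F2 :=
  thetaGraph.edgeLift
    (fun d => if d.2 then (![of 0, of 1, 1] d.1)⁻¹ else (![of 0, of 1, 1] d.1)) (by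
    rintro ⟨i, b⟩; cases b <;> simp)

lemma rose_dart_true (i : Fin 2) :
    roseGraph.dartClass (i, true) = (roseGraph.dartClass (i, false))⁻¹ :=
  roseGraph.dartClass_rev (i, false)

lemma theta_dart_true (i : Fin 3) :
    thetaGraph.dartClass (i, true) = (thetaGraph.dartClass (i, false))⁻¹ :=
  thetaGraph.dartClass_rev (i, false)

lemma roseRetr_dart (d : Fin 2 × Bool) :
    roseRetr (roseGraph.dartClass d) = if d.2 then (of d.1)⁻¹ else of d.1 :=
  roseGraph.edgeLift_dartClass _ _ _

lemma thetaRetr_dart (d : Fin 3 × Bool) : thetaRetr (thetaGraph.dartClass d) =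
    if d.2 then (![of 0, of 1, 1] d.1)⁻¹ else (![of 0, of 1, 1] d.1 : F2) :=
  thetaGraph.edgeLift_dartClass _ _ _

lemma roseIncl_of (i : Fin 2) : roseIncl (of i) = roseGraph.dartClass (i, false) := by
  simp [roseIncl]

lemma thetaIncl_of (i : Fin 2) : thetaIncl (of i) =
    thetaGraph.dartClass (i.castSucc, false) * (thetaGraph.dartClass (2, false))⁻¹ := by
  simp [thetaIncl]

/-- The standard rose with the identity marking. -/
abbrev stdRose : MarkedGraph 2 where
  toFinGraph := roseGraph
  connected := ⟨⟨()⟩, fun _ _ => ⟨[], rfl, by simp⟩⟩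
  noSeparatingEdge := fun _ _ _ => ⟨[], rfl, by simp⟩
  three_le_valence := fun v => by
    have h : ∀ v : Unit, 3 ≤ Fintype.card {d : Fin 2 × Bool // () = v} := by decide
    exact (h v).trans_eq Nat.card_eq_fintype_card.symm
  base := ()
  marking := markingOf (Γ := roseGraph) () roseIncl roseRetr (fun _ => 1) rfl (by
      rintro ⟨i, b⟩
      rw [roseRetr_dart]
      cases b
      · simp [roseIncl_of]
      · simp [roseIncl_of, rose_dart_true])
    (fun w => DFunLike.congr_fun (f := roseRetr.comp roseIncl) (g := MonoidHom.id _)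
      (FreeGroup.ext_hom _ _ fun i => by simp [roseIncl_of, roseRetr_dart]) w)
    (apply_mem_of_generators fun i => by
      rw [roseIncl_of]
      exact roseGraph.dartClass_mem_paths (i, false))

lemma theta_joined (p : thetaGraph.D → Prop) (i : Fin 3) (hp : ∀ b, p (i, b)) (u w : Bool) :
    thetaGraph.Joined p u w := by
  by_cases h : u = w
  · exact ⟨[], h, by simp⟩
  · refine ⟨[(i, u)], ⟨rfl, ?_⟩, List.forall_mem_singleton.2 (hp u)⟩
    change (!u) = w
    cases u <;> cases w <;> simp at h ⊢

/-- The standard theta graph; collapsing its last edge gives the standard rose. -/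
abbrev stdTheta : MarkedGraph 2 where
  toFinGraph := thetaGraph
  connected := ⟨⟨false⟩, fun u w => theta_joined _ 0 (fun _ => trivial) u w⟩
  noSeparatingEdge := fun e u w => by
    obtain ⟨i, hi⟩ := exists_ne e.1
    exact theta_joined _ i (fun b => ⟨fun h => hi (congrArg Prod.fst h),
      fun h => hi (congrArg Prod.fst h)⟩) u w
  three_le_valence := fun v => by
    have h : ∀ v : Bool, 3 ≤ Fintype.card {d : Fin 3 × Bool // d.2 = v} := by decide
    exact (h v).trans_eq Nat.card_eq_fintype_card.symm
  base := false
  marking := markingOf (Γ := thetaGraph) false thetaIncl thetaRetr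
    (fun b : Bool => if b then thetaGraph.dartClass (2, false) else 1) rfl (by
      rintro ⟨i, b⟩
      rw [thetaRetr_dart]
      cases b <;> fin_cases i <;>
        simp [thetaIncl_of, theta_dart_true, thetaGraph, FinGraph.tgt])
    (fun w => DFunLike.congr_fun (f := thetaRetr.comp thetaIncl) (g := MonoidHom.id _)
      (FreeGroup.ext_hom _ _ fun i => by
        fin_cases i <;> simp [thetaIncl_of, thetaRetr_dart]) w)
    (apply_mem_of_generators fun i => by
      rw [thetaIncl_of]
      exact FinGraph.mul_mem_paths (thetaGraph.dartClass_mem_paths (i.castSucc, false))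
        (FinGraph.inv_mem_paths (thetaGraph.dartClass_mem_paths (2, false))))

lemma isOrientation_rose : roseGraph.IsOrientation fun i : Fin 2 => (i, false) := by
  rintro ⟨i, b⟩
  refine ⟨i, by cases b <;> simp [roseGraph], ?_⟩
  rintro j (h | h) <;> exact (congrArg Prod.fst h).symm

lemma isOrientation_theta : thetaGraph.IsOrientation fun i : Fin 3 => (i, false) := by
  rintro ⟨i, b⟩
  refine ⟨i, by cases b <;> simp [thetaGraph], ?_⟩
  rintro j (h | h) <;> exact (congrArg Prod.fst h).symm

lemma stdRose_isRose : stdRose.IsRose := by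
  change Nat.card Unit = 1
  simp

lemma isTheta_stdTheta (φ : MulAut F2) :
    (stdTheta.precomp φ).IsTheta false true fun i : Fin 3 => (i, false) where
  ne := Bool.false_ne_true
  eq_or := fun v => Bool.eq_false_or_eq_true v |>.symm
  orient := isOrientation_theta
  src_eq _ := rfl
  tgt_eq _ := rfl

/-- Collapsing the last edge of the theta graph. -/
def collapseTheta : ForestCollapse thetaGraph roseGraph where
  onV _ := ()
  onD d := ![some (0, d.2), some (1, d.2), none] d.1
  forest := by
    rintro v l hl hF hc
    have hd : ∀ d : Fin 3 × Bool,
        ![some ((0 : Fin 2), d.2), some (1, d.2), none] d.1 = none → d.1 = 2 := by decide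
    -- A single dart over the collapsed edge is not closed, and two consecutive ones backtrack.
    match l with
    | [] => rfl
    | [d] =>
      obtain ⟨h1, h2⟩ := hl
      have h3 : (!d.2) = d.2 := Eq.trans (b := v) h2 h1.symm
      simp at h3
    | d :: d' :: l =>
      exfalso
      obtain ⟨-, h2, -⟩ := hl
      have h3 := hd d (hF d (by simp))
      have h4 := hd d' (hF d' (by simp))
      exact (List.isChain_cons_cons.1 hc).1 (Prod.ext (h4.trans h3.symm) h2)
  rev_eq := by
    rintro ⟨i, b⟩
    fin_cases i <;> rfl
  src_eq _ _ _ := rfl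
  onD_bij := by
    rintro ⟨i, b⟩
    refine ⟨(i.castSucc, b), by fin_cases i <;> rfl, ?_⟩
    change ∀ d : Fin 3 × Bool, ![some ((0 : Fin 2), d.2), some (1, d.2), none] d.1 = some (i, b) →
      d = (i.castSucc, b)
    revert i b
    decide
  onV_surj := fun _ => ⟨false, rfl⟩
  onV_eq_iff := fun u w => ⟨fun _ => theta_joined _ 2 (fun _ => rfl) u w, fun _ => rfl⟩

lemma stdTheta_collapsesTo (φ : MulAut F2) :
    (stdTheta.precomp φ).CollapsesTo (stdRose.precomp φ) := by
  refine ⟨collapseTheta, 1, roseGraph.one_mem_paths (), fun w => ?_⟩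
  have h : collapseTheta.map.comp thetaIncl = roseIncl := FreeGroup.ext_hom _ _ fun i => by
    rw [MonoidHom.comp_apply, thetaIncl_of, roseIncl_of, _root_.map_mul, _root_.map_inv,
      ForestCollapse.map_dartClass, ForestCollapse.map_dartClass]
    fin_cases i <;> simp [collapseTheta]
  rw [one_mul, inv_one, mul_one]
  exact DFunLike.congr_fun h (φ w)

lemma label_precomp {n : ℕ} (X : MarkedGraph n) (φ : MulAut (FreeGroup (Fin n))) (d : X.D) :
    (X.precomp φ).label d = Matrix.vecMul (X.label d) (abMatrix φ.toMonoidHom) := by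
  ext i
  exact X.count_mark d (φ (of i))

lemma stdRose_label (i : Fin 2) : stdRose.label (i, false) = Pi.single i 1 := by
  ext j
  change (roseGraph.count (i, false) (roseIncl (of j))).toAdd = _
  rw [roseIncl_of, isOrientation_rose.count_eq i j, Pi.single_apply]

lemma stdTheta_label (i : Fin 2) : stdTheta.label (i.castSucc, false) = Pi.single i 1 := by
  ext j
  change (thetaGraph.count (i.castSucc, false) (thetaIncl (of j))).toAdd = _
  rw [thetaIncl_of, _root_.map_mul, _root_.map_inv, toAdd_mul, toAdd_inv,
    isOrientation_theta.count_eq i.castSucc j.castSucc, isOrientation_theta.count_eq i.castSucc 2,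
    Pi.single_apply]
  fin_cases i <;> fin_cases j <;> simp

/-- Every basis of `ℤ^2` is realized by a rose, and by a theta graph that collapses to it. -/
theorem exists_rose_theta {m : Fin 2 → Fin 2 → ℤ} (hm : Unimod (m 0) (m 1)) :
    ∃ X Y : MarkedGraph 2, X.IsRose ∧ ¬ Y.IsRose ∧ Y.CollapsesTo X ∧
      (∃ e : Fin 2 → X.D, X.toFinGraph.IsOrientation e ∧ ∀ i, X.label (e i) = m i) ∧
      Y.slopes = {fareySlope (m 0), fareySlope (m 1), fareySlope (m 0 + m 1)} := by
  obtain ⟨φ, hφ⟩ := exists_abMatrix_eq m (unimod_iff_det.1 hm)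
  have hrow : ∀ i, Matrix.vecMul (Pi.single i 1) m = m i := fun i => Matrix.single_one_vecMul i m
  refine ⟨stdRose.precomp φ, stdTheta.precomp φ, stdRose_isRose, ?_, stdTheta_collapsesTo φ,
    ⟨_, isOrientation_rose, fun i => ?_⟩, ?_⟩
  · change ¬ Nat.card Bool = 1
    simp
  · rw [label_precomp, hφ]
    exact (congrArg (fun v => Matrix.vecMul v m) (stdRose_label i)).trans (hrow i)
  · have hθ := isTheta_stdTheta φ
    have h0 : (stdTheta.precomp φ).label ((0 : Fin 3), false) = m 0 := by
      rw [label_precomp, hφ]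
      exact (congrArg (fun v => Matrix.vecMul v m) (stdTheta_label 0)).trans (hrow 0)
    have h1 : (stdTheta.precomp φ).label ((1 : Fin 3), false) = m 1 := by
      rw [label_precomp, hφ]
      exact (congrArg (fun v => Matrix.vecMul v m) (stdTheta_label 1)).trans (hrow 1)
    have hs := hθ.sum_label
    rw [Fin.sum_univ_three] at hs
    have h2 : (stdTheta.precomp φ).label ((2 : Fin 3), false) = -(m 0 + m 1) := by
      rw [← h0, ← h1]
      exact eq_neg_of_add_eq_zero_right hs
    rw [MarkedGraph.slopes_eq hθ.orient, range_fin_three, h0, h1, h2, fareySlope_neg]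

end Standard

end OutFn

namespace OutFn

/-! ### Trees given by parent functions -/

section Parent

open Relation

/-- A graph in which every vertex except the root is joined to a parent of smaller height, and
which has no further edges, is a tree. -/
lemma isTree_of_parent {V Λ : Type*} [Preorder Λ] [WellFoundedLT Λ] {G : SimpleGraph V} (r : V)
    (p : V → V) (m : V → Λ) (hm : ∀ v, v ≠ r → m (p v) < m v)
    (hadj : ∀ u v, G.Adj u v ↔ (u ≠ r ∧ v = p u) ∨ (v ≠ r ∧ u = p v)) : G.IsTree := by
  have hreach : ∀ v, G.Reachable v r := by
    intro v
    induction v using (InvImage.wf m wellFounded_lt).induction with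
    | _ v ih =>
      by_cases hv : v = r
      · rw [hv]
      · exact ((hadj v (p v)).2 (Or.inl ⟨hv, rfl⟩)).reachable.trans (ih _ (hm v hv))
  have : Nonempty V := ⟨r⟩
  refine ⟨⟨fun u v => (hreach u).trans (hreach v).symm⟩, ?_⟩
  have key : ∀ u, u ≠ r → G.IsBridge s(u, p u) := by
    intro u hu
    rw [SimpleGraph.isBridge_iff]
    -- `D` is the set of descendants of `u`. Once the edge from `u` to its parent is deleted, no
    -- edge leaves `D`; all heights in `D` are at least `m u`, so the parent lies outside.
    let D : Set V := {x | ReflTransGen (fun x y => x ≠ r ∧ y = p x) x u}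
    have hD : ∀ x y, (G.deleteEdges {s(u, p u)}).Adj x y → x ∈ D → y ∈ D := by
      intro x y hxy hx
      rw [SimpleGraph.deleteEdges_adj] at hxy
      obtain ⟨h1, h2⟩ := hxy
      rcases (hadj x y).1 h1 with ⟨hxr, rfl⟩ | ⟨hyr, rfl⟩
      · rcases ReflTransGen.cases_head hx with rfl | ⟨z, ⟨-, rfl⟩, hz⟩
        · exact absurd rfl h2
        · exact hz
      · exact ReflTransGen.head ⟨hyr, rfl⟩ hx
    have hle : ∀ x ∈ D, m u ≤ m x := by
      intro x hx
      induction hx using ReflTransGen.head_induction_on with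
      | refl => exact le_rfl
      | head h _ ih => exact ih.trans (h.2 ▸ (hm _ h.1).le)
    have hwalk : ∀ x y, (G.deleteEdges {s(u, p u)}).Reachable x y → x ∈ D → y ∈ D := by
      rintro x y ⟨w⟩
      induction w with
      | nil => exact id
      | cons h _ ih => exact fun hx => ih (hD _ _ h hx)
    intro h
    exact absurd (hle _ (hwalk _ _ h ReflTransGen.refl)) (not_le_of_gt (hm u hu))
  rw [SimpleGraph.isAcyclic_iff_forall_adj_isBridge]
  intro u v huv
  rcases (hadj u v).1 huv with ⟨hu, rfl⟩ | ⟨hv, rfl⟩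
  · exact key u hu
  · rw [Sym2.eq_swap]; exact key v hv

/-- The parent function need only behave well on vertices of `K`, and any two distinct vertices of a
face must be child and parent. -/
lemma isTreeComplex_of_parent {V Λ : Type*} [Preorder Λ] [WellFoundedLT Λ]
    {K : PreAbstractSimplicialComplex V} (r : V) (p : V → V) (m : V → Λ)
    (hr : {r} ∈ K.faces) (hcard : ∀ s ∈ K.faces, s.card ≤ 2)
    (hp : ∀ v, {v} ∈ K.faces → v ≠ r → m (p v) < m v ∧ ∃ s ∈ K.faces, v ∈ s ∧ p v ∈ s)
    (hface : ∀ s ∈ K.faces, ∀ u ∈ s, ∀ v ∈ s, u ≠ v → (u ≠ r ∧ v = p u) ∨ (v ≠ r ∧ u = p v)) :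
    IsTreeComplex K := by
  classical
  refine ⟨hcard, ?_⟩
  have hpK : ∀ v, {v} ∈ K.faces → v ≠ r → {p v} ∈ K.faces := fun v hv hvr => by
    obtain ⟨-, s, hs, -, hps⟩ := hp v hv hvr
    exact (K.isRelLowerSet_faces hs).2 (Finset.singleton_subset_iff.2 hps)
      (Finset.singleton_nonempty _)
  let p' : {v : V // {v} ∈ K.faces} → {v : V // {v} ∈ K.faces} := fun v =>
    if h : v.1 = r then ⟨r, hr⟩ else ⟨p v.1, hpK v.1 v.2 h⟩
  have hp' : ∀ v : {v : V // {v} ∈ K.faces}, v ≠ ⟨r, hr⟩ → (p' v).1 = p v.1 := fun v hv => by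
    have : v.1 ≠ r := fun h => hv (Subtype.ext h)
    simp [p', this]
  have hne : ∀ v : {v : V // {v} ∈ K.faces}, v ≠ ⟨r, hr⟩ ↔ v.1 ≠ r := fun v =>
    not_congr Subtype.ext_iff
  refine isTree_of_parent ⟨r, hr⟩ p' (fun v => m v.1) (fun v hv => ?_) (fun u v => ?_)
  · rw [hp' v hv]
    exact (hp v.1 v.2 ((hne v).1 hv)).1
  · have hpar : ∀ u : {v : V // {v} ∈ K.faces}, u ≠ ⟨r, hr⟩ → (oneSkeleton K).Adj u (p' u) := by
      intro u hu
      obtain ⟨h1, s, hs, hus, hps⟩ := hp u.1 u.2 ((hne u).1 hu)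
      rw [← hp' u hu] at hps
      refine ⟨fun h => ?_, s, hs, hus, hps⟩
      have h2 := hp' u hu
      rw [← h] at h2
      rw [← h2] at h1
      exact lt_irrefl _ h1
    constructor
    · rintro ⟨huv, s, hs, hus, hvs⟩
      rcases hface s hs u hus v hvs (fun h => huv (Subtype.ext h)) with ⟨h1, h2⟩ | ⟨h1, h2⟩
      · have h3 := (hne u).2 h1
        exact Or.inl ⟨h3, Subtype.ext (h2.trans (hp' u h3).symm)⟩
      · have h3 := (hne v).2 h1
        exact Or.inr ⟨h3, Subtype.ext (h2.trans (hp' v h3).symm)⟩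
    · rintro (⟨h, rfl⟩ | ⟨h, rfl⟩)
      · exact hpar u h
      · exact (hpar v h).symm

end Parent

/-! ### Complexes built from stars of roses -/

lemma mem_iSup_faces {V W : Type*} {S : Set W} {F : W → PreAbstractSimplicialComplex V}
    {s : Finset V} : s ∈ (⨆ ρ ∈ S, F ρ).faces ↔ ∃ ρ ∈ S, s ∈ (F ρ).faces := by
  simp only [iSup, sSup, Set.mem_iUnion, Set.mem_range, exists_prop]
  constructor
  · rintro ⟨_, ⟨ρ, rfl⟩, hs⟩
    simp only [Set.mem_iUnion, exists_prop] at hs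
    obtain ⟨_, ⟨hρ, rfl⟩, hs⟩ := hs
    exact ⟨ρ, hρ, hs⟩
  · rintro ⟨ρ, hρ, hs⟩
    refine ⟨_, ⟨ρ, rfl⟩, ?_⟩
    simp only [Set.mem_iUnion, exists_prop]
    exact ⟨_, ⟨hρ, rfl⟩, hs⟩

/-- The combinatorics of the roses and theta graphs of rank two. The two theta graphs incident to a
rose are its arms; every theta graph has a unique incident rose of smallest norm; and every rose
except the root has exactly one arm incident to a rose of smaller norm. -/
structure RoseOrder (V Λ : Type*) [LinearOrder Λ] where
  Rose : V → Prop
  Inc : V → V → Prop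
  norm : V → Λ
  root : V
  rose_root : Rose root
  rose_of_inc : ∀ {ρ θ}, Inc ρ θ → Rose ρ
  not_rose_of_inc : ∀ {ρ θ}, Inc ρ θ → ¬ Rose θ
  arms : ∀ ρ, Rose ρ → ∃ θ₁ θ₂, θ₁ ≠ θ₂ ∧ ∀ θ, Inc ρ θ ↔ θ = θ₁ ∨ θ = θ₂
  exists_other : ∀ {ρ θ}, Inc ρ θ → ∃ σ, σ ≠ ρ ∧ Inc σ θ
  bottom : ∀ θ, ¬ Rose θ → ∃ ρ, Inc ρ θ ∧ ∀ σ, Inc σ θ → σ ≠ ρ → norm ρ < norm σ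
  down : ∀ ρ, Rose ρ → ρ ≠ root → ∃ θ, Inc ρ θ ∧ (∃ σ, Inc σ θ ∧ norm σ < norm ρ) ∧
    ∀ θ', Inc ρ θ' → θ' ≠ θ → ∀ σ, Inc σ θ' → norm ρ ≤ norm σ

namespace RoseOrder

variable {V Λ : Type*} [LinearOrder Λ] (T : RoseOrder V Λ)

/-- The star of a rose: the union of the edges joining it to its arms. -/
def star (ρ : V) : PreAbstractSimplicialComplex V where
  faces := {s | s.Nonempty ∧ ∃ θ, T.Inc ρ θ ∧ (s : Set V) ⊆ {ρ, θ}}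
  isRelLowerSet_faces := fun _ hs => ⟨hs.1, fun _ hts ht => ⟨ht, hs.2.imp fun _ h =>
    ⟨h.1, (Finset.coe_subset.2 hts).trans h.2⟩⟩⟩

lemma star_faces {ρ θ₁ θ₂ : V} (h : ∀ θ, T.Inc ρ θ ↔ θ = θ₁ ∨ θ = θ₂) :
    (T.star ρ).faces = {s : Finset V | s.Nonempty ∧
      ((s : Set V) ⊆ {ρ, θ₁} ∨ (s : Set V) ⊆ {ρ, θ₂})} := by
  ext s
  simp [star, h]

lemma singleton_mem_star {ρ θ : V} (h : T.Inc ρ θ) : {θ} ∈ (T.star ρ).faces :=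
  ⟨Finset.singleton_nonempty _, θ, h, by simp⟩

/-- Two different stars meet in common arms. -/
lemma exists_of_mem_star {ρ σ : V} (hσ : T.Rose σ) (hρ : T.Rose ρ) (hne : σ ≠ ρ) {s : Finset V}
    (hs : s ∈ (T.star ρ).faces) (hs' : s ∈ (T.star σ).faces) :
    ∃ θ, T.Inc ρ θ ∧ T.Inc σ θ ∧ s = {θ} := by
  obtain ⟨hsne, θ, hθ, h1⟩ := hs
  obtain ⟨-, θ', hθ', h2⟩ := hs'
  have key : ∀ x ∈ s, x = θ ∧ x = θ' := by
    intro x hx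
    have hnr : ¬ T.Rose x := by
      intro hxr
      rcases h1 hx with rfl | rfl
      · rcases h2 hx with rfl | rfl
        · exact hne rfl
        · exact T.not_rose_of_inc hθ' hρ
      · exact T.not_rose_of_inc hθ hxr
    rcases h1 hx with rfl | rfl
    · exact absurd hρ hnr
    · rcases h2 hx with rfl | rfl
      · exact absurd hσ hnr
      · exact ⟨rfl, rfl⟩
  obtain ⟨x, hx⟩ := hsne
  obtain ⟨rfl, rfl⟩ := key x hx
  exact ⟨x, hθ, hθ', Finset.eq_singleton_iff_unique_mem.2 ⟨hx, fun y hy => (key y hy).1⟩⟩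

/-- Different stars share only arms, and `exists_other` makes each arm of `ρ` shared. -/
lemma star_inf_iSup_star {ρ : V} (hρ : T.Rose ρ) {θ₁ θ₂ : V}
    (h : ∀ θ, T.Inc ρ θ ↔ θ = θ₁ ∨ θ = θ₂) :
    (T.star ρ ⊓ ⨆ σ ∈ {σ | T.Rose σ ∧ σ ≠ ρ}, T.star σ).faces = {{θ₁}, {θ₂}} := by
  ext s
  constructor
  · rintro ⟨h1, h2⟩
    obtain ⟨σ, ⟨hσ, hne⟩, h3⟩ := mem_iSup_faces.1 h2
    obtain ⟨θ, hθ, -, rfl⟩ := T.exists_of_mem_star hσ hρ hne h1 h3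
    rcases (h θ).1 hθ with rfl | rfl <;> simp
  · have key : ∀ θ, T.Inc ρ θ →
        {θ} ∈ (T.star ρ ⊓ ⨆ σ ∈ {σ | T.Rose σ ∧ σ ≠ ρ}, T.star σ).faces := fun θ hθ => by
      obtain ⟨σ, hne, hσ⟩ := T.exists_other hθ
      exact ⟨T.singleton_mem_star hθ,
        mem_iSup_faces.2 ⟨σ, ⟨T.rose_of_inc hσ, hne⟩, T.singleton_mem_star hσ⟩⟩
    rintro (rfl | rfl)
    exacts [key _ ((h _).2 (Or.inl rfl)), key _ ((h _).2 (Or.inr rfl))]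

/-- Only the descending arm from `down` touches a rose of smaller norm; all roses at the other arm
have norm at least that of `ρ`. -/
lemma exists_descending {ρ : V} (hρ : T.Rose ρ) (hne : ρ ≠ T.root) :
    ∃ θ, (T.star ρ ⊓ ⨆ σ ∈ {σ | T.Rose σ ∧ T.norm σ < T.norm ρ}, T.star σ).faces = {{θ}} := by
  obtain ⟨θ, hθ, ⟨σ, hσ, hlt⟩, hother⟩ := T.down ρ hρ hne
  refine ⟨θ, Set.ext fun s => ⟨?_, ?_⟩⟩
  · rintro ⟨h1, h2⟩
    obtain ⟨τ, ⟨hτ, hτlt⟩, h3⟩ := mem_iSup_faces.1 h2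
    obtain ⟨θ', hθ', hτθ', rfl⟩ := T.exists_of_mem_star hτ hρ (fun h => (h ▸ hτlt).ne rfl) h1 h3
    by_cases h : θ' = θ
    · rw [h]; rfl
    · exact absurd hτlt (not_lt_of_ge (hother θ' hθ' h τ hτθ'))
  · rintro rfl
    exact ⟨T.singleton_mem_star hθ,
      mem_iSup_faces.2 ⟨σ, ⟨T.rose_of_inc hσ, hlt⟩, T.singleton_mem_star hσ⟩⟩

variable [WellFoundedLT Λ]

/-- A nonempty set of roses closed under passing to smaller norm contains the root. -/
lemma root_mem {S : Set V} (hS : S.Nonempty) (hrose : ∀ ρ ∈ S, T.Rose ρ)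
    (hdown : ∀ ρ ∈ S, ∀ σ, T.Rose σ → T.norm σ < T.norm ρ → σ ∈ S) : T.root ∈ S := by
  have hmem := Function.argminOn_mem T.norm S hS
  set ρ := Function.argminOn T.norm S hS with hρ
  by_cases h : ρ = T.root
  · rwa [← h]
  · obtain ⟨θ, -, ⟨σ, hσ, hlt⟩, -⟩ := T.down ρ (hrose _ hmem) h
    exact absurd hlt (not_lt_of_ge (Function.argminOn_le T.norm S
      (hdown _ hmem σ (T.rose_of_inc hσ) hlt)))

/-- The roses below the root form a downward closed set. If it were nonempty, `root_mem` would put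
the root strictly below itself. -/
lemma norm_root_le {σ : V} (hσ : T.Rose σ) : T.norm T.root ≤ T.norm σ := by
  by_contra! h
  exact lt_irrefl _ (T.root_mem (S := {τ | T.Rose τ ∧ T.norm τ < T.norm T.root})
    ⟨σ, hσ, h⟩ (fun _ hτ => hτ.1) (fun _ hτ _ hυ hlt => ⟨hυ, hlt.trans hτ.2⟩)).2

lemma descending_root :
    (T.star T.root ⊓ ⨆ σ ∈ {σ | T.Rose σ ∧ T.norm σ < T.norm T.root}, T.star σ).faces = ∅ := by
  ext s
  simp only [Set.mem_empty_iff_false, iff_false]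
  rintro ⟨-, h2⟩
  obtain ⟨σ, ⟨hσ, hlt⟩, -⟩ := mem_iSup_faces.1 h2
  exact absurd hlt (not_lt_of_ge (T.norm_root_le hσ))

/-- Initial segments are trees. -/
theorem isTreeComplex_iSup_star {S : Set V} (hS : S.Nonempty) (hrose : ∀ ρ ∈ S, T.Rose ρ)
    (hdown : ∀ ρ ∈ S, ∀ σ, T.Rose σ → T.norm σ < T.norm ρ → σ ∈ S) :
    IsTreeComplex (⨆ ρ ∈ S, T.star ρ) := by
  classical
  -- `bot` chooses the lowest rose of a theta and `dn` the descending arm of a rose, with irrelevant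
  -- values elsewhere.
  have hbot : ∀ θ, ∃ ρ, ¬ T.Rose θ →
      (T.Inc ρ θ ∧ ∀ σ, T.Inc σ θ → σ ≠ ρ → T.norm ρ < T.norm σ) := fun θ => by
    by_cases h : T.Rose θ
    · exact ⟨θ, fun h' => absurd h h'⟩
    · exact (T.bottom θ h).imp fun _ h _ => h
  choose bot hbot using hbot
  have hdn : ∀ ρ, ∃ θ, T.Rose ρ → ρ ≠ T.root →
      (T.Inc ρ θ ∧ (∃ σ, T.Inc σ θ ∧ T.norm σ < T.norm ρ) ∧
        ∀ θ', T.Inc ρ θ' → θ' ≠ θ → ∀ σ, T.Inc σ θ' → T.norm ρ ≤ T.norm σ) := fun ρ => by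
    by_cases h : T.Rose ρ ∧ ρ ≠ T.root
    · exact (T.down ρ h.1 h.2).imp fun _ h _ _ => h
    · exact ⟨ρ, fun h1 h2 => absurd ⟨h1, h2⟩ h⟩
  choose dn hdn using hdn
  have hbot_le : ∀ {σ θ}, T.Inc σ θ → T.norm (bot θ) ≤ T.norm σ := fun {σ θ} h => by
    by_cases h' : σ = bot θ
    · rw [h']
    · exact ((hbot θ (T.not_rose_of_inc h)).2 σ h h').le
  let p : V → V := fun v => if T.Rose v then dn v else bot v
  -- A theta is placed just above its lowest rose. The second coordinate breaks this tie, while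
  -- going from a rose to its descending arm lowers the first.
  let m : V → Λ ×ₗ ℕ := fun v =>
    if T.Rose v then toLex (T.norm v, 0) else toLex (T.norm (bot v), 1)
  have hroot := T.root_mem hS hrose hdown
  have hroseS : ∀ v, {v} ∈ (⨆ ρ ∈ S, T.star ρ).faces → T.Rose v → v ∈ S := fun v hv hr => by
    obtain ⟨ρ, hρ, -, θ, hθ, hsub⟩ := mem_iSup_faces.1 hv
    rcases hsub (Finset.mem_coe.2 (Finset.mem_singleton_self v)) with rfl | rfl
    · exact hρ
    · exact absurd hr (T.not_rose_of_inc hθ)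
  have hthetaS : ∀ v, {v} ∈ (⨆ ρ ∈ S, T.star ρ).faces → ¬ T.Rose v → bot v ∈ S :=
    fun v hv hr => by
    obtain ⟨ρ, hρ, -, θ, hθ, hsub⟩ := mem_iSup_faces.1 hv
    rcases hsub (Finset.mem_coe.2 (Finset.mem_singleton_self v)) with rfl | rfl
    · exact absurd (hrose _ hρ) hr
    -- Downward closure of `S` provides the parent of a theta even when the theta was reached from a
    -- higher rose.
    · by_cases h : ρ = bot v
      · rwa [← h]
      · exact hdown ρ hρ _ (T.rose_of_inc (hbot v hr).1) ((hbot v hr).2 ρ hθ h)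
  have hedge : ∀ {ρ θ}, ρ ∈ S → T.Inc ρ θ → ({ρ, θ} : Finset V) ∈ (⨆ ρ ∈ S, T.star ρ).faces :=
    fun {ρ θ} hρ h => mem_iSup_faces.2 ⟨ρ, hρ, by simp, θ, h, by simp⟩
  refine isTreeComplex_of_parent T.root p m ?_ ?_ ?_ ?_
  · obtain ⟨θ₁, θ₂, -, h⟩ := T.arms _ T.rose_root
    exact mem_iSup_faces.2 ⟨_, hroot, Finset.singleton_nonempty _, θ₁, (h θ₁).2 (Or.inl rfl),
      by simp⟩
  · intro s hs
    obtain ⟨ρ, hρ, -, θ, hθ, hsub⟩ := mem_iSup_faces.1 hs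
    have : s ⊆ {ρ, θ} := by
      intro x hx
      simpa using hsub hx
    exact (Finset.card_le_card this).trans Finset.card_le_two
  · intro v hv hne
    by_cases hr : T.Rose v
    · obtain ⟨h1, ⟨σ, hσ, hlt⟩, -⟩ := hdn v hr hne
      have h2 := T.not_rose_of_inc h1
      simp only [p, m, hr, h2, if_true, if_false]
      exact ⟨Prod.Lex.toLex_lt_toLex.2 (Or.inl ((hbot_le hσ).trans_lt hlt)), _,
        hedge (hroseS v hv hr) h1, by simp, by simp⟩
    · have h1 := (hbot v hr).1
      have h2 := T.rose_of_inc h1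
      simp only [p, m, hr, h2, if_true, if_false]
      exact ⟨Prod.Lex.toLex_lt_toLex.2 (Or.inr ⟨rfl, Nat.zero_lt_one⟩), _,
        hedge (hthetaS v hv hr) h1, by simp, by simp⟩
  · have key : ∀ {ρ θ}, T.Inc ρ θ →
        (ρ ≠ T.root ∧ θ = p ρ) ∨ (θ ≠ T.root ∧ ρ = p θ) := fun {ρ θ} h => by
      have hρ := T.rose_of_inc h
      have hθ := T.not_rose_of_inc h
      simp only [p, hρ, hθ, if_true, if_false]
      -- If `ρ` is not the lowest rose at `θ`, then `θ` leads down from `ρ`, so it is the unique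
      -- descending arm.
      by_cases hb : ρ = bot θ
      · exact Or.inr ⟨fun h' => hθ (h' ▸ T.rose_root), hb⟩
      · have hlt := (hbot θ hθ).2 ρ h hb
        have hne : ρ ≠ T.root := by
          rintro rfl
          exact absurd hlt (not_lt_of_ge (T.norm_root_le (T.rose_of_inc (hbot θ hθ).1)))
        refine Or.inl ⟨hne, ?_⟩
        by_contra h'
        exact absurd hlt (not_lt_of_ge ((hdn ρ hρ hne).2.2 θ h h' _ (hbot θ hθ).1))
    intro s hs u hu v hv huv
    obtain ⟨ρ, hρ, -, θ, hθ, hsub⟩ := mem_iSup_faces.1 hs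
    rcases hsub hu with rfl | rfl <;> rcases hsub hv with rfl | rfl
    · exact absurd rfl huv
    · exact key hθ
    · exact (key hθ).symm
    · exact absurd rfl huv

end RoseOrder

end OutFn

namespace OutFn

/-! ### Edges and triangles of the Farey graph -/

/-- The edge of the Farey graph given by two vectors. -/
def pairSlopes (v w : Fin 2 → ℤ) : Set (OnePoint ℚ) := {fareySlope v, fareySlope w}

/-- The triangle of the Farey graph given by two vectors. -/
def triSlopes (v w : Fin 2 → ℤ) : Set (OnePoint ℚ) :=
  {fareySlope v, fareySlope w, fareySlope (v + w)}

lemma pairSlopes_comm (v w : Fin 2 → ℤ) : pairSlopes v w = pairSlopes w v := Set.pair_comm _ _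

lemma pairSlopes_neg_right (v w : Fin 2 → ℤ) : pairSlopes v (-w) = pairSlopes v w := by
  rw [pairSlopes, fareySlope_neg, pairSlopes]

lemma triSlopes_comm (v w : Fin 2 → ℤ) : triSlopes v w = triSlopes w v := by
  rw [triSlopes, triSlopes, add_comm, Set.insert_comm]

lemma triSlopes_neg (v w : Fin 2 → ℤ) : triSlopes (-v) (-w) = triSlopes v w := by
  rw [triSlopes, triSlopes, ← neg_add, fareySlope_neg, fareySlope_neg, fareySlope_neg]

/-- The triangle of `a`, `b` is also the triangle of `a + b`, `-b`. -/
lemma triSlopes_add_neg (a b : Fin 2 → ℤ) : triSlopes (a + b) (-b) = triSlopes a b := by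
  rw [triSlopes, triSlopes, fareySlope_neg, add_neg_cancel_right]
  ext p
  simp only [Set.mem_insert_iff, Set.mem_singleton_iff]
  tauto

lemma pairSlopes_subset_triSlopes (v w : Fin 2 → ℤ) : pairSlopes v w ⊆ triSlopes v w := by
  simp [pairSlopes, triSlopes, Set.insert_subset_iff]

namespace Unimod

variable {v w x : Fin 2 → ℤ}

lemma fareySlope_add_ne_left (h : Unimod v w) : fareySlope (v + w) ≠ fareySlope v :=
  h.add_right.fareySlope_ne.symm

lemma fareySlope_add_ne_right (h : Unimod v w) : fareySlope (v + w) ≠ fareySlope w := by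
  rw [add_comm]; exact h.symm.fareySlope_add_ne_left

lemma ncard_pairSlopes (h : Unimod v w) : (pairSlopes v w).ncard = 2 :=
  Set.ncard_pair h.fareySlope_ne

lemma ncard_triSlopes (h : Unimod v w) : (triSlopes v w).ncard = 3 :=
  Set.ncard_eq_three.2 ⟨_, _, _, h.fareySlope_ne, h.fareySlope_add_ne_left.symm,
    h.fareySlope_add_ne_right.symm, rfl⟩

/-- The vertices of the Farey graph adjacent to both ends of an edge. -/
lemma eq_add_or_sub (h : Unimod v w) (hv : Unimod v x) (hw : Unimod w x) :
    fareySlope x = fareySlope (v + w) ∨ fareySlope x = fareySlope (v + -w) := by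
  -- Cramer's rule: up to sign, the coordinates of `x` in the basis `v`, `w` are its determinants
  -- with `w` and `v`, here all ±1.
  have h0 : (v 0 * w 1 - v 1 * w 0) * x 0
      = -(w 0 * x 1 - w 1 * x 0) * v 0 + (v 0 * x 1 - v 1 * x 0) * w 0 := by ring
  have h1 : (v 0 * w 1 - v 1 * w 0) * x 1
      = -(w 0 * x 1 - w 1 * x 0) * v 1 + (v 0 * x 1 - v 1 * x 0) * w 1 := by ring
  have key : x = v + w ∨ x = -(v + w) ∨ x = v + -w ∨ x = -(v + -w) := by
    rcases h with h | h <;> rcases hv with hv | hv <;> rcases hw with hw | hw <;>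
      rw [h, hv, hw] at h0 h1 <;>
      first
      | (left; funext i; fin_cases i <;> simp <;> linarith)
      | (right; left; funext i; fin_cases i <;> simp <;> linarith)
      | (right; right; left; funext i; fin_cases i <;> simp <;> linarith)
      | (right; right; right; funext i; fin_cases i <;> simp <;> linarith)
  rcases key with rfl | rfl | rfl | rfl
  · exact Or.inl rfl
  · exact Or.inl (fareySlope_neg _)
  · exact Or.inr rfl
  · exact Or.inr (fareySlope_neg _)

lemma adj_of_mem_triSlopes (h : Unimod v w) {p q : OnePoint ℚ} (hp : p ∈ triSlopes v w)
    (hq : q ∈ triSlopes v w) (hne : p ≠ q) : fareyGraph.Adj p q := by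
  have h1 := h.fareyGraph_adj
  have h2 := h.add_right.fareyGraph_adj
  have h3 : fareyGraph.Adj (fareySlope w) (fareySlope (v + w)) := by
    rw [add_comm]; exact h.symm.add_right.fareyGraph_adj
  rcases hp with rfl | rfl | rfl <;> rcases hq with rfl | rfl | rfl <;>
    first
    | exact absurd rfl hne
    | assumption
    | exact SimpleGraph.Adj.symm (by assumption)

lemma eq_of_adj (h : Unimod v w) {r : OnePoint ℚ} (hv : fareyGraph.Adj (fareySlope v) r)
    (hw : fareyGraph.Adj (fareySlope w) r) :
    r = fareySlope (v + w) ∨ r = fareySlope (v + -w) := by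
  obtain ⟨x, hx, rfl⟩ := exists_isCoprime_fareySlope_eq r
  exact h.eq_add_or_sub ((fareyGraph_adj_iff h.isCoprime hx).1 hv)
    ((fareyGraph_adj_iff h.symm.isCoprime hx).1 hw)

lemma fareySlope_add_ne_sub (h : Unimod v w) : fareySlope (v + w) ≠ fareySlope (v + -w) := by
  have h1 := h.add_right.symm.isCoprime
  have h2 := h.neg_right.add_right.symm.isCoprime
  rw [Ne, fareySlope_eq_iff h1 h2]
  intro h3
  have h4 : (w 0 = 0 ∧ w 1 = 0) ∨ (v 0 = 0 ∧ v 1 = 0) := by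
    rcases h3 with h3 | h3
    · have a := congrFun h3 0
      have b := congrFun h3 1
      simp only [Pi.add_apply, Pi.neg_apply] at a b
      omega
    · have a := congrFun h3 0
      have b := congrFun h3 1
      simp only [Pi.add_apply, Pi.neg_apply] at a b
      omega
  rcases h4 with ⟨a, b⟩ | ⟨a, b⟩ <;> rcases h with h | h <;> simp [a, b] at h

/-- An edge of the Farey graph lies in two triangles. -/
lemma triSlopes_ne (h : Unimod v w) : triSlopes v w ≠ triSlopes v (-w) := by
  intro h'
  have hm : fareySlope (v + w) ∈ triSlopes v (-w) := h' ▸ by simp [triSlopes]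
  rcases hm with hm | hm | hm
  · exact h.fareySlope_add_ne_left hm
  · rw [fareySlope_neg] at hm
    exact h.fareySlope_add_ne_right hm
  · exact h.fareySlope_add_ne_sub hm

/-- The third vertex of the triangle is adjacent to both ends of the edge, so `eq_of_adj` leaves two
choices. -/
lemma triSlopes_eq_of_subset {a b : Fin 2 → ℤ} (h : Unimod v w) (hab : Unimod a b)
    (hsub : pairSlopes v w ⊆ triSlopes a b) :
    triSlopes a b = triSlopes v w ∨ triSlopes a b = triSlopes v (-w) := by
  have hcard := hab.ncard_triSlopes
  have hfin : (triSlopes a b).Finite := Set.finite_of_ncard_ne_zero (by omega)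
  obtain ⟨r, hr, hrn⟩ := Set.exists_mem_notMem_of_ncard_lt_ncard
    (s := pairSlopes v w) (t := triSlopes a b) (by rw [h.ncard_pairSlopes]; omega)
    (Set.toFinite {fareySlope v, fareySlope w})
  have hins : insert r (pairSlopes v w) = triSlopes a b :=
    Set.eq_of_subset_of_ncard_le (Set.insert_subset hr hsub) (by
      rw [Set.ncard_insert_of_notMem hrn (Set.toFinite {fareySlope v, fareySlope w}),
        h.ncard_pairSlopes, hcard]) hfin
  have hv : fareySlope v ∈ pairSlopes v w := Or.inl rfl
  have hw : fareySlope w ∈ pairSlopes v w := Or.inr rfl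
  rcases h.eq_of_adj
      (hab.adj_of_mem_triSlopes (hsub hv) hr fun h => hrn (h ▸ hv))
      (hab.adj_of_mem_triSlopes (hsub hw) hr fun h => hrn (h ▸ hw)) with rfl | rfl
  · left
    rw [← hins, pairSlopes, triSlopes, Set.insert_comm, Set.pair_comm (fareySlope (v + w))]
  · right
    rw [← hins, pairSlopes, triSlopes, Set.insert_comm, Set.pair_comm (fareySlope (v + -w)),
      fareySlope_neg]

/-- A triangle has three edges. -/
lemma pairSlopes_eq_of_subset {a b : Fin 2 → ℤ} (h : Unimod v w)
    (hsub : pairSlopes v w ⊆ triSlopes a b) :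
    pairSlopes v w = pairSlopes a b ∨ pairSlopes v w = pairSlopes a (a + b) ∨
      pairSlopes v w = pairSlopes b (a + b) := by
  have hne := h.fareySlope_ne
  have hv : fareySlope v ∈ triSlopes a b := hsub (Or.inl rfl)
  have hw : fareySlope w ∈ triSlopes a b := hsub (Or.inr rfl)
  unfold pairSlopes
  rcases hv with e | e | e <;> rcases hw with e' | e' | e' <;> rw [e, e'] at hne ⊢
  · exact absurd rfl hne
  · exact Or.inl rfl
  · exact Or.inr (Or.inl rfl)
  · exact Or.inl (Set.pair_comm _ _)
  · exact absurd rfl hne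
  · exact Or.inr (Or.inr rfl)
  · exact Or.inr (Or.inl (Set.pair_comm _ _))
  · exact Or.inr (Or.inr (Set.pair_comm _ _))
  · exact absurd rfl hne

end Unimod

/-! ### Norms of unimodular pairs -/

lemma toLex_fin_two_lt_iff {α : Type*} [LT α] {f g : Fin 2 → α} :
    toLex f < toLex g ↔ f 0 < g 0 ∨ (f 0 = g 0 ∧ f 1 < g 1) := by
  change (∃ i, (∀ j, j < i → f j = g j) ∧ f i < g i) ↔ _
  simp [Fin.exists_fin_two, Fin.forall_fin_two]

lemma vecNorm_neg {n : ℕ} (v : Fin n → ℤ) : vecNorm (-v) = vecNorm v := by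
  simp [vecNorm]

/-- If the entries agree up to sign, the determinant is 0 or ±2 v₀v₁, hence even. Thus the rows of a
marking matrix can always be ordered strictly. -/
lemma Unimod.vecNorm_ne {v w : Fin 2 → ℤ} (h : Unimod v w) : vecNorm v ≠ vecNorm w := by
  intro h'
  have h0 : (v 0).natAbs = (w 0).natAbs := congrFun (toLex.injective h') 0
  have h1 : (v 1).natAbs = (w 1).natAbs := congrFun (toLex.injective h') 1
  rw [Int.natAbs_eq_natAbs_iff] at h0 h1
  unfold Unimod at h
  rcases h0 with h0 | h0 <;> rcases h1 with h1 | h1 <;> rw [h0, h1] at h <;>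
    ring_nf at h <;> omega

/-- The norm of a rose with labels `v`, `w`. -/
noncomputable def pairNorm (v w : Fin 2 → ℤ) : Lex (Fin 2 → Lex (Fin 2 → ℕ)) :=
  toLex ![min (vecNorm v) (vecNorm w), max (vecNorm v) (vecNorm w)]

lemma pairNorm_comm (v w : Fin 2 → ℤ) : pairNorm v w = pairNorm w v := by
  rw [pairNorm, min_comm, max_comm, pairNorm]

lemma pairNorm_eq_of_pairSlopes_eq {v w v' w' : Fin 2 → ℤ} (h : Unimod v w) (h' : Unimod v' w')
    (hs : pairSlopes v w = pairSlopes v' w') : pairNorm v w = pairNorm v' w' := by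
  have key : ∀ {x y : Fin 2 → ℤ}, IsCoprime (x 0) (x 1) → IsCoprime (y 0) (y 1) →
      fareySlope x = fareySlope y → vecNorm x = vecNorm y := fun hx hy hxy => by
    rcases (fareySlope_eq_iff hx hy).1 hxy with rfl | rfl
    · rfl
    · rw [vecNorm_neg]
  rcases Set.pair_eq_pair_iff.1 hs with ⟨h1, h2⟩ | ⟨h1, h2⟩
  · rw [pairNorm, key h.isCoprime h'.isCoprime h1, key h.symm.isCoprime h'.symm.isCoprime h2,
      pairNorm]
  · rw [pairNorm, key h.isCoprime h'.symm.isCoprime h1, key h.symm.isCoprime h'.isCoprime h2,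
      pairNorm_comm, pairNorm]

lemma matNorm_eq_pairNorm {M : Matrix (Fin 2) (Fin 2) ℤ} (h : IsStandard M) :
    matNorm M = pairNorm (M 0) (M 1) := by
  have hlt : vecNorm (M 1) < vecNorm (M 0) := h (show (0 : Fin 2) < 1 by decide)
  rw [pairNorm, min_eq_right hlt.le, max_eq_left hlt.le, matNorm]
  congr 1
  funext i
  fin_cases i <;> rfl

/-- The vectors `v`, `w` lie in a common closed quadrant. -/
def SameQuadrant (v w : Fin 2 → ℤ) : Prop := 0 ≤ v 0 * w 0 ∧ 0 ≤ v 1 * w 1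

lemma SameQuadrant.symm {v w : Fin 2 → ℤ} (h : SameQuadrant v w) : SameQuadrant w v :=
  ⟨mul_comm (v 0) (w 0) ▸ h.1, mul_comm (v 1) (w 1) ▸ h.2⟩

/-- In a common quadrant absolute values add entrywise, and some entry of `w` is nonzero. -/
lemma SameQuadrant.vecNorm_lt_add {v w : Fin 2 → ℤ} (h : SameQuadrant v w) (hw : w ≠ 0) :
    vecNorm v < vecNorm (v + w) := by
  have key : ∀ i, 0 ≤ v i * w i → (v i + w i).natAbs = (v i).natAbs + (w i).natAbs := by
    intro i hi
    rcases mul_nonneg_iff.1 hi with ⟨a, b⟩ | ⟨a, b⟩ <;> omega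
  have hw' : w 0 ≠ 0 ∨ w 1 ≠ 0 := by
    by_contra! hc
    exact hw (by funext i; fin_cases i; exacts [hc.1, hc.2])
  have h0 := key 0 h.1
  have h1 := key 1 h.2
  rw [vecNorm, vecNorm, toLex_fin_two_lt_iff]
  simp only [Pi.add_apply]
  omega

namespace Unimod

variable {v w : Fin 2 → ℤ}

lemma ne_zero (h : Unimod v w) : v ≠ 0 := by
  rintro rfl
  rcases h with h | h <;> simp at h

/-- The integers v₀w₁ and v₁w₀ are consecutive, so their product is not negative. It equals
(v₀w₀)(v₁w₁), so these two factors never have strictly opposite signs. -/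
lemma sameQuadrant_or (h : Unimod v w) : SameQuadrant v w ∨ SameQuadrant v (-w) := by
  have key : ¬ (v 0 * w 1) * (v 1 * w 0) < 0 := by
    intro hlt
    rcases h with h | h
    · have e : v 0 * w 1 = v 1 * w 0 + 1 := by linarith
      rw [e] at hlt
      rcases le_or_gt 0 (v 1 * w 0) with h' | h'
      · nlinarith
      · nlinarith
    · have e : v 0 * w 1 = v 1 * w 0 - 1 := by linarith
      rw [e] at hlt
      rcases le_or_gt (v 1 * w 0) 0 with h' | h'
      · nlinarith
      · nlinarith
  have key' : ¬ (v 0 * w 0) * (v 1 * w 1) < 0 := by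
    convert key using 2; ring
  rw [mul_neg_iff] at key'
  unfold SameQuadrant
  simp only [Pi.neg_apply, mul_neg]
  omega

/-- A unimodular pair in a common quadrant is the standard basis, or it arises from a smaller one by
adding one vector to the other. -/
lemma sameQuadrant_sub (h : Unimod v w) (hq : SameQuadrant v w) :
    (v 0 * w 0 = 0 ∧ v 1 * w 1 = 0) ∨ SameQuadrant (v - w) w ∨ SameQuadrant (w - v) v := by
  have key : ∀ a b : ℤ, 0 ≤ a * b → |b| ≤ |a| → 0 ≤ (a - b) * b := by
    intro a b h1 h2
    have h3 : |b| * |b| ≤ |a| * |b| := mul_le_mul_of_nonneg_right h2 (abs_nonneg b)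
    rw [← abs_mul, ← abs_mul, abs_of_nonneg h1, abs_mul_self] at h3
    linarith
  have habs : |v 0| * |w 1| ≤ |v 1| * |w 0| + 1 ∧ |v 1| * |w 0| ≤ |v 0| * |w 1| + 1 := by
    rw [← abs_mul, ← abs_mul]
    have h1 := abs_sub_abs_le_abs_sub (v 0 * w 1) (v 1 * w 0)
    have h2 := abs_sub_abs_le_abs_sub (v 1 * w 0) (v 0 * w 1)
    have h3 : |v 0 * w 1 - v 1 * w 0| = 1 := by rcases h with h | h <;> simp [h]
    rw [abs_sub_comm, h3] at h2
    rw [h3] at h1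
    constructor <;> linarith
  rcases le_or_gt |w 0| |v 0| with h0 | h0 <;> rcases le_or_gt |w 1| |v 1| with h1 | h1
  · exact Or.inr (Or.inl ⟨key _ _ hq.1 h0, key _ _ hq.2 h1⟩)
  · rcases h0.eq_or_lt with h0 | h0
    · exact Or.inr (Or.inr ⟨key _ _ hq.symm.1 h0.ge, key _ _ hq.symm.2 h1.le⟩)
    · left
      have a := abs_nonneg (w 0)
      have b := abs_nonneg (v 1)
      -- Here |v₀||w₁| ≥ (|w₀| + 1)(|v₁| + 1), while it exceeds |w₀||v₁| by at most 1, so both extra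
      -- terms vanish.
      have hz : |w 0| = 0 ∧ |v 1| = 0 := by constructor <;> nlinarith
      rw [abs_eq_zero, abs_eq_zero] at hz
      simp [hz.1, hz.2]
  · rcases h1.eq_or_lt with h1 | h1
    · exact Or.inr (Or.inr ⟨key _ _ hq.symm.1 h0.le, key _ _ hq.symm.2 h1.ge⟩)
    · left
      have a := abs_nonneg (v 0)
      have b := abs_nonneg (w 1)
      have hz : |v 0| = 0 ∧ |w 1| = 0 := by constructor <;> nlinarith
      rw [abs_eq_zero, abs_eq_zero] at hz
      simp [hz.1, hz.2]
  · exact Or.inr (Or.inr ⟨key _ _ hq.symm.1 h0.le, key _ _ hq.symm.2 h1.le⟩)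

lemma add_left (h : Unimod v w) : Unimod (v + w) w := by
  rw [add_comm]; exact h.symm.add_right.symm

/-- Every triangle is spanned by a pair in a common quadrant. -/
lemma exists_sameQuadrant (h : Unimod v w) :
    ∃ a b, Unimod a b ∧ SameQuadrant a b ∧ triSlopes a b = triSlopes v w := by
  rcases h.sameQuadrant_or with hq | hq
  · exact ⟨v, w, h, hq, rfl⟩
  -- One Euclidean step on the pair v, -w, whose difference is v + w: it either shows that v, w
  -- already share a quadrant, or produces another edge of the same triangle that does.
  · rcases h.neg_right.sameQuadrant_sub hq with ⟨h0, h1⟩ | hq' | hq'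
    · refine ⟨v, w, h, ⟨?_, ?_⟩, rfl⟩
      · simp only [Pi.neg_apply, mul_neg] at h0; omega
      · simp only [Pi.neg_apply, mul_neg] at h1; omega
    · rw [sub_neg_eq_add] at hq'
      exact ⟨v + w, -w, h.add_left.neg_right, hq', triSlopes_add_neg v w⟩
    · refine ⟨-w - v, v, ?_, hq', ?_⟩
      · rw [← neg_add', add_comm]
        exact h.add_right.symm.neg_left
      · rw [← triSlopes_neg, ← neg_add', neg_neg, triSlopes_add_neg, triSlopes_comm]

/-- The norm of `v + w` exceeds both others. Replacing `w` by it raises the minimum if |w| < |v|;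
otherwise it keeps the minimum and raises the maximum. -/
lemma pairNorm_lt_add (h : Unimod v w) (hq : SameQuadrant v w) :
    pairNorm v w < pairNorm v (v + w) := by
  have h1 := hq.vecNorm_lt_add h.symm.ne_zero
  have h2 := hq.symm.vecNorm_lt_add h.ne_zero
  rw [add_comm] at h2
  rw [pairNorm, pairNorm, toLex_fin_two_lt_iff]
  simp only [Matrix.cons_val_zero, Matrix.cons_val_one]
  rw [min_eq_left h1.le, max_eq_right h1.le]
  rcases lt_or_ge (vecNorm w) (vecNorm v) with h3 | h3
  · exact Or.inl (min_lt_of_right_lt h3)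
  · exact Or.inr ⟨min_eq_left h3, max_lt h1 h2⟩

/-- Among the edges of a triangle, the one spanned by a pair in a common quadrant has the smallest
norm. -/
lemma pairNorm_lt {a b : Fin 2 → ℤ} (h : Unimod v w) (hq : SameQuadrant v w) (hab : Unimod a b)
    (hsub : pairSlopes a b ⊆ triSlopes v w) (hne : pairSlopes a b ≠ pairSlopes v w) :
    pairNorm v w < pairNorm a b := by
  rcases hab.pairSlopes_eq_of_subset hsub with h1 | h1 | h1
  · exact absurd h1 hne
  · rw [pairNorm_eq_of_pairSlopes_eq hab h.add_right h1]
    exact h.pairNorm_lt_add hq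
  · rw [pairNorm_eq_of_pairSlopes_eq hab h.add_left.symm h1, pairNorm_comm v, add_comm]
    exact h.symm.pairNorm_lt_add hq.symm

/-- A pair different from the standard basis has a neighbour of smaller norm across exactly one of
the two adjacent triangles. -/
lemma exists_descent {a b : Fin 2 → ℤ} (h : Unimod a b)
    (hne : pairSlopes a b ≠ pairSlopes ![1, 0] ![0, 1]) :
    ∃ v w, Unimod v w ∧ SameQuadrant v w ∧ pairSlopes a b = pairSlopes v w ∧
      SameQuadrant (v - w) w := by
  obtain ⟨v, w, hvw, hq, hs⟩ : ∃ v w, Unimod v w ∧ SameQuadrant v w ∧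
      pairSlopes a b = pairSlopes v w := by
    rcases h.sameQuadrant_or with hq | hq
    · exact ⟨a, b, h, hq, rfl⟩
    · exact ⟨a, -b, h.neg_right, hq, (pairSlopes_neg_right a b).symm⟩
  rcases hvw.sameQuadrant_sub hq with ⟨h0, h1⟩ | hq' | hq'
  -- Vanishing coordinatewise products place the vectors on the two axes, which gives the excluded
  -- standard edge.
  · exfalso
    apply hne
    rw [hs, pairSlopes, pairSlopes]
    rcases mul_eq_zero.1 h0 with e | e <;> rcases mul_eq_zero.1 h1 with e' | e' <;>
      unfold Unimod at hvw <;> rw [e, e'] at hvw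
    · simp at hvw
    · have hw0 : w 0 ≠ 0 := by rintro h; simp [h] at hvw
      simp [fareySlope, e, e', hw0, Set.pair_comm]
    · have hv0 : v 0 ≠ 0 := by rintro h; simp [h] at hvw
      simp [fareySlope, e, e', hv0]
    · simp at hvw
  · exact ⟨v, w, hvw, hq, hs, hq'⟩
  · exact ⟨w, v, hvw.symm, hq.symm, hs.trans (pairSlopes_comm v w), hq'⟩

end Unimod

end OutFn

namespace OutFn

/-! ### The vertices of the spine of rank two -/

lemma quotProj_injective : Function.Injective (quotProj : SpineVertex 2 → QuotVertex 2) := by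
  intro x y h
  obtain ⟨⟨φ, hφ⟩, rfl⟩ := (MulAction.orbitRel_apply (G := (Torelli 2).op)).1 (Quotient.exact h)
  have h1 : φ = 1 := by
    rw [Subgroup.mem_op, torelli_two_eq_bot, Subgroup.mem_bot] at hφ
    exact MulOpposite.unop_injective hφ
  subst h1
  exact one_smul (Out 2)ᵐᵒᵖ y

lemma quotProj_bijective : Function.Bijective (quotProj : SpineVertex 2 → QuotVertex 2) :=
  ⟨quotProj_injective, Quotient.mk_surjective⟩

lemma MarkedGraph.toQuot_eq_iff {X X' : MarkedGraph 2} :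
    X.toQuot = X'.toQuot ↔ X.slopes = X'.slopes := by
  refine ⟨fun h => ?_, fun h => ?_⟩
  · exact (Quotient.exact (quotProj_injective h) : X.Equiv X').slopes_eq
  · exact congrArg quotProj (Quotient.sound (equiv_of_slopes_eq h))

lemma MarkedGraph.toQuot_surjective (y : QuotVertex 2) : ∃ X : MarkedGraph 2, X.toQuot = y := by
  obtain ⟨x, rfl⟩ := quotProj_bijective.2 y
  obtain ⟨X, rfl⟩ := Quotient.mk_surjective x
  exact ⟨X, rfl⟩

/-- The set of slopes of the labels of a vertex. -/
noncomputable def slopesOf (y : QuotVertex 2) : Set (OnePoint ℚ) :=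
  (MarkedGraph.toQuot_surjective y).choose.slopes

lemma slopesOf_toQuot (X : MarkedGraph 2) : slopesOf X.toQuot = X.slopes :=
  MarkedGraph.toQuot_eq_iff.1 (MarkedGraph.toQuot_surjective X.toQuot).choose_spec

lemma slopesOf_injective : Function.Injective slopesOf := by
  intro y z h
  obtain ⟨X, rfl⟩ := MarkedGraph.toQuot_surjective y
  obtain ⟨X', rfl⟩ := MarkedGraph.toQuot_surjective z
  rw [slopesOf_toQuot, slopesOf_toQuot] at h
  exact MarkedGraph.toQuot_eq_iff.2 h

lemma exists_unimod_of_rose {X : MarkedGraph 2} (h : X.IsRose) :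
    ∃ v w, Unimod v w ∧ X.slopes = pairSlopes v w := by
  rcases X.rose_or_theta with ⟨-, e, he⟩ | ⟨h', -⟩
  · exact ⟨_, _, MarkedGraph.unimod_of_rose he, MarkedGraph.rose_slopes he⟩
  · exact absurd h h'

lemma exists_unimod_of_not_rose {X : MarkedGraph 2} (h : ¬ X.IsRose) :
    ∃ v w, Unimod v w ∧ X.slopes = triSlopes v w := by
  rcases X.rose_or_theta with ⟨h', -⟩ | ⟨-, u, w, e, he⟩
  · exact absurd h' h
  · refine ⟨_, _, he.unimod (i := 0) (j := 1) (by decide), ?_⟩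
    have hs := he.sum_label
    rw [Fin.sum_univ_three] at hs
    rw [MarkedGraph.slopes_eq he.orient, range_fin_three, triSlopes,
      ← fareySlope_neg (X.label (e 0) + X.label (e 1)), ← eq_neg_of_add_eq_zero_right hs]

/-- The number of slopes, 2 or 3, detects the shape, so it does not depend on the representative. -/
lemma isRose_toQuot {X : MarkedGraph 2} : IsRose X.toQuot ↔ X.IsRose := by
  refine ⟨?_, fun h => ⟨X, rfl, h⟩⟩
  rintro ⟨X', h, h'⟩
  by_contra hX
  obtain ⟨v, w, hvw, h1⟩ := exists_unimod_of_rose h'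
  obtain ⟨a, b, hab, h2⟩ := exists_unimod_of_not_rose hX
  have h3 := congrArg Set.ncard (MarkedGraph.toQuot_eq_iff.1 h)
  rw [h1, h2, hvw.ncard_pairSlopes, hab.ncard_triSlopes] at h3
  omega

lemma IsRose.exists_unimod {y : QuotVertex 2} (h : IsRose y) :
    ∃ v w, Unimod v w ∧ slopesOf y = pairSlopes v w := by
  obtain ⟨X, rfl, hX⟩ := h
  rw [slopesOf_toQuot]
  exact exists_unimod_of_rose hX

lemma exists_unimod_of_not_isRose {y : QuotVertex 2} (h : ¬ IsRose y) :
    ∃ v w, Unimod v w ∧ slopesOf y = triSlopes v w := by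
  obtain ⟨X, rfl⟩ := MarkedGraph.toQuot_surjective y
  rw [slopesOf_toQuot]
  exact exists_unimod_of_not_rose fun hX => h (isRose_toQuot.2 hX)

lemma exists_rose {v w : Fin 2 → ℤ} (h : Unimod v w) :
    ∃ y, IsRose y ∧ slopesOf y = pairSlopes v w := by
  obtain ⟨X, Y, hX, -, -, ⟨e, he, hl⟩, -⟩ := exists_rose_theta (m := ![v, w]) h
  refine ⟨X.toQuot, isRose_toQuot.2 hX, ?_⟩
  rw [slopesOf_toQuot, MarkedGraph.rose_slopes he, hl, hl]
  rfl

lemma exists_theta {v w : Fin 2 → ℤ} (h : Unimod v w) :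
    ∃ y, ¬ IsRose y ∧ slopesOf y = triSlopes v w := by
  obtain ⟨X, Y, -, hY, -, -, hs⟩ := exists_rose_theta (m := ![v, w]) h
  exact ⟨Y.toQuot, fun h => hY (isRose_toQuot.1 h), (slopesOf_toQuot Y).trans hs⟩

lemma IsRose.of_slopesOf_eq {y : QuotVertex 2} {v w : Fin 2 → ℤ} (h : Unimod v w)
    (hy : slopesOf y = pairSlopes v w) : IsRose y := by
  obtain ⟨z, hz, hs⟩ := exists_rose h
  rwa [slopesOf_injective (hy.trans hs.symm)]

lemma not_isRose_of_slopesOf_eq {y : QuotVertex 2} {v w : Fin 2 → ℤ} (h : Unimod v w)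
    (hy : slopesOf y = triSlopes v w) : ¬ IsRose y := by
  obtain ⟨z, hz, hs⟩ := exists_theta h
  rwa [slopesOf_injective (hy.trans hs.symm)]

/-- The converse uses realization of every basis by a rose and uniqueness of the rose with given
slopes. -/
lemma hasMarkingMatrix_iff {y : QuotVertex 2} {M : Matrix (Fin 2) (Fin 2) ℤ} :
    HasMarkingMatrix y M ↔ Unimod (M 0) (M 1) ∧ slopesOf y = pairSlopes (M 0) (M 1) := by
  constructor
  · rintro ⟨X, rfl, hX, e, he, hl⟩
    have he' : X.toFinGraph.IsOrientation e := he
    rw [hl, hl, slopesOf_toQuot]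
    exact ⟨MarkedGraph.unimod_of_rose he', MarkedGraph.rose_slopes he'⟩
  · rintro ⟨h, hs⟩
    obtain ⟨X, Y, hX, -, -, ⟨e, he, hl⟩, -⟩ := exists_rose_theta (m := M) h
    refine ⟨X, slopesOf_injective ?_, hX, e, he, fun i => (hl i).symm⟩
    rw [slopesOf_toQuot, hs, MarkedGraph.rose_slopes he, hl, hl]
    rfl

/-- The theta graph `θ` collapses to the rose `ρ`. -/
def Incident (ρ θ : QuotVertex 2) : Prop :=
  IsRose ρ ∧ ¬ IsRose θ ∧ slopesOf ρ ⊆ slopesOf θ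

lemma slopesOf_finite (y : QuotVertex 2) : (slopesOf y).Finite := by
  by_cases h : IsRose y
  · obtain ⟨v, w, -, h⟩ := h.exists_unimod
    exact h ▸ Set.toFinite {fareySlope v, fareySlope w}
  · obtain ⟨v, w, -, h⟩ := exists_unimod_of_not_isRose h
    exact h ▸ Set.toFinite {fareySlope v, fareySlope w, fareySlope (v + w)}

lemma IsRose.ncard_slopesOf {y : QuotVertex 2} (h : IsRose y) : (slopesOf y).ncard = 2 := by
  obtain ⟨v, w, h, hs⟩ := h.exists_unimod
  rw [hs, h.ncard_pairSlopes]

lemma ncard_slopesOf_of_not_isRose {y : QuotVertex 2} (h : ¬ IsRose y) :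
    (slopesOf y).ncard = 3 := by
  obtain ⟨v, w, h, hs⟩ := exists_unimod_of_not_isRose h
  rw [hs, h.ncard_triSlopes]

/-- Slope sets have two or three elements, so a proper inclusion is that of an edge in a triangle.
-/
lemma eq_or_incident_of_subset {y z : QuotVertex 2} (h : slopesOf y ⊆ slopesOf z) :
    y = z ∨ Incident y z := by
  have hle := Set.ncard_le_ncard h (slopesOf_finite z)
  have hcard : (slopesOf y).ncard = (slopesOf z).ncard → y = z := fun h' =>
    slopesOf_injective (Set.eq_of_subset_of_ncard_le h h'.ge (slopesOf_finite z))
  by_cases hy : IsRose y <;> by_cases hz : IsRose z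
  · exact Or.inl (hcard (by rw [hy.ncard_slopesOf, hz.ncard_slopesOf]))
  · exact Or.inr ⟨hy, hz, h⟩
  · rw [ncard_slopesOf_of_not_isRose hy, hz.ncard_slopesOf] at hle
    omega
  · exact Or.inl (hcard (by rw [ncard_slopesOf_of_not_isRose hy, ncard_slopesOf_of_not_isRose hz]))

lemma incident_iff {ρ θ θ₁ θ₂ : QuotVertex 2} {v w : Fin 2 → ℤ} (h : Unimod v w)
    (hρ : slopesOf ρ = pairSlopes v w) (h₁ : slopesOf θ₁ = triSlopes v w)
    (h₂ : slopesOf θ₂ = triSlopes v (-w)) : Incident ρ θ ↔ θ = θ₁ ∨ θ = θ₂ := by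
  have hr := IsRose.of_slopesOf_eq h hρ
  constructor
  · rintro ⟨-, hθ, hsub⟩
    obtain ⟨a, b, hab, hs⟩ := exists_unimod_of_not_isRose hθ
    rw [hρ, hs] at hsub
    rcases h.triSlopes_eq_of_subset hab hsub with h' | h'
    · exact Or.inl (slopesOf_injective (by rw [hs, h', h₁]))
    · exact Or.inr (slopesOf_injective (by rw [hs, h', h₂]))
  · rintro (rfl | rfl)
    · refine ⟨hr, not_isRose_of_slopesOf_eq h h₁, ?_⟩
      rw [hρ, h₁]
      exact pairSlopes_subset_triSlopes v w
    · refine ⟨hr, not_isRose_of_slopesOf_eq h.neg_right h₂, ?_⟩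
      rw [hρ, h₂, ← pairSlopes_neg_right]
      exact pairSlopes_subset_triSlopes v (-w)

lemma exists_arms {ρ : QuotVertex 2} {v w : Fin 2 → ℤ} (h : Unimod v w)
    (hρ : slopesOf ρ = pairSlopes v w) : ∃ θ₁ θ₂, slopesOf θ₁ = triSlopes v w ∧
      slopesOf θ₂ = triSlopes v (-w) ∧ θ₁ ≠ θ₂ ∧ ∀ θ, Incident ρ θ ↔ θ = θ₁ ∨ θ = θ₂ := by
  obtain ⟨θ₁, -, h₁⟩ := exists_theta h
  obtain ⟨θ₂, -, h₂⟩ := exists_theta h.neg_right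
  refine ⟨θ₁, θ₂, h₁, h₂, ?_, fun θ => incident_iff h hρ h₁ h₂⟩
  rintro rfl
  exact h.triSlopes_ne (h₁.symm.trans h₂)

/-! ### The norm of a rose -/

open Classical in
/-- The norm of a rose, with a junk value for theta graphs. -/
noncomputable def roseNorm (y : QuotVertex 2) : Lex (Fin 2 → Lex (Fin 2 → ℕ)) :=
  if h : IsRose y then
    pairNorm h.exists_unimod.choose h.exists_unimod.choose_spec.choose
  else pairNorm 0 0

lemma roseNorm_eq {y : QuotVertex 2} {v w : Fin 2 → ℤ} (h : Unimod v w)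
    (hy : slopesOf y = pairSlopes v w) : roseNorm y = pairNorm v w := by
  have hr := IsRose.of_slopesOf_eq h hy
  rw [roseNorm, dif_pos hr]
  obtain ⟨h1, h2⟩ := hr.exists_unimod.choose_spec.choose_spec
  exact pairNorm_eq_of_pairSlopes_eq h1 h (h2.symm.trans hy)

lemma IsRose.exists_standard {y : QuotVertex 2} (h : IsRose y) :
    ∃ M, HasMarkingMatrix y M ∧ IsStandard M := by
  have hstd : ∀ M : Matrix (Fin 2) (Fin 2) ℤ, vecNorm (M 1) < vecNorm (M 0) → IsStandard M := by
    intro M hlt i j hij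
    fin_cases i <;> fin_cases j <;> first | exact hlt | exact absurd hij (by decide)
  obtain ⟨v, w, h, hs⟩ := h.exists_unimod
  rcases lt_or_gt_of_ne h.vecNorm_ne with hlt | hlt
  · exact ⟨![w, v], hasMarkingMatrix_iff.2 ⟨h.symm, hs.trans (pairSlopes_comm v w)⟩,
      hstd _ hlt⟩
  · exact ⟨![v, w], hasMarkingMatrix_iff.2 ⟨h, hs⟩, hstd _ hlt⟩

lemma roseLT_iff {y z : QuotVertex 2} :
    RoseLT y z ↔ IsRose y ∧ IsRose z ∧ roseNorm y < roseNorm z := by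
  have key : ∀ {y : QuotVertex 2} {M}, HasMarkingMatrix y M → IsStandard M →
      roseNorm y = matNorm M := fun hM hs => by
    rw [matNorm_eq_pairNorm hs]
    obtain ⟨h1, h2⟩ := hasMarkingMatrix_iff.1 hM
    exact roseNorm_eq h1 h2
  constructor
  · rintro ⟨M, M', hM, hs, hM', hs', hlt⟩
    refine ⟨?_, ?_, ?_⟩
    · obtain ⟨h1, h2⟩ := hasMarkingMatrix_iff.1 hM
      exact IsRose.of_slopesOf_eq h1 h2
    · obtain ⟨h1, h2⟩ := hasMarkingMatrix_iff.1 hM'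
      exact IsRose.of_slopesOf_eq h1 h2
    · rwa [key hM hs, key hM' hs']
  · rintro ⟨hy, hz, hlt⟩
    obtain ⟨M, hM, hs⟩ := hy.exists_standard
    obtain ⟨M', hM', hs'⟩ := hz.exists_standard
    exact ⟨M, M', hM, hs, hM', hs', by rwa [← key hM hs, ← key hM' hs']⟩

lemma roseNorm_lt {v w : Fin 2 → ℤ} (h : Unimod v w) (hq : SameQuadrant v w) {ρ σ θ : QuotVertex 2}
    (hρ : slopesOf ρ = pairSlopes v w) (hθ : slopesOf θ = triSlopes v w) (hσ : Incident σ θ)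
    (hne : σ ≠ ρ) : roseNorm ρ < roseNorm σ := by
  obtain ⟨a, b, hab, hs⟩ := hσ.1.exists_unimod
  rw [roseNorm_eq h hρ, roseNorm_eq hab hs]
  refine h.pairNorm_lt hq hab ?_ fun h' => hne (slopesOf_injective (by rw [hs, hρ, h']))
  rw [← hs, ← hθ]
  exact hσ.2.2

/-- The roses and theta graphs of rank two. -/
noncomputable def roseOrder : RoseOrder (QuotVertex 2) (Lex (Fin 2 → Lex (Fin 2 → ℕ))) where
  Rose := IsRose
  Inc := Incident
  norm := roseNorm
  root := (exists_rose (v := ![1, 0]) (w := ![0, 1]) (Or.inl rfl)).choose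
  rose_root := (exists_rose (v := ![1, 0]) (w := ![0, 1]) (Or.inl rfl)).choose_spec.1
  rose_of_inc h := h.1
  not_rose_of_inc h := h.2.1
  arms ρ hρ := by
    obtain ⟨v, w, h, hs⟩ := hρ.exists_unimod
    obtain ⟨θ₁, θ₂, -, -, hne, hiff⟩ := exists_arms h hs
    exact ⟨θ₁, θ₂, hne, hiff⟩
  exists_other {ρ θ} hρ := by
    obtain ⟨v, w, h, hs⟩ := exists_unimod_of_not_isRose hρ.2.1
    obtain ⟨σ, hσ, hσs⟩ := exists_rose h
    obtain ⟨τ, hτ, hτs⟩ := exists_rose h.add_right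
    have hστ : σ ≠ τ := by
      rintro rfl
      have : fareySlope w ∈ pairSlopes v (v + w) := by
        rw [← hτs, hσs]; exact Or.inr rfl
      rcases this with h' | h'
      · exact h.fareySlope_ne h'.symm
      · exact h.fareySlope_add_ne_right h'.symm
    have h1 : Incident σ θ := ⟨hσ, hρ.2.1, by rw [hσs, hs]; exact pairSlopes_subset_triSlopes v w⟩
    have h2 : Incident τ θ := ⟨hτ, hρ.2.1, by
      rw [hτs, hs]; simp [pairSlopes, triSlopes, Set.insert_subset_iff]⟩
    -- Two different edges of the triangle are at hand, so at least one is not `ρ`.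
    by_cases h3 : σ = ρ
    · exact ⟨τ, h3 ▸ hστ.symm, h2⟩
    · exact ⟨σ, h3, h1⟩
  bottom θ hθ := by
    obtain ⟨a, b, hab, hs⟩ := exists_unimod_of_not_isRose hθ
    obtain ⟨v, w, h, hq, hvw⟩ := hab.exists_sameQuadrant
    rw [← hvw] at hs
    obtain ⟨ρ, hρ, hρs⟩ := exists_rose h
    exact ⟨ρ, ⟨hρ, hθ, by rw [hρs, hs]; exact pairSlopes_subset_triSlopes v w⟩,
      fun σ hσ hne => roseNorm_lt h hq hρs hs hσ hne⟩
  down ρ hρ hne := by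
    obtain ⟨a, b, hab, hs⟩ := hρ.exists_unimod
    obtain ⟨v, w, h, hq, hvw, hq'⟩ := hab.exists_descent fun h' =>
      hne (slopesOf_injective ((hs.trans h').trans
        (exists_rose (v := ![1, 0]) (w := ![0, 1]) (Or.inl rfl)).choose_spec.2.symm))
    rw [hvw] at hs
    -- `θ₁` is the triangle of v, w, whose least edge is `ρ`. `θ₂` is that of v, -w, equivalently of
    -- v - w, w; its least edge is spanned by v - w, w, so it is the descending arm.
    obtain ⟨θ₁, θ₂, h₁, h₂, -, hiff⟩ := exists_arms h hs
    have hsub : Unimod (v - w) w := by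
      rw [sub_eq_add_neg]; simpa using h.neg_right.add_left.neg_right
    obtain ⟨σ, hσ, hσs⟩ := exists_rose hsub
    have h₂' : slopesOf θ₂ = triSlopes (v - w) w := by
      rw [h₂, ← triSlopes_add_neg, neg_neg, sub_eq_add_neg]
    have hρθ : Incident ρ θ₂ := (hiff θ₂).2 (Or.inr rfl)
    refine ⟨θ₂, hρθ, ⟨σ, ⟨hσ, hρθ.2.1, ?_⟩, ?_⟩, fun θ' hθ' hne' σ' hσ' => ?_⟩
    · rw [hσs, h₂']
      exact pairSlopes_subset_triSlopes _ _
    · refine roseNorm_lt hsub hq' hσs h₂' hρθ ?_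
      rintro rfl
      have : fareySlope (v - w) ∈ pairSlopes v w := by rw [← hs, hσs]; exact Or.inl rfl
      rw [sub_eq_add_neg] at this
      rcases this with h' | h'
      · exact h.neg_right.fareySlope_add_ne_left h'
      · rw [← fareySlope_neg w] at h'
        exact h.neg_right.fareySlope_add_ne_right h'
    · obtain rfl : θ' = θ₁ := ((hiff θ').1 hθ').resolve_right hne'
      by_cases h' : σ' = ρ
      · rw [h']
      · exact (roseNorm_lt h hq hs h₁ hσ' h').le

lemma hasMarkingMatrix_one_iff {y : QuotVertex 2} : HasMarkingMatrix y 1 ↔ y = roseOrder.root := by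
  have hroot : slopesOf roseOrder.root = pairSlopes ![1, 0] ![0, 1] :=
    (exists_rose (v := ![1, 0]) (w := ![0, 1]) (Or.inl rfl)).choose_spec.2
  have h0 : (1 : Matrix (Fin 2) (Fin 2) ℤ) 0 = ![1, 0] := by
    funext i; fin_cases i <;> rfl
  have h1 : (1 : Matrix (Fin 2) (Fin 2) ℤ) 1 = ![0, 1] := by
    funext i; fin_cases i <;> rfl
  rw [hasMarkingMatrix_iff, h0, h1, ← hroot, slopesOf_injective.eq_iff]
  exact and_iff_right (Or.inl rfl)

end OutFn

namespace OutFn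

/-! ### The simplices of the spine of rank two -/

lemma SpineVertex.CollapsesTo.slopesOf_subset {x y : SpineVertex 2} (h : x.CollapsesTo y) :
    slopesOf (quotProj y) ⊆ slopesOf (quotProj x) := by
  obtain ⟨X, Y, rfl, rfl, h⟩ := h
  change slopesOf Y.toQuot ⊆ slopesOf X.toQuot
  rw [slopesOf_toQuot, slopesOf_toQuot]
  exact h.slopes_subset

/-- The relation on classes allows a choice of representatives: `exists_rose_theta` gives a
collapsing pair with the required slopes, and slopes identify the classes. -/
lemma collapsesTo_of_incident {x y : SpineVertex 2} (h : Incident (quotProj y) (quotProj x)) :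
    x.CollapsesTo y := by
  have key : ∀ {v w : Fin 2 → ℤ}, Unimod v w → slopesOf (quotProj y) = pairSlopes v w →
      slopesOf (quotProj x) = triSlopes v w → x.CollapsesTo y := by
    intro v w hvw hy hx
    obtain ⟨Y, X, hY, hX, hc, ⟨e, he, hl⟩, hs⟩ := exists_rose_theta (m := ![v, w]) hvw
    refine ⟨X, Y, quotProj_injective (slopesOf_injective ?_),
      quotProj_injective (slopesOf_injective ?_), hc⟩
    · exact hx.trans (hs.symm.trans (slopesOf_toQuot X).symm)
    · refine hy.trans (Eq.trans ?_ (slopesOf_toQuot Y).symm)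
      rw [MarkedGraph.rose_slopes he, hl, hl]
      rfl
  obtain ⟨v, w, hvw, hs⟩ := h.1.exists_unimod
  obtain ⟨θ₁, θ₂, h₁, h₂, -, hiff⟩ := exists_arms hvw hs
  rcases (hiff _).1 h with rfl | rfl
  · exact key hvw hs h₁
  · exact key hvw.neg_right (hs.trans (pairSlopes_neg_right v w).symm) h₂

lemma mem_quotSpine_faces {s : Finset (QuotVertex 2)} : s ∈ (QuotSpine 2).faces ↔
    s.Nonempty ∧ ∀ y ∈ s, ∀ z ∈ s, y = z ∨ Incident y z ∨ Incident z y := by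
  classical
  constructor
  · intro hs
    refine ⟨((QuotSpine 2).isRelLowerSet_faces hs).1, ?_⟩
    obtain ⟨t, ⟨-, ht⟩, rfl⟩ := hs
    intro y hy z hz
    obtain ⟨x, hx, rfl⟩ := Finset.mem_image.1 hy
    obtain ⟨x', hx', rfl⟩ := Finset.mem_image.1 hz
    by_cases h : x = x'
    · exact Or.inl (congrArg quotProj h)
    · rcases ht hx hx' h with h' | h'
      · rcases eq_or_incident_of_subset h'.slopesOf_subset with h' | h'
        · exact Or.inl h'.symm
        · exact Or.inr (Or.inr h')
      · rcases eq_or_incident_of_subset h'.slopesOf_subset with h' | h'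
        · exact Or.inl h'
        · exact Or.inr (Or.inl h')
  · rintro ⟨hne, hs⟩
    let E := Equiv.ofBijective _ quotProj_bijective
    have hE : ∀ y, quotProj (E.symm y) = y := E.apply_symm_apply
    refine ⟨s.image E.symm, ⟨hne.image _, ?_⟩, ?_⟩
    · intro x hx x' hx' hxx'
      obtain ⟨y, hy, rfl⟩ := Finset.mem_image.1 (Finset.mem_coe.1 hx)
      obtain ⟨z, hz, rfl⟩ := Finset.mem_image.1 (Finset.mem_coe.1 hx')
      rcases hs y hy z hz with rfl | h | h
      · exact absurd rfl hxx'
      · exact Or.inr (collapsesTo_of_incident (by rwa [hE, hE]))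
      · exact Or.inl (collapsesTo_of_incident (by rwa [hE, hE]))
    · change (s.image E.symm).image quotProj = s
      rw [Finset.image_image]
      exact (Finset.image_congr fun y _ => hE y).trans Finset.image_id'

/-- A simplex of the quotient containing `y` lifts to one containing some vertex above `y`;
injectivity of the projection plays no role. -/
lemma quotStar_eq_closedStar (y : QuotVertex 2) : quotStar y = closedStar (QuotSpine 2) y := by
  classical
  refine PreAbstractSimplicialComplex.ext (Set.ext fun s => ?_)
  rw [quotStar, mem_iSup_faces]
  constructor
  · rintro ⟨x, rfl, u, ⟨hu, t, ht, hxt, hut⟩, rfl⟩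
    exact ⟨hu.image _, t.image quotProj, ⟨t, ht, by congr⟩, Finset.mem_image_of_mem _ hxt,
      (by convert Finset.image_subset_image hut)⟩
  · rintro ⟨hs, t, ⟨t, ht, rfl⟩, hyt, hst⟩
    obtain ⟨x, hx, rfl⟩ := Finset.mem_image.1 hyt
    obtain ⟨u, hu, rfl⟩ := Finset.subset_image_iff.1 hst
    exact ⟨x, rfl, u, ⟨Finset.image_nonempty.1 hs, t, ht, hx, hu⟩, by congr⟩

lemma IsRose.quotStar_eq {ρ : QuotVertex 2} (hρ : IsRose ρ) : quotStar ρ = roseOrder.star ρ := by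
  classical
  rw [quotStar_eq_closedStar]
  refine PreAbstractSimplicialComplex.ext (Set.ext fun s => ?_)
  constructor
  · rintro ⟨hs, t, ht, hρt, hst⟩
    obtain ⟨-, ht⟩ := mem_quotSpine_faces.1 ht
    have hinc : ∀ θ ∈ t, θ = ρ ∨ Incident ρ θ := fun θ hθ => by
      rcases ht θ hθ ρ hρt with h | h | h
      · exact Or.inl h
      · exact absurd hρ h.2.1
      · exact Or.inr h
    refine ⟨hs, ?_⟩
    by_cases h : ∃ θ ∈ t, Incident ρ θ
    · obtain ⟨θ, hθt, hθ⟩ := h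
      refine ⟨θ, hθ, fun x hx => ?_⟩
      rcases hinc x (hst hx) with rfl | hx'
      · exact Or.inl rfl
      · rcases ht x (hst hx) θ hθt with h | h | h
        · exact Or.inr h
        · exact absurd h.1 hx'.2.1
        · exact absurd h.1 hθ.2.1
    · obtain ⟨θ₁, θ₂, -, hiff⟩ := roseOrder.arms ρ hρ
      exact ⟨θ₁, (hiff θ₁).2 (Or.inl rfl), fun x hx =>
        Or.inl ((hinc x (hst hx)).resolve_right fun h' => h ⟨x, hst hx, h'⟩)⟩
  · rintro ⟨hs, θ, hθ, hsub⟩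
    have hθ' : Incident ρ θ := hθ
    refine ⟨hs, {ρ, θ}, mem_quotSpine_faces.2 ⟨by simp, ?_⟩, by simp, fun x hx => ?_⟩
    · intro y hy z hz
      rw [Finset.mem_insert, Finset.mem_singleton] at hy hz
      rcases hy with rfl | rfl <;> rcases hz with rfl | rfl
      · exact Or.inl rfl
      · exact Or.inr (Or.inl hθ')
      · exact Or.inr (Or.inr hθ')
      · exact Or.inl rfl
    · simpa using hsub hx

lemma iSup_quotStar_eq {S : Set (QuotVertex 2)} (hS : ∀ ρ ∈ S, IsRose ρ) :
    (⨆ ρ ∈ S, quotStar ρ) = ⨆ ρ ∈ S, roseOrder.star ρ :=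
  iSup_congr fun ρ => iSup_congr fun hρ => (hS ρ hρ).quotStar_eq

/-- A simplex without a rose is a single theta vertex, which lies in the star of any rose it
collapses to. -/
lemma iSup_quotStar_isRose : (⨆ ρ ∈ {ρ | IsRose ρ}, quotStar ρ) = QuotSpine 2 := by
  refine PreAbstractSimplicialComplex.ext (Set.ext fun s => ?_)
  rw [mem_iSup_faces]
  constructor
  · rintro ⟨ρ, -, hs⟩
    rw [quotStar_eq_closedStar] at hs
    obtain ⟨hne, t, ht, -, hst⟩ := hs
    exact ((QuotSpine 2).isRelLowerSet_faces ht).2 hst hne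
  · intro hs
    obtain ⟨hne, hs'⟩ := mem_quotSpine_faces.1 hs
    by_cases h : ∃ ρ ∈ s, IsRose ρ
    · obtain ⟨ρ, hρs, hρ⟩ := h
      refine ⟨ρ, hρ, ?_⟩
      rw [quotStar_eq_closedStar]
      exact ⟨hne, s, hs, hρs, subset_rfl⟩
    · obtain ⟨θ, hθ⟩ := hne
      have hnr : ∀ x ∈ s, ¬ IsRose x := fun x hx hr => h ⟨x, hx, hr⟩
      obtain ⟨ρ, hρ, -⟩ := roseOrder.bottom θ (hnr θ hθ)
      refine ⟨ρ, hρ.1, ?_⟩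
      rw [IsRose.quotStar_eq hρ.1]
      refine ⟨⟨θ, hθ⟩, θ, hρ, fun x hx => Or.inr ?_⟩
      rcases hs' x hx θ hθ with h' | h' | h'
      · exact h'
      · exact absurd h'.1 (hnr x hx)
      · exact absurd h'.1 (hnr θ hθ)

lemma isTreeComplex_iSup_quotStar {S : Set (QuotVertex 2)} (hne : S.Nonempty)
    (hS : ∀ ρ ∈ S, IsRose ρ) (hdown : ∀ ρ ∈ S, ∀ σ, RoseLT σ ρ → σ ∈ S) :
    IsTreeComplex (⨆ ρ ∈ S, quotStar ρ) := by
  rw [iSup_quotStar_eq hS]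
  exact roseOrder.isTreeComplex_iSup_star hne hS fun ρ hρ σ hσ hlt =>
    hdown ρ hρ σ (roseLT_iff.2 ⟨hσ, hS ρ hρ, hlt⟩)

lemma isTreeComplex_quotSpine : IsTreeComplex (QuotSpine 2) := by
  rw [← iSup_quotStar_isRose]
  exact isTreeComplex_iSup_quotStar ⟨_, roseOrder.rose_root⟩ (fun _ h => h)
    fun _ _ _ h => (roseLT_iff.1 h).1

lemma IsTreeComplex.of_map {V W : Type*} [DecidableEq W] {K : PreAbstractSimplicialComplex V}
    {f : V → W} (hf : Function.Injective f) (h : IsTreeComplex (K.map f)) : IsTreeComplex K := by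
  have hmem : ∀ s : Finset V, s.image f ∈ (K.map f).faces ↔ s ∈ K.faces := fun s =>
    (Finset.image_injective hf).mem_set_image
  refine ⟨fun s hs => ?_, ?_⟩
  · rw [← Finset.card_image_of_injective s hf]
    exact h.1 _ ((hmem s).2 hs)
  · let g : {v : V // {v} ∈ K.faces} → {w : W // {w} ∈ (K.map f).faces} := fun v =>
      ⟨f v.1, by rw [← Finset.image_singleton, hmem]; exact v.2⟩
    have hg : Function.Bijective g := by
      refine ⟨fun u v huv => Subtype.ext (hf (congrArg Subtype.val huv)), ?_⟩
      rintro ⟨w, s, hs, hw⟩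
      have hw' : s.image f = {w} := hw
      obtain ⟨v, hv, rfl⟩ : ∃ v ∈ s, f v = w :=
        Finset.mem_image.1 (hw' ▸ Finset.mem_singleton_self w)
      exact ⟨⟨v, (K.isRelLowerSet_faces hs).2 (Finset.singleton_subset_iff.2 hv)
        (Finset.singleton_nonempty v)⟩, rfl⟩
    let i : oneSkeleton K ≃g oneSkeleton (K.map f) :=
      { Equiv.ofBijective g hg with
        map_rel_iff' := by
          intro u v
          change (g u ≠ g v ∧ ∃ s ∈ (K.map f).faces, f u.1 ∈ s ∧ f v.1 ∈ s) ↔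
            u ≠ v ∧ ∃ s ∈ K.faces, u.1 ∈ s ∧ v.1 ∈ s
          rw [hg.1.ne_iff]
          refine and_congr_right fun _ => ⟨?_, ?_⟩
          · rintro ⟨_, ⟨s, hs, rfl⟩, hu, hv⟩
            exact ⟨s, hs, (hf.mem_finset_image).1 hu, (hf.mem_finset_image).1 hv⟩
          · rintro ⟨s, hs, hu, hv⟩
            exact ⟨_, ⟨s, hs, rfl⟩, Finset.mem_image_of_mem f hu, Finset.mem_image_of_mem f hv⟩ }
    exact i.isTree_iff.2 h.2

lemma isTreeComplex_spine : IsTreeComplex (Spine 2) := by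
  classical
  exact IsTreeComplex.of_map quotProj_injective isTreeComplex_quotSpine

/-! ### Duality with the Farey graph -/

open Classical in
/-- The slopes of a vertex, as a finite set. -/
noncomputable def slopeFinset (y : QuotVertex 2) : Finset (OnePoint ℚ) := (slopesOf_finite y).toFinset

lemma coe_slopeFinset (y : QuotVertex 2) : (slopeFinset y : Set (OnePoint ℚ)) = slopesOf y :=
  (slopesOf_finite y).coe_toFinset

lemma card_slopeFinset (y : QuotVertex 2) : (slopeFinset y).card = (slopesOf y).ncard := by
  rw [← coe_slopeFinset, Set.ncard_coe_finset]

lemma isClique_slopesOf (y : QuotVertex 2) : fareyGraph.IsClique (slopesOf y) := by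
  have key : ∀ {v w : Fin 2 → ℤ}, Unimod v w → fareyGraph.IsClique (triSlopes v w) :=
    fun h p hp q hq hne => h.adj_of_mem_triSlopes hp hq hne
  by_cases h : IsRose y
  · obtain ⟨v, w, h, hs⟩ := h.exists_unimod
    rw [hs]
    exact (key h).subset (pairSlopes_subset_triSlopes v w)
  · obtain ⟨v, w, h, hs⟩ := exists_unimod_of_not_isRose h
    rw [hs]
    exact key h

lemma isNClique_two_slopeFinset_iff {y : QuotVertex 2} :
    IsRose y ↔ fareyGraph.IsNClique 2 (slopeFinset y) := by
  rw [SimpleGraph.isNClique_iff, card_slopeFinset, coe_slopeFinset,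
    and_iff_right (isClique_slopesOf y)]
  refine ⟨fun h => h.ncard_slopesOf, fun h => ?_⟩
  by_contra h'
  rw [ncard_slopesOf_of_not_isRose h'] at h
  omega

lemma slopeFinset_isNClique (y : QuotVertex 2) :
    fareyGraph.IsNClique 2 (slopeFinset y) ∨ fareyGraph.IsNClique 3 (slopeFinset y) := by
  by_cases h : IsRose y
  · exact Or.inl (isNClique_two_slopeFinset_iff.1 h)
  · right
    rw [SimpleGraph.isNClique_iff, card_slopeFinset, coe_slopeFinset]
    exact ⟨isClique_slopesOf y, ncard_slopesOf_of_not_isRose h⟩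

/-- Surjectivity onto Farey cells: the third vertex of a 3-clique over the edge v, w is the slope of
v + w or v - w. -/
lemma exists_slopesOf_eq (c : FareyCell) : ∃ y, slopesOf y = (c.1 : Set (OnePoint ℚ)) := by
  classical
  obtain ⟨s, hs | hs⟩ := c
  · obtain ⟨hc, h2⟩ := (SimpleGraph.isNClique_iff _).1 hs
    obtain ⟨p, q, hpq, rfl⟩ := Finset.card_eq_two.1 h2
    have hadj : fareyGraph.Adj p q := hc (by simp) (by simp) hpq
    obtain ⟨v, hv, rfl⟩ := exists_isCoprime_fareySlope_eq p
    obtain ⟨w, hw, rfl⟩ := exists_isCoprime_fareySlope_eq q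
    obtain ⟨y, -, hy⟩ := exists_rose ((fareyGraph_adj_iff hv hw).1 hadj)
    exact ⟨y, by rw [hy]; simp [pairSlopes]⟩
  · obtain ⟨p, q, r, hpq, hpr, hqr, rfl⟩ := SimpleGraph.is3Clique_iff.1 hs
    obtain ⟨v, hv, rfl⟩ := exists_isCoprime_fareySlope_eq p
    obtain ⟨w, hw, rfl⟩ := exists_isCoprime_fareySlope_eq q
    have h := (fareyGraph_adj_iff hv hw).1 hpq
    rcases h.eq_of_adj hpr hqr with rfl | rfl
    · obtain ⟨y, -, hy⟩ := exists_theta h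
      exact ⟨y, by rw [hy]; simp [triSlopes]⟩
    · obtain ⟨y, -, hy⟩ := exists_theta h.neg_right
      exact ⟨y, by rw [hy]; simp [triSlopes, fareySlope_neg]⟩

/-- The vertices of the spine correspond to the edges and triangles of the Farey graph. -/
noncomputable def fareyEquiv : QuotVertex 2 ≃ FareyCell :=
  Equiv.ofBijective (fun y => ⟨slopeFinset y, slopeFinset_isNClique y⟩) (by
    constructor
    · intro y z h
      apply slopesOf_injective
      have h' : slopeFinset y = slopeFinset z := congrArg Subtype.val h
      rw [← coe_slopeFinset, ← coe_slopeFinset, h']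
    · intro c
      obtain ⟨y, hy⟩ := exists_slopesOf_eq c
      exact ⟨y, Subtype.ext (Finset.coe_injective ((coe_slopeFinset y).trans hy))⟩)

lemma exists_face_iff {y z : QuotVertex 2} : (∃ s ∈ (QuotSpine 2).faces, y ∈ s ∧ z ∈ s) ↔
    slopeFinset y ⊆ slopeFinset z ∨ slopeFinset z ⊆ slopeFinset y := by
  classical
  rw [← Finset.coe_subset, ← Finset.coe_subset, coe_slopeFinset, coe_slopeFinset]
  constructor
  · rintro ⟨s, hs, hy, hz⟩
    rcases (mem_quotSpine_faces.1 hs).2 y hy z hz with rfl | h | h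
    · exact Or.inl subset_rfl
    · exact Or.inl h.2.2
    · exact Or.inr h.2.2
  · intro h
    have h' : y = z ∨ Incident y z ∨ Incident z y := by
      rcases h with h | h <;> rcases eq_or_incident_of_subset h with h | h <;> tauto
    refine ⟨{y, z}, mem_quotSpine_faces.2 ⟨by simp, ?_⟩, by simp, by simp⟩
    intro a ha b hb
    rw [Finset.mem_insert, Finset.mem_singleton] at ha hb
    rcases ha with rfl | rfl <;> rcases hb with rfl | rfl
    · exact Or.inl rfl
    · exact h'
    · tauto
    · exact Or.inl rfl

lemma descendingLink_eq {ρ : QuotVertex 2} (hρ : IsRose ρ) : descendingLink ρ =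
    roseOrder.star ρ ⊓ ⨆ σ ∈ {σ | roseOrder.Rose σ ∧ roseOrder.norm σ < roseOrder.norm ρ},
      roseOrder.star σ := by
  rw [descendingLink, hρ.quotStar_eq, iSup_quotStar_eq (S := {σ | RoseLT σ ρ}) fun σ hσ => (roseLT_iff.1 hσ).1]
  have : {σ | RoseLT σ ρ} = {σ | roseOrder.Rose σ ∧ roseOrder.norm σ < roseOrder.norm ρ} :=
    Set.ext fun σ => roseLT_iff.trans (and_congr_right fun _ => and_iff_right hρ)
  rw [this]

end OutFn

/-! ### Assembly of the theorem. -/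

theorem mainTheorem8 :
    -- the Torelli group is trivial
    Torelli 2 = ⊥ ∧
    -- `X_2 = Y_2`, and this complex is a tree
    Function.Bijective (quotProj : SpineVertex 2 → QuotVertex 2) ∧
    IsTreeComplex (Spine 2) ∧
    IsTreeComplex (QuotSpine 2) ∧
    -- the star of a rose is an arc centred at the rose, and it meets the other stars exactly in
    -- the two endpoints of this arc
    (∀ ρ : QuotVertex 2, IsRose ρ → ∃ θ₁ θ₂ : QuotVertex 2, θ₁ ≠ θ₂ ∧ θ₁ ≠ ρ ∧ θ₂ ≠ ρ ∧
      (quotStar ρ).faces = {s : Finset (QuotVertex 2) | s.Nonempty ∧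
        ((s : Set (QuotVertex 2)) ⊆ {ρ, θ₁} ∨ (s : Set (QuotVertex 2)) ⊆ {ρ, θ₂})} ∧
      (quotStar ρ ⊓ ⨆ σ ∈ {σ | IsRose σ ∧ σ ≠ ρ}, quotStar σ).faces = {{θ₁}, {θ₂}}) ∧
    -- the descending link of a rose is a single point, except for the rose with the identity
    -- marking, whose descending link is empty
    (∀ ρ : QuotVertex 2, IsRose ρ →
      (HasMarkingMatrix ρ 1 → (descendingLink ρ).faces = ∅) ∧
      (¬ HasMarkingMatrix ρ 1 → ∃ θ, (descendingLink ρ).faces = {{θ}})) ∧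
    -- every nonempty initial segment is a tree, and the stars of the roses cover the complex
    (∀ S : Set (QuotVertex 2), S.Nonempty → (∀ ρ ∈ S, IsRose ρ) →
      (∀ ρ ∈ S, ∀ σ, RoseLT σ ρ → σ ∈ S) → IsTreeComplex (⨆ ρ ∈ S, quotStar ρ)) ∧
    (⨆ ρ ∈ {ρ | IsRose ρ}, quotStar ρ) = QuotSpine 2 ∧
    -- the tree is dual to the Farey graph
    (∃ Φ : QuotVertex 2 ≃ FareyCell,
      (∀ X : MarkedGraph 2,
        ((Φ X.toQuot).1 : Set (OnePoint ℚ)) = Set.range fun d => fareySlope (X.label d)) ∧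
      (∀ ρ, IsRose ρ ↔ fareyGraph.IsNClique 2 (Φ ρ).1) ∧
      (∀ ρ (a b c d : ℤ), HasMarkingMatrix ρ !![a, b; c, d] →
        ((Φ ρ).1 : Set (OnePoint ℚ)) = {fareySlope ![a, b], fareySlope ![c, d]}) ∧
      (∀ y z, (∃ s ∈ (QuotSpine 2).faces, y ∈ s ∧ z ∈ s) ↔
        (Φ y).1 ⊆ (Φ z).1 ∨ (Φ z).1 ⊆ (Φ y).1)) := by
  refine ⟨torelli_two_eq_bot, quotProj_bijective, isTreeComplex_spine, isTreeComplex_quotSpine,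
    fun ρ hρ => ?_, fun ρ hρ => ⟨fun h => ?_, fun h => ?_⟩,
    fun S hne hS hdown => isTreeComplex_iSup_quotStar hne hS hdown, iSup_quotStar_isRose,
    fareyEquiv, fun X => ?_, fun ρ => isNClique_two_slopeFinset_iff, fun ρ a b c d h => ?_,
    fun y z => exists_face_iff⟩
  · obtain ⟨θ₁, θ₂, hne, hiff⟩ := roseOrder.arms ρ hρ
    have h₁ : Incident ρ θ₁ := (hiff θ₁).2 (Or.inl rfl)
    have h₂ : Incident ρ θ₂ := (hiff θ₂).2 (Or.inr rfl)
    refine ⟨θ₁, θ₂, hne, fun h => h₁.2.1 (h ▸ hρ), fun h => h₂.2.1 (h ▸ hρ), ?_, ?_⟩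
    · rw [hρ.quotStar_eq, roseOrder.star_faces hiff]
    · rw [hρ.quotStar_eq, iSup_quotStar_eq fun σ hσ => hσ.1]
      exact roseOrder.star_inf_iSup_star hρ hiff
  · rw [descendingLink_eq hρ, hasMarkingMatrix_one_iff.1 h]
    exact roseOrder.descending_root
  · rw [descendingLink_eq hρ]
    exact roseOrder.exists_descending hρ fun h' => h (hasMarkingMatrix_one_iff.2 h')
  · exact (coe_slopeFinset X.toQuot).trans (slopesOf_toQuot X)
  · exact (coe_slopeFinset ρ).trans (hasMarkingMatrix_iff.1 h).2
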